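/- Let $\alpha>\tfrac12$, $\kappa_0>0$, and let $f\in L^\infty(\mathbb R)$ be real-valued with $\operatorname{supp} f\subset[0,1]$. Let $\{\omega(j)\}_{j\ge1}$ be real random variables on a probability space and consider the random potential $V(t)=\sum_{j\ge1}\frac{\omega(j)}{j^{\alpha}}f(t-j)$ for $t\ge0$. For $\kappa>0$ let $\theta_t(\kappa)$ be the Prüfer phase: if $\psi$ solves $-\psi''+V\psi=\kappa^2\psi$ on $[0,\infty)$ with $\psi(0)=0$, $\psi'(0)=\kappa$, then $$\begin{pmatrix}\psi(t)\\ \psi'(t)/\kappa\end{pmatrix}=r_t(\kappa)\begin{pmatrix}\sin\theta_t(\kappa)\\ \cos\theta_t(\kappa)\end{pmatrix},\qquad r_t(\kappa)>0,$$ with $t\mapsto\theta_t(\kappa)$ continuous and $\theta_0(\kappa)=0$. For real $n>0$ and $c\in\mathbb R$ with $\kappa_0+c/n>0$ set $$\Theta^{(n)}(c)=\theta_n\Bigl(\kappa_0+\frac cn\Bigr)-\theta_n(\kappa_0).$$ (1) Suppose (assumption A) that the $\omega(j)$ are i.i.d. with $|\omega(j)|\le1$, $\mathbf E[\omega(j)]=0$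 and $\mathbf E[\omega(j)^2]>0$. Then almost surely, for all $c\in\mathbb R$, $\Theta^{(n)}(c)\to c$ as $n\to\infty$, $n\in\mathbb N$. (2) Suppose (assumption B) that $|\omega(j)|\le1$, that $\{\omega(j)\}_{j\ge1}$ is adapted to a filtration $\{\mathcal F_j\}_{j\ge1}$, and that for some $\rho>0$ one has $|\mathbf E[\omega(j)\mid\mathcal F_k]|\le e^{-\rho|j-k|}$ almost surely for all $1\le k<j$. Let $0<\eta<\alpha-\tfrac12$ and let $\beta>0$ satisfy $2\eta\beta>1$. Then almost surely, for all $c\in\mathbb R$, $\Theta^{(k^\beta)}(c)\to c$ as $k\to\infty$, $k\in\mathbb N$. -/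

import Mathlib

open MeasureTheory ProbabilityTheory Filter Topology Set

namespace ClockStatistics

noncomputable section

/-- The alloy-type decaying potential `V(t) = ∑_{j ≥ 1} x(j) j^{-α} f(t - j)` on the half line,
for a sequence of amplitudes `x(1), x(2), …` (the value `x 0` is never used).
When `f` is supported in `[0, 1]`, at most two terms are nonzero at each `t`. -/
def alloyPotential (f : ℝ → ℝ) (α : ℝ) (x : ℕ → ℝ) (t : ℝ) : ℝ :=
  ∑' j : ℕ, x (j + 1) / ((j + 1 : ℕ) : ℝ) ^ α * f (t - ((j + 1 : ℕ) : ℝ))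

/-- `ψ`, with derivative `ψ'`, solves `-ψ'' + V ψ = κ² ψ` on `[0, ∞)` with `ψ(0) = 0`.
As `V` is only locally bounded and measurable, the equation is understood in the usual sense:
`ψ` is differentiable and `ψ'` is the integral of `(V - κ²) ψ`. -/
structure IsDirichletSolution (V : ℝ → ℝ) (κ : ℝ) (ψ ψ' : ℝ → ℝ) : Prop where
  zero : ψ 0 = 0
  hasDeriv : ∀ t, 0 ≤ t → HasDerivWithinAt ψ (ψ' t) (Ici 0) t
  integrable : ∀ t, 0 ≤ t →
    IntervalIntegrable (fun s => (V s - κ ^ 2) * ψ s) volume 0 t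
  eqn : ∀ t, 0 ≤ t → ψ' t = ψ' 0 + ∫ s in (0 : ℝ)..t, (V s - κ ^ 2) * ψ s

/-- `θ` is the Prüfer phase at momentum `κ` for the potential `V`: for a solution `ψ` of the
Dirichlet problem one has `(ψ, ψ' / κ) = r (sin θ, cos θ)` on `[0, ∞)`, where `r > 0`, `θ` is
continuous, and `r 0 = 1`, `θ 0 = 0`. -/
def IsPruferPhase (V : ℝ → ℝ) (κ : ℝ) (θ : ℝ → ℝ) : Prop :=
  ContinuousOn θ (Ici 0) ∧ θ 0 = 0 ∧
    ∃ ψ ψ' r : ℝ → ℝ, IsDirichletSolution V κ ψ ψ' ∧ r 0 = 1 ∧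
      ∀ t, 0 ≤ t → 0 < r t ∧ ψ t = r t * Real.sin (θ t) ∧ ψ' t / κ = r t * Real.cos (θ t)

open Classical in
/-- The Prüfer phase `θ_t(κ)`. For a locally bounded measurable `V` and `κ > 0` there is exactly
one Prüfer phase on `[0, ∞)`; the value `0` in the other case is a convention only. -/
def pruferPhase (V : ℝ → ℝ) (κ t : ℝ) : ℝ :=
  if h : ∃ θ : ℝ → ℝ, IsPruferPhase V κ θ then h.choose t else 0

/-- The relative Prüfer phase `Θ^{(n)}(c) = θ_n(κ₀ + c / n) - θ_n(κ₀)`, for real `n`. -/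
def relativePhase (V : ℝ → ℝ) (κ₀ n c : ℝ) : ℝ :=
  pruferPhase V (κ₀ + c / n) n - pruferPhase V κ₀ n

/-- Assumption A: `ω(1), ω(2), …` are i.i.d. with `|ω(j)| ≤ 1`, mean zero, and
nonzero variance. -/
structure AssumptionA {Ω : Type*} [MeasurableSpace Ω] (μ : Measure Ω) (ω : ℕ → Ω → ℝ) :
    Prop where
  measurable : ∀ j, 1 ≤ j → Measurable (ω j)
  indep : iIndepFun (fun j : ℕ => ω (j + 1)) μ
  identDistrib : ∀ j, 1 ≤ j → IdentDistrib (ω j) (ω 1) μ μ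
  bounded : ∀ j, 1 ≤ j → ∀ᵐ w ∂μ, |ω j w| ≤ 1
  mean_zero : ∀ j, 1 ≤ j → ∫ w, ω j w ∂μ = 0
  variance_pos : ∀ j, 1 ≤ j → 0 < ∫ w, ω j w ^ 2 ∂μ

/-- Assumption B: `ω(1), ω(2), …` is a process adapted to a filtration `(ℱ_j)_{j ≥ 1}`, with
`|ω(j)| ≤ 1` and `|E[ω(j) | ℱ_k]| ≤ e^{-ρ |j - k|}` for `k < j`, where `ρ > 0`.
(The σ-algebra `ℱ 0` is not used.) -/
structure AssumptionB {Ω : Type*} [mΩ : MeasurableSpace Ω] (μ : Measure Ω) (ω : ℕ → Ω → ℝ)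
    (ℱ : Filtration ℕ mΩ) (ρ : ℝ) : Prop where
  rate_pos : 0 < ρ
  adapted : ∀ j, 1 ≤ j → Measurable[ℱ j] (ω j)
  bounded : ∀ j, 1 ≤ j → ∀ᵐ w ∂μ, |ω j w| ≤ 1
  decay : ∀ k j, 1 ≤ k → k < j →
    ∀ᵐ w ∂μ, |(μ[ω j | ℱ k]) w| ≤ Real.exp (-ρ * |(j : ℝ) - (k : ℝ)|)

end

end ClockStatistics

/-! ### The Prüfer equation: existence of phases and their Dirichlet solutions -/

namespace ClockStatistics

/-! Put δ = c/n and let Δ be the difference of the phases at the momenta κ₀ + δ and κ₀. Without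
potential Δ = δt, which is c at t = n, so the random potential has to be shown to disturb this by
o(1). Over the cell with coupling v = ω(j) j^{-α}, the Prüfer equation θ' = κ - (V/κ) sin²θ gives
the increment δ + v Re(z - z₀) + O(j^{-α}|δ| + j^{-2α}|Δ|), where z = a(κ) e^{2iθ} and z₀ is the
same quantity at κ₀ (`IsPhaseStep.abs_increment_sub_le`, collected in `exists_coupledCells`). Since
|z - z₀| is at most a constant times |Δ| + |δ|, all errors are linear in the small quantities Δ and
δ.

The amplitudes need not be centred given the past, but their predictions decay geometrically. As z
turns by the nearly constant factor p = e^{2iκ} per cell, the corrector X_k = ∑ p^m E[ω(k+m) | past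
k] solves ω(k) = X_k - p X_{k+1} + p · (innovation) (`eq_corrector_sub_add_innovation`). Summation
by parts against the slowly varying v z turns ∑ v ω Re(z - z₀) into a martingale, boundary terms,
and errors summable against v² (`CoupledCells.abs_step_le`). Because ∑ v² < ∞, i.e. α > 1/2, a
discrete Grönwall argument yields E Δ_m² ≤ A (m+1)² δ². Doob's inequality then bounds the
probability of max_{m ≤ N} |Δ_m - (m+1)δ| ≥ ε by A δ² ε⁻² N^{3-2α}
(`exists_measureReal_deviation_le`, `sum_coupling_le`). For δ of order 1/N this is of order
N^{1-2α}, which tends to 0.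

Along the scales N of order k^b, with b(2α-1) ≥ 2, these bounds are summable, so Borel–Cantelli
gives convergence for all rational c. The maximal bound fills in the times between consecutive
scales. The phase is increasing in κ up to an error vanishing at κ₀ (`pruferPhase_le_add`), so real
c is squeezed between rationals (`tendsto_of_forall_rat_scale`). The outcome is almost sure
convergence along all real times (`ae_tendsto_relativePhase_of_memLp`), and both assertions are
restrictions of it to sequences tending to infinity. -/

/-- Grönwall's inequality in integral form. -/
lemma le_mul_exp_of_le_add_integral {u : ℝ → ℝ} {A K a b : ℝ} (hK : 0 ≤ K)
    (hu : ContinuousOn u (Icc a b))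
    (h : ∀ t ∈ Icc a b, u t ≤ A + K * ∫ s in a..t, u s) :
    ∀ t ∈ Icc a b, u t ≤ A * Real.exp (K * (t - a)) := by
  intro t ht
  have hab : a ≤ b := ht.1.trans ht.2
  set w : ℝ → ℝ := IccExtend hab (fun x : Icc a b => u x) with hw
  have hwc : Continuous w := (continuousOn_iff_continuous_domRestrict.1 hu).Icc_extend'
  have hwu : ∀ s ∈ Icc a b, w s = u s := fun s hs => IccExtend_of_mem hab _ hs
  have hint : ∀ s ∈ Icc a b, ∫ x in a..s, w x = ∫ x in a..s, u x := by
    intro s hs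
    refine intervalIntegral.integral_congr fun x hx => hwu x ?_
    rw [uIcc_of_le hs.1] at hx
    exact ⟨hx.1, hx.2.trans hs.2⟩
  have hd : ∀ x, HasDerivAt (fun t => A + K * ∫ s in a..t, w s) (K * w x) x := fun x =>
    ((intervalIntegral.integral_hasDerivAt_right (hwc.intervalIntegrable _ _)
      (hwc.stronglyMeasurableAtFilter _ _) hwc.continuousAt).const_mul K).const_add A
  have hg := le_gronwallBound_of_liminf_deriv_right_le (f := fun t => A + K * ∫ s in a..t, w s)
    (f' := fun x => K * w x) (δ := A) (K := K) (ε := 0) (a := a) (b := b)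
    (fun x _ => (hd x).continuousAt.continuousWithinAt)
    (fun x _ r hr => (hd x).hasDerivWithinAt.liminf_right_slope_le hr) (by simp)
    (fun x hx => by
      have hx' : x ∈ Icc a b := ⟨hx.1, hx.2.le⟩
      have := h x hx'
      rw [← hint x hx', ← hwu x hx'] at this
      simpa using mul_le_mul_of_nonneg_left this hK) t ht
  rw [gronwallBound_ε0] at hg
  have := h t ht
  rw [← hint t ht] at this
  exact this.trans hg

lemma abs_sin_sq_sub_sin_sq_le (x y : ℝ) :
    |Real.sin x ^ 2 - Real.sin y ^ 2| ≤ |x - y| := by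
  have : Real.sin x ^ 2 - Real.sin y ^ 2 = Real.sin (x + y) * Real.sin (x - y) := by
    rw [Real.sin_add, Real.sin_sub]
    have h1 := Real.sin_sq_add_cos_sq x
    have h2 := Real.sin_sq_add_cos_sq y
    linear_combination (Real.sin y ^ 2) * h1 - (Real.sin x ^ 2) * h2
  rw [this, abs_mul]
  calc |Real.sin (x + y)| * |Real.sin (x - y)| ≤ 1 * |x - y| :=
        mul_le_mul (Real.abs_sin_le_one _) Real.abs_sin_le_abs (abs_nonneg _) zero_le_one
    _ = |x - y| := one_mul _

/-- A bounded measurable function is interval integrable. -/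
lemma intervalIntegrable_of_bound {g : ℝ → ℝ} (hg : Measurable g) {B : ℝ}
    (hB : ∀ t, |g t| ≤ B) (a b : ℝ) : IntervalIntegrable g volume a b :=
  (intervalIntegrable_const (c := B)).mono_fun hg.aestronglyMeasurable
    (ae_of_all _ fun t => by
      simpa [Real.norm_eq_abs] using (hB t).trans (le_abs_self B))

/-- Carathéodory existence for the phase equation `y' = a + q sin² y`, `y 0 = 0`. -/
lemma exists_phase (a : ℝ) {q : ℝ → ℝ} (hq : Measurable q) {B : ℝ} (hB : ∀ t, |q t| ≤ B) :
    ∃ y : ℝ → ℝ, Continuous y ∧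
      ∀ t, 0 ≤ t → y t = a * t + ∫ s in (0 : ℝ)..t, q s * Real.sin (y s) ^ 2 := by
  have hB0 : 0 ≤ B := (abs_nonneg _).trans (hB 0)
  -- Weight of a Bielecki norm: the right side is `B`-Lipschitz in the phase, so the Picard map
  -- contracts by B / L ≤ 1/2 on the whole half line at once. The unknown is g = exp(-L t)(y - a t).
  set L : ℝ := 2 * B + 1 with hL
  have hLpos : 0 < L := by positivity
  let P : (BoundedContinuousFunction ℝ ℝ) → ℝ → ℝ := fun g s =>
    q s * Real.sin (a * s + Real.exp (L * s) * g s) ^ 2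
  have hPm : ∀ g, Measurable (P g) := fun g => by
    have : Measurable g := g.continuous.measurable
    fun_prop
  have hPb : ∀ g s, |P g s| ≤ B := fun g s => by
    have h1 : |Real.sin (a * s + Real.exp (L * s) * g s) ^ 2| ≤ 1 := by
      rw [abs_of_nonneg (sq_nonneg _)]; exact Real.sin_sq_le_one _
    calc |P g s| = |q s| * |Real.sin (a * s + Real.exp (L * s) * g s) ^ 2| := abs_mul _ _
      _ ≤ B * 1 := mul_le_mul (hB s) h1 (abs_nonneg _) hB0
      _ = B := mul_one B
  have hPi : ∀ g s t, IntervalIntegrable (P g) volume s t := fun g s t =>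
    intervalIntegrable_of_bound (hPm g) (hPb g) s t
  -- Replacing t by max t 0 extends the Picard map to negative times, where the weight would
  -- otherwise blow up.
  let F : (BoundedContinuousFunction ℝ ℝ) → ℝ → ℝ := fun g t =>
    Real.exp (-(L * max t 0)) * ∫ s in (0 : ℝ)..(max t 0), P g s
  have hFc : ∀ g, Continuous (F g) := fun g => by
    have h1 : Continuous fun t : ℝ => ∫ s in (0 : ℝ)..t, P g s :=
      intervalIntegral.continuous_primitive (hPi g) 0
    have h2 : Continuous fun t : ℝ => max t 0 := by fun_prop
    exact (Real.continuous_exp.comp (by fun_prop)).mul (h1.comp h2)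
  have hFb : ∀ g t, ‖F g t‖ ≤ B := fun g t => by
    have hm : 0 ≤ max t 0 := le_max_right _ _
    have h1 : ‖∫ s in (0 : ℝ)..(max t 0), P g s‖ ≤ B * |max t 0 - 0| :=
      intervalIntegral.norm_integral_le_of_norm_le_const fun s _ => hPb g s
    have h2 : L * max t 0 ≤ Real.exp (L * max t 0) :=
      (Real.add_one_le_exp _).trans' (by linarith)
    have h3 : max t 0 ≤ Real.exp (L * max t 0) := by
      refine le_trans ?_ h2
      nlinarith
    rw [norm_mul, Real.norm_eq_abs, abs_of_pos (Real.exp_pos _), Real.exp_neg]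
    rw [sub_zero, abs_of_nonneg hm] at h1
    calc (Real.exp (L * max t 0))⁻¹ * ‖∫ s in (0 : ℝ)..(max t 0), P g s‖
        ≤ (Real.exp (L * max t 0))⁻¹ * (B * Real.exp (L * max t 0)) := by
          gcongr
          exact h1.trans (by gcongr)
      _ = B := by field_simp
  let T : (BoundedContinuousFunction ℝ ℝ) → (BoundedContinuousFunction ℝ ℝ) := fun g =>
    BoundedContinuousFunction.ofNormedAddCommGroup (F g) (hFc g) B (hFb g)
  have hT : ContractingWith (1 / 2 : NNReal) T := by
    refine ⟨by rw [← NNReal.coe_lt_coe]; norm_num, LipschitzWith.of_dist_le_mul fun g h => ?_⟩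
    rw [BoundedContinuousFunction.dist_le (by positivity)]
    intro t
    have hm : 0 ≤ max t 0 := le_max_right _ _
    set m := max t 0 with hmdef
    set d := dist g h with hd
    have hd0 : 0 ≤ d := dist_nonneg
    have hpt : ∀ s, |P g s - P h s| ≤ B * d * Real.exp (L * s) := fun s => by
      have h1 : |g s - h s| ≤ d := g.dist_coe_le_dist s
      have h2 := abs_sin_sq_sub_sin_sq_le (a * s + Real.exp (L * s) * g s)
        (a * s + Real.exp (L * s) * h s)
      have h3 : a * s + Real.exp (L * s) * g s - (a * s + Real.exp (L * s) * h s)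
        = Real.exp (L * s) * (g s - h s) := by ring
      rw [h3, abs_mul, abs_of_pos (Real.exp_pos _)] at h2
      calc |P g s - P h s| = |q s| * |Real.sin (a * s + Real.exp (L * s) * g s) ^ 2
            - Real.sin (a * s + Real.exp (L * s) * h s) ^ 2| := by
            rw [← abs_mul, mul_sub]
        _ ≤ B * (Real.exp (L * s) * d) :=
            mul_le_mul (hB s) (h2.trans (by gcongr)) (abs_nonneg _) hB0
        _ = _ := by ring
    have hsub : F g t - F h t = Real.exp (-(L * m)) * ∫ s in (0 : ℝ)..m, (P g s - P h s) := by
      rw [intervalIntegral.integral_sub (hPi g _ _) (hPi h _ _)]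
      simp only [F, ← hmdef]
      ring
    have hexp : ∫ s in (0 : ℝ)..m, B * d * Real.exp (L * s)
        = B * d * ((Real.exp (L * m) - 1) / L) := by
      rw [intervalIntegral.integral_const_mul, intervalIntegral.integral_comp_mul_left (fun x => Real.exp x) hLpos.ne']
      simp [integral_exp, div_eq_inv_mul]
    have h1 : |∫ s in (0 : ℝ)..m, (P g s - P h s)| ≤ B * d * ((Real.exp (L * m) - 1) / L) := by
      rw [← hexp, ← Real.norm_eq_abs]
      refine intervalIntegral.norm_integral_le_of_norm_le hm (ae_of_all _ fun s _ => hpt s) ?_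
      exact Continuous.intervalIntegrable (by fun_prop) _ _
    change dist (F g t) (F h t) ≤ _
    rw [Real.dist_eq, hsub, abs_mul, abs_of_pos (Real.exp_pos _), Real.exp_neg]
    have hE : 0 < Real.exp (L * m) := Real.exp_pos _
    calc (Real.exp (L * m))⁻¹ * |∫ s in (0 : ℝ)..m, (P g s - P h s)|
        ≤ (Real.exp (L * m))⁻¹ * (B * d * (Real.exp (L * m) / L)) := by
          gcongr
          refine h1.trans ?_
          gcongr
          linarith
      _ = B / L * d := by field_simp
      _ ≤ ((1 / 2 : NNReal) : ℝ) * d := by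
          gcongr
          rw [div_le_iff₀ hLpos]
          push_cast
          rw [hL]; linarith
  let g := hT.fixedPoint T
  have hg : T g = g := hT.fixedPoint_isFixedPt
  refine ⟨fun t => a * t + Real.exp (L * t) * g t, by fun_prop, fun t ht => ?_⟩
  have h1 : g t = F g t := by
    conv_lhs => rw [← hg]
    rfl
  have h2 : F g t = Real.exp (-(L * t)) * ∫ s in (0 : ℝ)..t, P g s := by
    simp only [F, max_eq_left ht]
  simp only [add_right_inj]
  rw [h1, h2, ← mul_assoc, ← Real.exp_add, add_neg_cancel, Real.exp_zero, one_mul]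

lemma abs_integral_sub_integral_le {g : ℝ → ℝ} (hg : Measurable g) {B : ℝ}
    (hB : ∀ t, |g t| ≤ B) (s t : ℝ) :
    |(∫ x in (0 : ℝ)..t, g x) - ∫ x in (0 : ℝ)..s, g x| ≤ B * |t - s| := by
  have hi := intervalIntegrable_of_bound hg hB
  rw [intervalIntegral.integral_interval_sub_left (hi _ _) (hi _ _), ← Real.norm_eq_abs]
  exact intervalIntegral.norm_integral_le_of_norm_le_const fun x _ => hB x

lemma ae_hasDerivAt_integral_of_bound {g : ℝ → ℝ} (hg : Measurable g) {B : ℝ}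
    (hB : ∀ t, |g t| ≤ B) :
    ∀ᵐ x, HasDerivAt (fun t => ∫ s in (0 : ℝ)..t, g s) (g x) x := by
  have hl : LocallyIntegrable g volume :=
    (locallyIntegrable_const B).mono hg.aestronglyMeasurable
      (ae_of_all _ fun t => by
        simpa [Real.norm_eq_abs] using (hB t).trans (le_abs_self B))
  filter_upwards [LocallyIntegrable.ae_hasDerivAt_integral hl] with x hx using hx 0

lemma continuous_integral_of_bound {g : ℝ → ℝ} (hg : Measurable g) {B : ℝ}
    (hB : ∀ t, |g t| ≤ B) : Continuous fun t => ∫ s in (0 : ℝ)..t, g s :=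
  intervalIntegral.continuous_primitive (intervalIntegrable_of_bound hg hB) 0

/-- The fundamental theorem of calculus for `exp ℓ * S y`, where `y` and `ℓ` are primitives of
bounded measurable functions. -/
lemma exp_mul_comp_sub_eq_integral {g₁ g₂ : ℝ → ℝ} (h₁ : Measurable g₁) (h₂ : Measurable g₂)
    {B₁ B₂ : ℝ} (hB₁ : ∀ t, |g₁ t| ≤ B₁) (hB₂ : ∀ t, |g₂ t| ≤ B₂) {S S' : ℝ → ℝ}
    (hS : ∀ x, HasDerivAt S (S' x) x) (hSL : LipschitzWith 1 S) (t : ℝ) :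
    Real.exp (∫ s in (0 : ℝ)..t, g₂ s) * S (∫ s in (0 : ℝ)..t, g₁ s) - S 0
      = ∫ x in (0 : ℝ)..t, Real.exp (∫ s in (0 : ℝ)..x, g₂ s) *
          (g₂ x * S (∫ s in (0 : ℝ)..x, g₁ s) + g₁ x * S' (∫ s in (0 : ℝ)..x, g₁ s)) := by
  set y : ℝ → ℝ := fun t => ∫ s in (0 : ℝ)..t, g₁ s with hy
  set l : ℝ → ℝ := fun t => ∫ s in (0 : ℝ)..t, g₂ s with hl
  have hlip : ∀ {g : ℝ → ℝ} {B : ℝ}, Measurable g → (∀ t, |g t| ≤ B) →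
      LipschitzWith B.toNNReal (fun t => ∫ s in (0 : ℝ)..t, g s) := by
    intro g B hg hB
    have hB0 : 0 ≤ B := (abs_nonneg _).trans (hB 0)
    refine LipschitzWith.of_dist_le_mul fun s t => ?_
    rw [Real.coe_toNNReal _ hB0, Real.dist_eq, Real.dist_eq]
    exact abs_integral_sub_integral_le hg hB t s
  have hyL : AbsolutelyContinuousOnInterval (fun t => S (y t)) 0 t :=
    ((hSL.comp (hlip h₁ hB₁)).lipschitzOnWith).absolutelyContinuousOnInterval
  have hlL : AbsolutelyContinuousOnInterval (fun t => Real.exp (l t)) 0 t := by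
    have hc : IsCompact (l '' uIcc 0 t) := isCompact_uIcc.image (hlip h₂ hB₂).continuous
    obtain ⟨R, hR⟩ := hc.isBounded.subset_closedBall 0
    obtain ⟨K, hK⟩ := (Real.contDiff_exp (n := 1)).contDiffOn (s := Metric.closedBall 0 R)
      |>.exists_lipschitzOnWith (by decide) (convex_closedBall _ _) (isCompact_closedBall _ _)
    exact (hK.comp ((hlip h₂ hB₂).lipschitzOnWith (s := uIcc 0 t))
      (fun x hx => hR (mem_image_of_mem l hx))).absolutelyContinuousOnInterval
  -- The integrands are merely measurable, so the product is differentiable only almost everywhere;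
  -- absolute continuity is what still licenses the fundamental theorem.
  have hAC := hlL.fun_mul hyL
  have h0 : Real.exp (l t) * S (y t) - S 0
      = Real.exp (l t) * S (y t) - Real.exp (l 0) * S (y 0) := by simp [hy, hl]
  change Real.exp (l t) * S (y t) - S 0 = _
  rw [h0, ← hAC.integral_deriv_eq_sub]
  refine intervalIntegral.integral_congr_ae ?_
  filter_upwards [ae_hasDerivAt_integral_of_bound h₁ hB₁, ae_hasDerivAt_integral_of_bound h₂ hB₂]
    with x hx₁ hx₂ _
  have := (hx₂.exp.mul ((hS (y x)).comp x hx₁)).deriv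
  refine Eq.trans this ?_
  simp only [Function.comp, hy]
  ring

/-- Existence of a phase at scale `lam` together with the Dirichlet solution it belongs to. -/
lemma exists_phase_solution {V : ℝ → ℝ} (hV : Measurable V) {B : ℝ} (hB : ∀ t, |V t| ≤ B)
    {κ lam : ℝ} (hκ : 0 < κ) (hlam : 0 < lam) :
    ∃ y ψ ψ' r : ℝ → ℝ, Continuous y ∧
      (∀ t, 0 ≤ t → y t = lam * t
        + ∫ s in (0 : ℝ)..t, ((κ ^ 2 - V s) / lam - lam) * Real.sin (y s) ^ 2) ∧
      IsDirichletSolution V κ ψ ψ' ∧ ψ' 0 = κ ∧ r 0 = κ / lam ∧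
      ∀ t, 0 ≤ t → 0 < r t ∧ ψ t = r t * Real.sin (y t) ∧ ψ' t = lam * (r t * Real.cos (y t)) := by
  set q : ℝ → ℝ := fun s => (κ ^ 2 - V s) / lam - lam with hq
  have hqm : Measurable q := by fun_prop
  have hqB : ∀ t, |q t| ≤ (κ ^ 2 + B) / lam + lam := fun t => by
    have h1 : |κ ^ 2 - V t| ≤ κ ^ 2 + B := by
      have := abs_le.1 (hB t)
      rw [abs_le]; constructor <;> nlinarith [sq_nonneg κ]
    calc |q t| ≤ |(κ ^ 2 - V t) / lam| + |lam| := abs_sub _ _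
      _ ≤ _ := by
        rw [abs_div, abs_of_pos hlam]
        gcongr
  set B' := (κ ^ 2 + B) / lam + lam with hB'
  have hB'0 : 0 ≤ B' := (abs_nonneg _).trans (hqB 0)
  obtain ⟨y₀, hy₀c, hy₀⟩ := exists_phase lam hqm hqB
  have hy₀m : Measurable y₀ := hy₀c.measurable
  -- `g₁` is the derivative of the phase, and `g₂` the logarithmic derivative of the radius that (ψ,
  -- ψ'/lam) = r (sin y, cos y) forces.
  set g₁ : ℝ → ℝ := fun s => lam + q s * Real.sin (y₀ s) ^ 2 with hg₁
  set g₂ : ℝ → ℝ := fun s => -(q s * (Real.sin (y₀ s) * Real.cos (y₀ s))) with hg₂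
  have hg₁m : Measurable g₁ := by fun_prop
  have hg₂m : Measurable g₂ := by fun_prop
  have hqs : ∀ t, |q t * Real.sin (y₀ t) ^ 2| ≤ B' := fun t => by
    have h1 : |Real.sin (y₀ t) ^ 2| ≤ 1 := by
      rw [abs_of_nonneg (sq_nonneg _)]; exact Real.sin_sq_le_one _
    rw [abs_mul]
    exact (mul_le_mul (hqB t) h1 (abs_nonneg _) hB'0).trans (mul_one _).le
  have hg₁B : ∀ t, |g₁ t| ≤ lam + B' := fun t => by
    calc |g₁ t| ≤ |lam| + |q t * Real.sin (y₀ t) ^ 2| := abs_add_le _ _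
      _ ≤ lam + B' := by
        rw [abs_of_pos hlam]
        gcongr
        exact hqs t
  have hg₂B : ∀ t, |g₂ t| ≤ B' := fun t => by
    have h1 : |Real.sin (y₀ t) * Real.cos (y₀ t)| ≤ 1 := by
      rw [abs_mul]
      exact (mul_le_mul (Real.abs_sin_le_one _) (Real.abs_cos_le_one _) (abs_nonneg _)
        zero_le_one).trans (mul_one _).le
    simp only [hg₂]
    rw [abs_neg, abs_mul]
    exact (mul_le_mul (hqB t) h1 (abs_nonneg _) hB'0).trans (mul_one _).le
  have hyeq : ∀ t, 0 ≤ t → ∫ s in (0 : ℝ)..t, g₁ s = y₀ t := fun t ht => by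
    rw [hy₀ t ht, hg₁, intervalIntegral.integral_add (intervalIntegrable_const)
      (intervalIntegrable_of_bound (by fun_prop) hqs _ _)]
    simp [mul_comm]
  set l : ℝ → ℝ := fun t => ∫ s in (0 : ℝ)..t, g₂ s with hl
  have hlc : Continuous l := continuous_integral_of_bound hg₂m hg₂B
  have hsinL : LipschitzWith 1 Real.sin :=
    lipschitzWith_of_nnnorm_deriv_le Real.differentiable_sin fun x => by
      rw [Real.deriv_sin, ← NNReal.coe_le_coe]
      simpa using Real.abs_cos_le_one x
  have hcosL : LipschitzWith 1 Real.cos :=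
    lipschitzWith_of_nnnorm_deriv_le Real.differentiable_cos fun x => by
      rw [Real.deriv_cos, ← NNReal.coe_le_coe]
      simpa using Real.abs_sin_le_one x
  have hsin : ∀ t, 0 ≤ t → Real.exp (l t) * Real.sin (y₀ t)
      = ∫ x in (0 : ℝ)..t, lam * (Real.exp (l x) * Real.cos (y₀ x)) := fun t ht => by
    have h := exp_mul_comp_sub_eq_integral hg₁m hg₂m hg₁B hg₂B Real.hasDerivAt_sin hsinL t
    rw [hyeq t ht, Real.sin_zero, sub_zero] at h
    rw [hl]
    refine h.trans (intervalIntegral.integral_congr fun x hx => ?_)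
    rw [uIcc_of_le ht] at hx
    beta_reduce
    rw [hyeq x hx.1]
    simp only [hg₁, hg₂]
    ring
  have hcos : ∀ t, 0 ≤ t → Real.exp (l t) * Real.cos (y₀ t)
      = 1 + ∫ x in (0 : ℝ)..t, (V x - κ ^ 2) / lam * (Real.exp (l x) * Real.sin (y₀ x)) :=
    fun t ht => by
    have h := exp_mul_comp_sub_eq_integral hg₁m hg₂m hg₁B hg₂B Real.hasDerivAt_cos hcosL t
    rw [hyeq t ht, Real.cos_zero] at h
    rw [hl]
    rw [← sub_eq_iff_eq_add']
    refine h.trans (intervalIntegral.integral_congr fun x hx => ?_)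
    rw [uIcc_of_le ht] at hx
    beta_reduce
    rw [hyeq x hx.1]
    simp only [hg₁, hg₂, hq]
    have := Real.cos_sq' (y₀ x)
    field_simp
    linear_combination (V x - κ ^ 2 + lam ^ 2) * Real.sin (y₀ x) * this
  refine ⟨y₀, fun t => κ / lam * Real.exp (l t) * Real.sin (y₀ t),
    fun t => lam * (κ / lam * Real.exp (l t) * Real.cos (y₀ t)),
    fun t => κ / lam * Real.exp (l t), hy₀c, hy₀, ⟨?_, ?_, ?_, ?_⟩, ?_, ?_, ?_⟩
  · simp [hy₀ 0 le_rfl]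
  · intro t ht
    have hc : Continuous fun x => lam * (κ / lam * Real.exp (l x) * Real.cos (y₀ x)) := by fun_prop
    have hd : HasDerivAt (fun t => ∫ x in (0 : ℝ)..t,
        lam * (κ / lam * Real.exp (l x) * Real.cos (y₀ x)))
        (lam * (κ / lam * Real.exp (l t) * Real.cos (y₀ t))) t :=
      intervalIntegral.integral_hasDerivAt_right (hc.intervalIntegrable _ _)
        (hc.stronglyMeasurableAtFilter _ _) hc.continuousAt
    refine hd.hasDerivWithinAt.congr_of_mem (fun x hx => ?_) ht
    rw [mul_assoc, hsin x hx, ← intervalIntegral.integral_const_mul]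
    refine intervalIntegral.integral_congr fun s _ => ?_
    ring
  · intro t _
    exact (intervalIntegrable_of_bound (g := fun s => V s - κ ^ 2) (by fun_prop)
      (B := B + κ ^ 2) (fun s => (abs_sub _ _).trans (by
        rw [abs_of_nonneg (sq_nonneg κ)]; gcongr; exact hB s)) 0 t).mul_continuousOn
      (by fun_prop)
  · intro t ht
    have : lam * (κ / lam * Real.exp (l t) * Real.cos (y₀ t))
        = κ * (Real.exp (l t) * Real.cos (y₀ t)) := by field_simp
    rw [this, hcos t ht, mul_add, ← intervalIntegral.integral_const_mul]
    congr 1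
    · have : l 0 = 0 := by simp [hl]
      simp [hy₀ 0 le_rfl, this]
      field_simp
    · refine intervalIntegral.integral_congr fun s _ => ?_
      field_simp
  · have : l 0 = 0 := by simp [hl]
    simp [hy₀ 0 le_rfl, this]
    field_simp
  · have : l 0 = 0 := by simp [hl]
    simp [this]
  · intro t _
    exact ⟨by positivity, rfl, rfl⟩

end ClockStatistics

/-! ### Uniqueness of the Prüfer phase and its near monotonicity in the momentum -/

namespace ClockStatistics

lemma IsDirichletSolution.continuousOn_deriv {V ψ ψ' : ℝ → ℝ} {κ : ℝ}
    (h : IsDirichletSolution V κ ψ ψ') {T : ℝ} (hT : 0 ≤ T) : ContinuousOn ψ' (Icc 0 T) := by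
  have h1 := intervalIntegral.continuousOn_primitive_interval' (h.integrable T hT)
    (left_mem_uIcc)
  rw [uIcc_of_le hT] at h1
  exact (continuousOn_const.add h1).congr fun t ht => h.eqn t ht.1

lemma IsDirichletSolution.continuousOn {V ψ ψ' : ℝ → ℝ} {κ : ℝ}
    (h : IsDirichletSolution V κ ψ ψ') : ContinuousOn ψ (Ici 0) :=
  fun t ht => (h.hasDeriv t ht).continuousWithinAt

lemma IsDirichletSolution.eq_integral {V ψ ψ' : ℝ → ℝ} {κ : ℝ}
    (h : IsDirichletSolution V κ ψ ψ') {t : ℝ} (ht : 0 ≤ t) : ψ t = ∫ s in (0 : ℝ)..t, ψ' s := by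
  have := intervalIntegral.integral_eq_sub_of_hasDeriv_right_of_le ht
    (h.continuousOn.mono Icc_subset_Ici_self)
    (fun x hx => (h.hasDeriv x hx.1.le).mono (fun y hy => hx.1.le.trans (le_of_lt hy)))
    (ContinuousOn.intervalIntegrable_of_Icc ht (h.continuousOn_deriv ht))
  rw [this, h.zero, sub_zero]

/-- Solutions of the Dirichlet problem are determined by `ψ' 0`. -/
lemma IsDirichletSolution.unique {V : ℝ → ℝ} {B : ℝ} (hB : ∀ t, |V t| ≤ B)
    {κ : ℝ} {ψ₁ ψ₁' ψ₂ ψ₂' : ℝ → ℝ} (h₁ : IsDirichletSolution V κ ψ₁ ψ₁')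
    (h₂ : IsDirichletSolution V κ ψ₂ ψ₂') (h0 : ψ₁' 0 = ψ₂' 0) {T : ℝ} (hT : 0 ≤ T) :
    ψ₁ T = ψ₂ T ∧ ψ₁' T = ψ₂' T := by
  have hB0 : 0 ≤ B := (abs_nonneg _).trans (hB 0)
  set u : ℝ → ℝ := fun t => |ψ₁ t - ψ₂ t| with hu
  set u' : ℝ → ℝ := fun t => |ψ₁' t - ψ₂' t| with hu'
  have huc : ContinuousOn u (Icc 0 T) :=
    ((h₁.continuousOn.mono Icc_subset_Ici_self).sub
      (h₂.continuousOn.mono Icc_subset_Ici_self)).abs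
  have huc' : ContinuousOn u' (Icc 0 T) :=
    ((h₁.continuousOn_deriv hT).sub (h₂.continuousOn_deriv hT)).abs
  have hint : ∀ t ∈ Icc 0 T, IntervalIntegrable u volume 0 t := fun t ht =>
    (huc.mono (Icc_subset_Icc_right ht.2)).intervalIntegrable_of_Icc ht.1
  have hint' : ∀ t ∈ Icc 0 T, IntervalIntegrable u' volume 0 t := fun t ht =>
    (huc'.mono (Icc_subset_Icc_right ht.2)).intervalIntegrable_of_Icc ht.1
  have hψ : ∀ t ∈ Icc 0 T, u t ≤ ∫ s in (0 : ℝ)..t, u' s := fun t ht => by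
    have hi : ∀ {ψ ψ'}, IsDirichletSolution V κ ψ ψ' → IntervalIntegrable ψ' volume 0 t :=
      fun h => (h.continuousOn_deriv ht.1).intervalIntegrable_of_Icc ht.1
    simp only [hu]
    rw [h₁.eq_integral ht.1, h₂.eq_integral ht.1, ← intervalIntegral.integral_sub (hi h₁) (hi h₂)]
    exact intervalIntegral.abs_integral_le_integral_abs ht.1
  have hψ' : ∀ t ∈ Icc 0 T, u' t ≤ (B + κ ^ 2) * ∫ s in (0 : ℝ)..t, u s := fun t ht => by
    simp only [hu']
    rw [h₁.eqn t ht.1, h₂.eqn t ht.1, h0, add_sub_add_left_eq_sub,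
      ← intervalIntegral.integral_sub (h₁.integrable t ht.1) (h₂.integrable t ht.1),
      ← intervalIntegral.integral_const_mul, ← Real.norm_eq_abs]
    refine intervalIntegral.norm_integral_le_of_norm_le ht.1 (ae_of_all _ fun s _ => ?_)
      ((hint t ht).const_mul _)
    rw [← mul_sub, Real.norm_eq_abs, abs_mul]
    gcongr
    refine (abs_sub _ _).trans ?_
    rw [abs_of_nonneg (sq_nonneg κ)]
    gcongr
    exact hB s
  have hK : 0 ≤ B + κ ^ 2 + 1 := by positivity
  have key := le_mul_exp_of_le_add_integral (u := fun t => u t + u' t) (A := 0) hK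
    (huc.add huc') (fun t ht => by
      rw [zero_add, intervalIntegral.integral_add (hint t ht) (hint' t ht)]
      have h3 : 0 ≤ ∫ s in (0 : ℝ)..t, u s :=
        intervalIntegral.integral_nonneg ht.1 fun s _ => abs_nonneg _
      have h4 : 0 ≤ ∫ s in (0 : ℝ)..t, u' s :=
        intervalIntegral.integral_nonneg ht.1 fun s _ => abs_nonneg _
      nlinarith [hψ t ht, hψ' t ht, mul_nonneg (add_nonneg hB0 (sq_nonneg κ)) h4]) T ⟨hT, le_rfl⟩
  simp only [zero_mul] at key
  have h5 : 0 ≤ u T := abs_nonneg _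
  have h6 : 0 ≤ u' T := abs_nonneg _
  exact ⟨sub_eq_zero.1 (abs_eq_zero.1 (by linarith : u T = 0)),
    sub_eq_zero.1 (abs_eq_zero.1 (by linarith : u' T = 0))⟩

/-- By continuity |d| cannot pass π/2 without taking that value, where the cosine vanishes. This
fixes the branch: information on the sine and cosine of a phase difference becomes information on
the difference itself. -/
lemma abs_lt_pi_div_two_of_cos_pos {d : ℝ → ℝ} (hd : ContinuousOn d (Ici 0)) (h0 : d 0 = 0)
    (hc : ∀ t, 0 ≤ t → 0 < Real.cos (d t)) {t : ℝ} (ht : 0 ≤ t) : |d t| < Real.pi / 2 := by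
  by_contra! h
  have hI : ContinuousOn (fun s => |d s|) (Icc 0 t) := (hd.mono Icc_subset_Ici_self).abs
  obtain ⟨s, hs, hs'⟩ := intermediate_value_Icc ht hI
    (show Real.pi / 2 ∈ Icc (|d 0|) (|d t|) from ⟨by rw [h0, abs_zero]; positivity, h⟩)
  have := hc s hs.1
  rw [← Real.cos_abs, show |d s| = Real.pi / 2 from hs', Real.cos_pi_div_two] at this
  exact lt_irrefl _ this

/-- Phases of one Dirichlet solution at the scales `κ` and `lam`. -/
lemma abs_phase_sub_phase_le {κ lam : ℝ} (hκ : 0 < κ) (hlam : 0 < lam)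
    {θ y ψ ψ' r ρ : ℝ → ℝ} (hθ : ContinuousOn θ (Ici 0)) (hy : ContinuousOn y (Ici 0))
    (hθ0 : θ 0 = 0) (hy0 : y 0 = 0)
    (h₁ : ∀ t, 0 ≤ t → 0 < r t ∧ ψ t = r t * Real.sin (θ t) ∧ ψ' t / κ = r t * Real.cos (θ t))
    (h₂ : ∀ t, 0 ≤ t → 0 < ρ t ∧ ψ t = ρ t * Real.sin (y t) ∧
      ψ' t / lam = ρ t * Real.cos (y t)) {t : ℝ} (ht : 0 ≤ t) :
    |θ t - y t| ≤ Real.pi / 2 * |1 - lam / κ| := by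
  have hkey : ∀ t, 0 ≤ t → 0 < Real.cos (θ t - y t) ∧
      |Real.sin (θ t - y t)| ≤ |1 - lam / κ| := by
    intro t ht
    obtain ⟨hr, hs, hc⟩ := h₁ t ht
    obtain ⟨hρ, hs', hc'⟩ := h₂ t ht
    have e1 : r t * Real.sin (θ t) = ρ t * Real.sin (y t) := hs.symm.trans hs'
    have e2 : r t * Real.cos (θ t) = lam / κ * (ρ t * Real.cos (y t)) := by
      rw [← hc, ← hc']; field_simp
    set x := lam / κ with hx
    have hx0 : 0 < x := by positivity
    have f1 := Real.sin_sq_add_cos_sq (θ t)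
    have f2 := Real.sin_sq_add_cos_sq (y t)
    constructor
    · rw [Real.cos_sub]
      have h3 : r t * (Real.cos (θ t) * Real.cos (y t) + Real.sin (θ t) * Real.sin (y t))
          = ρ t * (x * Real.cos (y t) ^ 2 + Real.sin (y t) ^ 2) := by
        linear_combination Real.cos (y t) * e2 + Real.sin (y t) * e1
      have h4 : 0 < x * Real.cos (y t) ^ 2 + Real.sin (y t) ^ 2 := by
        rcases (sq_nonneg (Real.cos (y t))).eq_or_lt with h | h
        · rw [← h] at f2 ⊢; linarith
        · positivity
      have h5 := mul_pos hρ h4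
      rw [← h3] at h5
      exact pos_of_mul_pos_right h5 hr.le
    · rw [Real.sin_sub]
      -- Eliminating the second radius leaves sin(θ - y) = (1 - lam/κ) sin θ cos y.
      have h3 : r t * (Real.sin (θ t) * Real.cos (y t) - Real.cos (θ t) * Real.sin (y t))
          = r t * ((1 - x) * (Real.sin (θ t) * Real.cos (y t))) := by
        linear_combination (-Real.sin (y t)) * e2 + x * Real.cos (y t) * e1
      rw [mul_left_cancel₀ hr.ne' h3, abs_mul]
      refine (mul_le_mul_of_nonneg_left ?_ (abs_nonneg _)).trans (mul_one _).le
      rw [abs_mul]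
      exact (mul_le_mul (Real.abs_sin_le_one _) (Real.abs_cos_le_one _) (abs_nonneg _)
        zero_le_one).trans (mul_one _).le
  have hlt := abs_lt_pi_div_two_of_cos_pos (hθ.sub hy) (by simp [hθ0, hy0])
    (fun t ht => (hkey t ht).1) ht
  -- Jordan's inequality, available since |θ - y| < π/2; it is the source of the constant π/2.
  have h1 := Real.mul_abs_le_abs_sin (x := θ t - y t) hlt.le
  have h2 := (hkey t ht).2
  have hpi := Real.pi_pos
  have h3 := h1.trans h2
  rw [div_mul_eq_mul_div, div_le_iff₀ hpi] at h3
  linarith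

/-- The Prüfer phase agrees with the phase at scale `κ` of any Dirichlet solution. -/
lemma pruferPhase_eq {V : ℝ → ℝ} {B : ℝ} (hB : ∀ t, |V t| ≤ B) {κ : ℝ} (hκ : 0 < κ)
    {θ : ℝ → ℝ} (hθ : IsPruferPhase V κ θ) {t : ℝ} (ht : 0 ≤ t) : pruferPhase V κ t = θ t := by
  have hex : ∃ θ, IsPruferPhase V κ θ := ⟨θ, hθ⟩
  have hc := hex.choose_spec
  simp only [pruferPhase, dif_pos hex]
  set φ := hex.choose
  obtain ⟨hθc, hθ0, ψ₁, ψ₁', r₁, hs₁, hr₁, h₁⟩ := hθ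
  obtain ⟨hφc, hφ0, ψ₂, ψ₂', r₂, hs₂, hr₂, h₂⟩ := hc
  -- The normalisation r 0 = 1 removes the scalar freedom in the Dirichlet solution.
  have e0 : ψ₁' 0 = ψ₂' 0 := by
    have a1 := (h₁ 0 le_rfl).2.2
    have a2 := (h₂ 0 le_rfl).2.2
    rw [hr₁, hθ0] at a1
    rw [hr₂, hφ0, ← a1] at a2
    field_simp at a2
    exact a2.symm
  -- With equal scales the bound (π/2)|1 - κ/κ| is zero, so the comparison becomes uniqueness.
  have hle := abs_phase_sub_phase_le hκ hκ hφc hθc hφ0 hθ0 h₂ (ψ := ψ₂) (ψ' := ψ₂') (ρ := r₁)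
    (fun t ht => by
      obtain ⟨e1, e2⟩ := hs₁.unique hB hs₂ e0 ht
      rw [← e1, ← e2]
      exact h₁ t ht) ht
  rw [div_self hκ.ne', sub_self, abs_zero, mul_zero] at hle
  exact sub_eq_zero.1 (abs_eq_zero.1 (le_antisymm hle (abs_nonneg _)))

/-- Integral equation of the Prüfer phase. -/
lemma pruferPhase_spec {V : ℝ → ℝ} (hV : Measurable V) {B : ℝ} (hB : ∀ t, |V t| ≤ B)
    {κ : ℝ} (hκ : 0 < κ) :
    ∃ θ : ℝ → ℝ, Continuous θ ∧ IsPruferPhase V κ θ ∧ (∀ t, 0 ≤ t → pruferPhase V κ t = θ t) ∧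
      ∀ t, 0 ≤ t → θ t = κ * t - ∫ s in (0 : ℝ)..t, V s / κ * Real.sin (θ s) ^ 2 := by
  obtain ⟨y, ψ, ψ', r, hyc, hy, hsol, hψ0, hr0, h⟩ := exists_phase_solution hV hB hκ hκ
  have hP : IsPruferPhase V κ y := by
    refine ⟨hyc.continuousOn, by simp [hy 0 le_rfl], ψ, ψ', r, hsol, by rw [hr0, div_self hκ.ne'],
      fun t ht => ⟨(h t ht).1, (h t ht).2.1, ?_⟩⟩
    rw [(h t ht).2.2]; field_simp
  refine ⟨y, hyc, hP, fun t ht => pruferPhase_eq hB hκ hP ht, fun t ht => ?_⟩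
  rw [hy t ht, sub_eq_add_neg, ← intervalIntegral.integral_neg]
  congr 1
  refine intervalIntegral.integral_congr fun s _ => ?_
  field_simp
  ring

/-- Comparison for scalar integral equations. -/
lemma nonpos_of_sub_le_integral_abs {d : ℝ → ℝ} (hd : Continuous d) (h0 : d 0 = 0) {K : ℝ}
    (hK : 0 ≤ K) (h : ∀ s t, 0 ≤ s → s ≤ t → d t - d s ≤ K * ∫ x in s..t, |d x|)
    {t : ℝ} (ht : 0 ≤ t) : d t ≤ 0 := by
  by_contra! hpos
  -- Start from the last time at which d ≤ 0. After it |d| = d, so the one-sided hypothesis is a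
  -- genuine Grönwall inequality with zero initial term.
  set S : Set ℝ := Icc 0 t ∩ {s | d s ≤ 0} with hS
  have hSne : S.Nonempty := ⟨0, ⟨le_rfl, ht⟩, by simp [h0]⟩
  have hSc : IsCompact S := isCompact_Icc.inter_right (isClosed_le hd continuous_const)
  obtain ⟨⟨hm1, hm2⟩, hm3⟩ := hSc.sSup_mem hSne
  set m := sSup S with hm
  have hgt : ∀ x, m < x → x ≤ t → 0 < d x := fun x hx hxt => by
    by_contra! hx0
    exact absurd (le_csSup hSc.bddAbove ⟨⟨hm1.trans hx.le, hxt⟩, hx0⟩) (not_le.2 hx)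
  have key := le_mul_exp_of_le_add_integral (u := d) (A := 0) (a := m) (b := t) hK
    hd.continuousOn (fun x hx => by
      have h1 := h m x hm1 hx.1
      have h2 : ∫ s in m..x, |d s| = ∫ s in m..x, d s := by
        refine intervalIntegral.integral_congr_ae (ae_of_all _ fun s hs => ?_)
        rw [uIoc_of_le hx.1] at hs
        exact abs_of_pos (hgt s hs.1 (hs.2.trans hx.2))
      rw [h2] at h1
      have : d m ≤ 0 := hm3
      linarith) t ⟨hm2, le_rfl⟩
  linarith

/-- The right side κ - (V/κ) sin²θ need not increase with κ. At the fixed scale κ₀, however, the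
phase obeys y' = κ₀ cos²y + ((κ² - V)/κ₀) sin²y, which does, so the phases at scale κ₀ are ordered.
Returning to the scales κ₁ and κ₂ costs one `abs_phase_sub_phase_le` each, and both costs vanish as
the momenta tend to κ₀. -/
lemma pruferPhase_le_add {V : ℝ → ℝ} (hV : Measurable V) {B : ℝ} (hB : ∀ t, |V t| ≤ B)
    {κ₀ κ₁ κ₂ : ℝ} (h₀ : 0 < κ₀) (h₁ : 0 < κ₁) (h₁₂ : κ₁ ≤ κ₂) {t : ℝ} (ht : 0 ≤ t) :
    pruferPhase V κ₁ t ≤ pruferPhase V κ₂ t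
      + Real.pi / 2 * (|1 - κ₀ / κ₁| + |1 - κ₀ / κ₂|) := by
  have h₂ : 0 < κ₂ := h₁.trans_le h₁₂
  have hB0 : 0 ≤ B := (abs_nonneg _).trans (hB 0)
  have aux : ∀ κ, 0 < κ → ∃ y : ℝ → ℝ, Continuous y ∧ (∀ t, 0 ≤ t → y t = κ₀ * t
        + ∫ s in (0 : ℝ)..t, ((κ ^ 2 - V s) / κ₀ - κ₀) * Real.sin (y s) ^ 2) ∧
      ∀ t, 0 ≤ t → |pruferPhase V κ t - y t| ≤ Real.pi / 2 * |1 - κ₀ / κ| := by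
    intro κ hκ
    obtain ⟨θ, hθc, ⟨_, hθ0, ψ₁, ψ₁', r₁, hs₁, hr₁, h₁⟩, hθ, -⟩ := pruferPhase_spec hV hB hκ
    obtain ⟨y, ψ, ψ', r, hyc, hy, hsol, hψ0, hr0, h⟩ := exists_phase_solution hV hB hκ h₀
    refine ⟨y, hyc, hy, fun t ht => ?_⟩
    rw [hθ t ht]
    have e0 : ψ₁' 0 = ψ' 0 := by
      have a1 := (h₁ 0 le_rfl).2.2
      rw [hr₁, hθ0, Real.cos_zero, mul_one, div_eq_one_iff_eq hκ.ne'] at a1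
      rw [a1, hψ0]
    refine abs_phase_sub_phase_le hκ h₀ hθc.continuousOn hyc.continuousOn hθ0
      (by simp [hy 0 le_rfl]) h₁ (ρ := r) (fun t ht => ?_) ht
    obtain ⟨e1, e2⟩ := hs₁.unique hB hsol e0 ht
    rw [e1, e2]
    refine ⟨(h t ht).1, (h t ht).2.1, ?_⟩
    rw [(h t ht).2.2]; field_simp
  obtain ⟨y₁, hc₁, hy₁, hd₁⟩ := aux κ₁ h₁
  obtain ⟨y₂, hc₂, hy₂, hd₂⟩ := aux κ₂ h₂
  have hcmp : y₁ t - y₂ t ≤ 0 := by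
    set q : ℝ → ℝ → ℝ := fun κ s => (κ ^ 2 - V s) / κ₀ - κ₀ with hq
    have hqm : ∀ κ, Measurable (q κ) := fun κ => by fun_prop
    have hqB : ∀ κ t, |q κ t| ≤ (κ ^ 2 + B) / κ₀ + κ₀ := fun κ t => by
      have h1 : |κ ^ 2 - V t| ≤ κ ^ 2 + B := by
        have := abs_le.1 (hB t)
        rw [abs_le]; constructor <;> nlinarith [sq_nonneg κ]
      calc |q κ t| ≤ |(κ ^ 2 - V t) / κ₀| + |κ₀| := abs_sub _ _
        _ ≤ _ := by
          rw [abs_div, abs_of_pos h₀]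
          gcongr
    have hi : ∀ κ (y : ℝ → ℝ), Continuous y → ∀ a b,
        IntervalIntegrable (fun s => q κ s * Real.sin (y s) ^ 2) volume a b := fun κ y hy a b =>
      (intervalIntegrable_of_bound (hqm κ) (hqB κ) a b).mul_continuousOn (by fun_prop)
    have hK : 0 ≤ (κ₂ ^ 2 + B) / κ₀ + κ₀ := by positivity
    refine nonpos_of_sub_le_integral_abs (d := fun t => y₁ t - y₂ t) (hc₁.sub hc₂)
      (by simp [hy₁ 0 le_rfl, hy₂ 0 le_rfl]) hK (fun s t hs hst => ?_) ht
    have hdiff : ∀ κ (y : ℝ → ℝ), Continuous y → (∀ t, 0 ≤ t → y t = κ₀ * t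
        + ∫ s in (0 : ℝ)..t, q κ s * Real.sin (y s) ^ 2) →
        y t - y s = κ₀ * (t - s) + ∫ x in s..t, q κ x * Real.sin (y x) ^ 2 := by
      intro κ y hyc hy
      rw [← intervalIntegral.integral_interval_sub_left (hi κ y hyc 0 t) (hi κ y hyc 0 s),
        hy t (hs.trans hst), hy s hs]
      ring
    have e : (y₁ t - y₂ t) - (y₁ s - y₂ s) = ∫ x in s..t, (q κ₁ x * Real.sin (y₁ x) ^ 2
        - q κ₂ x * Real.sin (y₂ x) ^ 2) := by
      rw [intervalIntegral.integral_sub (hi _ _ hc₁ _ _) (hi _ _ hc₂ _ _)]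
      linear_combination hdiff κ₁ y₁ hc₁ hy₁ - hdiff κ₂ y₂ hc₂ hy₂
    rw [e, ← intervalIntegral.integral_const_mul]
    refine intervalIntegral.integral_mono_on hst ((hi _ _ hc₁ _ _).sub (hi _ _ hc₂ _ _))
      (Continuous.intervalIntegrable (by fun_prop) _ _) fun x _ => ?_
    -- The integrand splits as (q κ₁ - q κ₂) sin²y₁ ≤ 0 plus q κ₂ (sin²y₁ - sin²y₂), the latter
    -- being Lipschitz in y₁ - y₂.
    have e1 : q κ₁ x ≤ q κ₂ x := by
      simp only [hq]
      gcongr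
    have e2 : q κ₂ x * (Real.sin (y₁ x) ^ 2 - Real.sin (y₂ x) ^ 2)
        ≤ ((κ₂ ^ 2 + B) / κ₀ + κ₀) * |y₁ x - y₂ x| := by
      refine (le_abs_self _).trans ?_
      rw [abs_mul]
      exact mul_le_mul (hqB κ₂ x) (abs_sin_sq_sub_sin_sq_le _ _) (abs_nonneg _) hK
    nlinarith [mul_le_mul_of_nonneg_right e1 (sq_nonneg (Real.sin (y₁ x)))]
  have a1 := (abs_le.1 (hd₁ t ht)).2
  have a2 := (abs_le.1 (hd₂ t ht)).1
  linarith

/-- The Prüfer phase only depends on the almost everywhere class of the potential. -/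
lemma pruferPhase_congr_ae {V V' : ℝ → ℝ} (h : V =ᵐ[volume] V') : pruferPhase V = pruferPhase V' := by
  have aux : ∀ {V V' : ℝ → ℝ}, V =ᵐ[volume] V' → ∀ κ ψ ψ', IsDirichletSolution V κ ψ ψ' →
      IsDirichletSolution V' κ ψ ψ' := by
    intro V V' h κ ψ ψ' hs
    have hae : ∀ t, (fun s => (V s - κ ^ 2) * ψ s) =ᵐ[volume.restrict (uIoc 0 t)]
        (fun s => (V' s - κ ^ 2) * ψ s) := fun t =>
      ae_restrict_of_ae (h.mono fun s hs => by simp only [hs])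
    refine ⟨hs.zero, hs.hasDeriv, fun t ht => (hs.integrable t ht).congr_ae (hae t),
      fun t ht => ?_⟩
    rw [hs.eqn t ht, intervalIntegral.integral_congr_ae_restrict (hae t)]
  have hP : IsPruferPhase V = IsPruferPhase V' := by
    funext κ θ
    have : ∀ ψ ψ', IsDirichletSolution V κ ψ ψ' ↔ IsDirichletSolution V' κ ψ ψ' :=
      fun ψ ψ' => ⟨aux h κ ψ ψ', aux h.symm κ ψ ψ'⟩
    simp only [IsPruferPhase, this]
  funext κ t
  unfold pruferPhase
  rw [hP]

end ClockStatistics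

/-! ### Perturbation theory of the phase over one cell -/

namespace ClockStatistics

noncomputable section

/-- The unimodular factor `exp (2 i x)`. -/
def circleExp (x : ℝ) : ℂ := Complex.exp ((2 * x : ℝ) * Complex.I)

lemma norm_circleExp (x : ℝ) : ‖circleExp x‖ = 1 := Complex.norm_exp_ofReal_mul_I _

lemma circleExp_add (x y : ℝ) : circleExp (x + y) = circleExp x * circleExp y := by
  rw [circleExp, circleExp, circleExp, ← Complex.exp_add]
  congr 1
  push_cast
  ring

lemma circleExp_re (x : ℝ) : (circleExp x).re = Real.cos (2 * x) := Complex.exp_ofReal_mul_I_re _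

lemma continuous_circleExp : Continuous circleExp := by unfold circleExp; fun_prop

lemma norm_circleExp_sub_one_le (x : ℝ) : ‖circleExp x - 1‖ ≤ 2 * |x| := by
  have := Real.norm_exp_I_mul_ofReal_sub_one_le (x := 2 * x)
  rw [circleExp, mul_comm _ Complex.I]
  refine this.trans ?_
  rw [Real.norm_eq_abs, abs_mul, abs_two]

lemma norm_circleExp_sub_le (x y : ℝ) : ‖circleExp x - circleExp y‖ ≤ 2 * |x - y| := by
  have : circleExp x - circleExp y = circleExp y * (circleExp (x - y) - 1) := by
    rw [mul_sub, ← circleExp_add, mul_one]; congr 2; ring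
  rw [this, norm_mul, norm_circleExp, one_mul]
  exact norm_circleExp_sub_one_le _

/-- The Fourier amplitude `(2κ)⁻¹ ∫₀¹ f(s) exp (2 i κ s) ds` of the single site potential. -/
def amplitude (f : ℝ → ℝ) (κ : ℝ) : ℂ := ∫ s in (0 : ℝ)..1, (f s / (2 * κ) : ℝ) * circleExp (κ * s)

/-- `g` is a phase along one cell, at momentum `κ` and coupling `v`. -/
structure IsPhaseStep (f : ℝ → ℝ) (κ v : ℝ) (g : ℝ → ℝ) : Prop where
  cont : Continuous g
  eqn : ∀ s ∈ Icc (0 : ℝ) 1, g s = g 0 + κ * s - v * ∫ u in (0 : ℝ)..s, f u / κ * Real.sin (g u) ^ 2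

section

variable {f : ℝ → ℝ} {B c κ κ₀ v : ℝ} {g g₀ : ℝ → ℝ}

lemma abs_inv_sub_inv_le (hκ : 0 < κ) (hκ₀ : 0 < κ₀) (hc : κ⁻¹ ≤ c) (hc₀ : κ₀⁻¹ ≤ c) :
    |κ⁻¹ - κ₀⁻¹| ≤ c ^ 2 * |κ - κ₀| := by
  have h : κ⁻¹ - κ₀⁻¹ = κ⁻¹ * κ₀⁻¹ * (κ₀ - κ) := by field_simp
  have hi : 0 < κ⁻¹ := inv_pos.2 hκ
  have hi₀ : 0 < κ₀⁻¹ := inv_pos.2 hκ₀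
  have hc0 : 0 ≤ c := hi.le.trans hc
  rw [h, abs_mul, abs_sub_comm κ₀ κ, abs_of_pos (mul_pos hi hi₀), sq]
  gcongr

lemma abs_sin_sq_div_sub_le (hf : ∀ t, |f t| ≤ B) (hκ : 0 < κ) (hκ₀ : 0 < κ₀) (hc : κ⁻¹ ≤ c)
    (hc₀ : κ₀⁻¹ ≤ c) (u x y : ℝ) :
    |f u / κ * Real.sin x ^ 2 - f u / κ₀ * Real.sin y ^ 2|
      ≤ B * (c ^ 2 * |κ - κ₀| + c * |x - y|) := by
  have e : f u / κ * Real.sin x ^ 2 - f u / κ₀ * Real.sin y ^ 2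
      = f u * ((κ⁻¹ - κ₀⁻¹) * Real.sin x ^ 2 + κ₀⁻¹ * (Real.sin x ^ 2 - Real.sin y ^ 2)) := by
    field_simp
    ring
  have hB0 : 0 ≤ B := (abs_nonneg _).trans (hf 0)
  have hi₀ : 0 < κ₀⁻¹ := inv_pos.2 hκ₀
  have h1 : |Real.sin x ^ 2| ≤ 1 := by
    rw [abs_of_nonneg (sq_nonneg _)]; exact Real.sin_sq_le_one _
  rw [e, abs_mul]
  refine mul_le_mul (hf u) ((abs_add_le _ _).trans ?_) (abs_nonneg _) hB0
  rw [abs_mul, abs_mul, abs_of_pos hi₀]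
  refine add_le_add ?_ (mul_le_mul hc₀ (abs_sin_sq_sub_sin_sq_le x y) (abs_nonneg _)
    (hi₀.le.trans hc₀))
  exact (mul_le_of_le_one_right (abs_nonneg _) h1).trans (abs_inv_sub_inv_le hκ hκ₀ hc hc₀)

lemma abs_div_mul_sin_sq_le (hf : ∀ t, |f t| ≤ B) (hκ : 0 < κ) (hc : κ⁻¹ ≤ c) (u x : ℝ) :
    |f u / κ * Real.sin x ^ 2| ≤ B * c := by
  have hB0 : 0 ≤ B := (abs_nonneg _).trans (hf 0)
  have hi : 0 < κ⁻¹ := inv_pos.2 hκ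
  have h1 : |Real.sin x ^ 2| ≤ 1 := by
    rw [abs_of_nonneg (sq_nonneg _)]; exact Real.sin_sq_le_one _
  rw [abs_mul, div_eq_mul_inv, abs_mul, abs_of_pos hi]
  calc |f u| * κ⁻¹ * |Real.sin x ^ 2| ≤ B * c * 1 := by
        have := hf u
        have hc0 : 0 ≤ c := hi.le.trans hc
        gcongr
    _ = _ := mul_one _

lemma IsPhaseStep.intervalIntegrable (h : IsPhaseStep f κ v g) (hfm : Measurable f)
    (hf : ∀ t, |f t| ≤ B) (a b : ℝ) :
    IntervalIntegrable (fun u => f u / κ * Real.sin (g u) ^ 2) volume a b := by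
  have := h.cont
  exact ((intervalIntegrable_of_bound hfm hf a b).div_const κ).mul_continuousOn (by fun_prop)

lemma IsPhaseStep.abs_sub_linear_le (h : IsPhaseStep f κ v g) (hf : ∀ t, |f t| ≤ B) (hκ : 0 < κ)
    (hc : κ⁻¹ ≤ c) {s : ℝ} (hs : s ∈ Icc (0 : ℝ) 1) :
    |g s - g 0 - κ * s| ≤ |v| * (B * c) := by
  have e : g s - g 0 - κ * s = -(v * ∫ u in (0 : ℝ)..s, f u / κ * Real.sin (g u) ^ 2) := by
    rw [h.eqn s hs]; ring
  have h1 : ‖∫ u in (0 : ℝ)..s, f u / κ * Real.sin (g u) ^ 2‖ ≤ B * c * |s - 0| :=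
    intervalIntegral.norm_integral_le_of_norm_le_const fun u _ =>
      abs_div_mul_sin_sq_le hf hκ hc u _
  have hBc : 0 ≤ B * c := (abs_nonneg _).trans (abs_div_mul_sin_sq_le hf hκ hc 0 0)
  rw [e, abs_neg, abs_mul]
  gcongr
  refine h1.trans ?_
  rw [sub_zero, abs_of_nonneg hs.1]
  exact mul_le_of_le_one_right hBc hs.2

/-- Growth of the difference of two phases over one cell. -/
lemma IsPhaseStep.abs_sub_le (h : IsPhaseStep f κ v g) (h₀ : IsPhaseStep f κ₀ v g₀)
    (hfm : Measurable f) (hf : ∀ t, |f t| ≤ B) (hκ : 0 < κ) (hκ₀ : 0 < κ₀) (hc : κ⁻¹ ≤ c)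
    (hc₀ : κ₀⁻¹ ≤ c) (hv : |v| ≤ 1) {s : ℝ} (hs : s ∈ Icc (0 : ℝ) 1) :
    |g s - g₀ s| ≤ (1 + B * c ^ 2) * Real.exp (B * c) * (|g 0 - g₀ 0| + |κ - κ₀|) := by
  have hB0 : 0 ≤ B := (abs_nonneg _).trans (hf 0)
  have hc0 : 0 ≤ c := (inv_pos.2 hκ).le.trans hc
  have hd : Continuous fun s => g s - g₀ s := h.cont.sub h₀.cont
  have key := le_mul_exp_of_le_add_integral (u := fun s => |g s - g₀ s|)
    (A := |g 0 - g₀ 0| + |κ - κ₀| + B * (c ^ 2 * |κ - κ₀|)) (K := B * c) (a := 0) (b := 1)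
    (by positivity) hd.abs.continuousOn (fun t ht => by
      have e : g t - g₀ t = (g 0 - g₀ 0) + (κ - κ₀) * t
          - v * ∫ u in (0 : ℝ)..t, (f u / κ * Real.sin (g u) ^ 2
            - f u / κ₀ * Real.sin (g₀ u) ^ 2) := by
        rw [intervalIntegral.integral_sub (h.intervalIntegrable hfm hf _ _)
          (h₀.intervalIntegrable hfm hf _ _), h.eqn t ht, h₀.eqn t ht]
        ring
      have h1 : ‖∫ u in (0 : ℝ)..t, (f u / κ * Real.sin (g u) ^ 2
            - f u / κ₀ * Real.sin (g₀ u) ^ 2)‖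
          ≤ ∫ u in (0 : ℝ)..t, (B * (c ^ 2 * |κ - κ₀|) + B * c * |g u - g₀ u|) := by
        refine intervalIntegral.norm_integral_le_of_norm_le ht.1 (ae_of_all _ fun u _ => ?_)
          (Continuous.intervalIntegrable (by fun_prop) _ _)
        refine (abs_sin_sq_div_sub_le hf hκ hκ₀ hc hc₀ u _ _).trans (le_of_eq (by ring))
      rw [intervalIntegral.integral_add intervalIntegrable_const
        (Continuous.intervalIntegrable (by fun_prop) _ _), intervalIntegral.integral_const,
        intervalIntegral.integral_const_mul, sub_zero, smul_eq_mul] at h1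
      have h2 : |v * ∫ u in (0 : ℝ)..t, (f u / κ * Real.sin (g u) ^ 2
            - f u / κ₀ * Real.sin (g₀ u) ^ 2)| ≤ B * (c ^ 2 * |κ - κ₀|)
              + B * c * ∫ u in (0 : ℝ)..t, |g u - g₀ u| := by
        rw [abs_mul]
        refine (mul_le_of_le_one_left (abs_nonneg _) hv).trans (h1.trans ?_)
        exact add_le_add_left (mul_le_of_le_one_left (by positivity) ht.2) _
      have h3 : |(κ - κ₀) * t| ≤ |κ - κ₀| := by
        rw [abs_mul, abs_of_nonneg ht.1]
        exact mul_le_of_le_one_right (abs_nonneg _) ht.2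
      simp only [e]
      refine (abs_sub _ _).trans ?_
      have := abs_add_le (g 0 - g₀ 0) ((κ - κ₀) * t)
      linarith) s hs
  refine key.trans ?_
  have h4 : Real.exp (B * c * (s - 0)) ≤ Real.exp (B * c) :=
    Real.exp_le_exp.2 (by rw [sub_zero]; exact mul_le_of_le_one_right (by positivity) hs.2)
  calc _ ≤ ((1 + B * c ^ 2) * (|g 0 - g₀ 0| + |κ - κ₀|)) * Real.exp (B * c) := by
        refine mul_le_mul ?_ h4 (Real.exp_pos _).le (by positivity)
        nlinarith [abs_nonneg (g 0 - g₀ 0), mul_nonneg hB0 (sq_nonneg c)]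
    _ = _ := by ring

/-- The deviation from free motion depends in a Lipschitz way on the initial phase and on `κ`. -/
lemma IsPhaseStep.abs_deviation_sub_le (h : IsPhaseStep f κ v g) (h₀ : IsPhaseStep f κ₀ v g₀)
    (hfm : Measurable f) (hf : ∀ t, |f t| ≤ B) (hκ : 0 < κ) (hκ₀ : 0 < κ₀) (hc : κ⁻¹ ≤ c)
    (hc₀ : κ₀⁻¹ ≤ c) (hv : |v| ≤ 1) {s : ℝ} (hs : s ∈ Icc (0 : ℝ) 1) :
    |(g s - g 0 - κ * s) - (g₀ s - g₀ 0 - κ₀ * s)|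
      ≤ B * (c ^ 2 + c * ((1 + B * c ^ 2) * Real.exp (B * c))) *
        (|v| * (|g 0 - g₀ 0| + |κ - κ₀|)) := by
  have hB0 : 0 ≤ B := (abs_nonneg _).trans (hf 0)
  have hc0 : 0 ≤ c := (inv_pos.2 hκ).le.trans hc
  set C := (1 + B * c ^ 2) * Real.exp (B * c) with hC
  have hC0 : 0 ≤ C := by positivity
  have e : (g s - g 0 - κ * s) - (g₀ s - g₀ 0 - κ₀ * s)
      = - (v * ∫ u in (0 : ℝ)..s, (f u / κ * Real.sin (g u) ^ 2
            - f u / κ₀ * Real.sin (g₀ u) ^ 2)) := by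
    rw [intervalIntegral.integral_sub (h.intervalIntegrable hfm hf _ _)
      (h₀.intervalIntegrable hfm hf _ _), h.eqn s hs, h₀.eqn s hs]
    ring
  set D := |g 0 - g₀ 0| + |κ - κ₀| with hD
  have hD0 : 0 ≤ D := by positivity
  have hDκ : |κ - κ₀| ≤ D := by rw [hD]; linarith [abs_nonneg (g 0 - g₀ 0)]
  have h1 : ‖∫ u in (0 : ℝ)..s, (f u / κ * Real.sin (g u) ^ 2
            - f u / κ₀ * Real.sin (g₀ u) ^ 2)‖ ≤ B * (c ^ 2 * D + c * (C * D)) * |s - 0| := by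
    refine intervalIntegral.norm_integral_le_of_norm_le_const fun u hu => ?_
    rw [uIoc_of_le hs.1] at hu
    refine (abs_sin_sq_div_sub_le hf hκ hκ₀ hc hc₀ u _ _).trans ?_
    gcongr
    exact h.abs_sub_le h₀ hfm hf hκ hκ₀ hc hc₀ hv ⟨hu.1.le, hu.2.trans hs.2⟩
  rw [e, abs_neg, abs_mul]
  calc |v| * |∫ u in (0 : ℝ)..s, (f u / κ * Real.sin (g u) ^ 2
            - f u / κ₀ * Real.sin (g₀ u) ^ 2)|
      ≤ |v| * (B * (c ^ 2 * D + c * (C * D)) * 1) := by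
        gcongr
        refine h1.trans ?_
        gcongr
        rw [sub_zero, abs_of_nonneg hs.1]; exact hs.2
    _ = _ := by ring

lemma norm_amplitude_le (hf : ∀ t, |f t| ≤ B) (hκ : 0 < κ) (hc : κ⁻¹ ≤ c) :
    ‖amplitude f κ‖ ≤ B * c := by
  have hB0 : 0 ≤ B := (abs_nonneg _).trans (hf 0)
  have hc0 : 0 ≤ c := (inv_pos.2 hκ).le.trans hc
  have : ‖amplitude f κ‖ ≤ B * c * |(1 : ℝ) - 0| := by
    refine intervalIntegral.norm_integral_le_of_norm_le_const fun u _ => ?_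
    rw [norm_mul, norm_circleExp, mul_one, Complex.norm_real, Real.norm_eq_abs, abs_div,
      abs_of_pos (by positivity : 0 < 2 * κ), div_eq_mul_inv, mul_inv]
    have := inv_pos.2 hκ
    gcongr
    · exact hf u
    · linarith
  simpa using this

lemma amplitude_integrable (hfm : Measurable f) (hf : ∀ t, |f t| ≤ B) (κ a : ℝ) :
    IntervalIntegrable (fun s => ((f s / (2 * κ) : ℝ) : ℂ) * circleExp (a + κ * s)) volume 0 1 := by
  have h1 : IntervalIntegrable (fun s => ((f s / (2 * κ) : ℝ) : ℂ)) volume 0 1 :=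
    intervalIntegrable_iff.2 (intervalIntegrable_iff.1
      ((intervalIntegrable_of_bound hfm hf 0 1).div_const _)).ofReal
  exact h1.mul_continuousOn (continuous_circleExp.comp (by fun_prop)).continuousOn

lemma norm_amplitude_sub_le (hfm : Measurable f) (hf : ∀ t, |f t| ≤ B) (hκ : 0 < κ) (hκ₀ : 0 < κ₀)
    (hc : κ⁻¹ ≤ c) (hc₀ : κ₀⁻¹ ≤ c) :
    ‖amplitude f κ - amplitude f κ₀‖ ≤ B * (c ^ 2 + c) * |κ - κ₀| := by
  have hB0 : 0 ≤ B := (abs_nonneg _).trans (hf 0)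
  have hc0 : 0 ≤ c := (inv_pos.2 hκ).le.trans hc
  have hi := amplitude_integrable hfm hf κ 0
  have hi₀ := amplitude_integrable hfm hf κ₀ 0
  simp only [zero_add] at hi hi₀
  have : ‖amplitude f κ - amplitude f κ₀‖ ≤ B * (c ^ 2 + c) * |κ - κ₀| * |(1 : ℝ) - 0| := by
    rw [amplitude, amplitude, ← intervalIntegral.integral_sub hi hi₀]
    refine intervalIntegral.norm_integral_le_of_norm_le_const fun u hu => ?_
    rw [uIoc_of_le zero_le_one] at hu
    have e : ((f u / (2 * κ) : ℝ) : ℂ) * circleExp (κ * u)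
        - ((f u / (2 * κ₀) : ℝ) : ℂ) * circleExp (κ₀ * u)
        = ((f u / 2 : ℝ) : ℂ) * (((κ⁻¹ - κ₀⁻¹ : ℝ) : ℂ) * circleExp (κ * u)
          + ((κ₀⁻¹ : ℝ) : ℂ) * (circleExp (κ * u) - circleExp (κ₀ * u))) := by
      have : (κ : ℂ) ≠ 0 := by exact_mod_cast hκ.ne'
      have : (κ₀ : ℂ) ≠ 0 := by exact_mod_cast hκ₀.ne'
      push_cast
      field_simp
      ring
    have h1 := norm_circleExp_sub_le (κ * u) (κ₀ * u)
    rw [← sub_mul, abs_mul, abs_of_pos hu.1] at h1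
    have h2 : ‖circleExp (κ * u) - circleExp (κ₀ * u)‖ ≤ 2 * |κ - κ₀| :=
      h1.trans (by gcongr; exact mul_le_of_le_one_right (abs_nonneg _) hu.2)
    have h3 : ‖((κ⁻¹ - κ₀⁻¹ : ℝ) : ℂ) * circleExp (κ * u)
          + ((κ₀⁻¹ : ℝ) : ℂ) * (circleExp (κ * u) - circleExp (κ₀ * u))‖
        ≤ c ^ 2 * |κ - κ₀| + c * (2 * |κ - κ₀|) := by
      refine (norm_add_le _ _).trans ?_
      rw [norm_mul, norm_mul, norm_circleExp, mul_one, Complex.norm_real, Complex.norm_real,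
        Real.norm_eq_abs, Real.norm_eq_abs, abs_of_pos (inv_pos.2 hκ₀)]
      gcongr
      exact abs_inv_sub_inv_le hκ hκ₀ hc hc₀
    rw [e, norm_mul, Complex.norm_real, Real.norm_eq_abs, abs_div, abs_two]
    calc |f u| / 2 * ‖((κ⁻¹ - κ₀⁻¹ : ℝ) : ℂ) * circleExp (κ * u)
          + ((κ₀⁻¹ : ℝ) : ℂ) * (circleExp (κ * u) - circleExp (κ₀ * u))‖
        ≤ B / 2 * (c ^ 2 * |κ - κ₀| + c * (2 * |κ - κ₀|)) := by
          gcongr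
          exact hf u
      _ ≤ B * (c ^ 2 + c) * |κ - κ₀| := by
          nlinarith [mul_nonneg hB0 (mul_nonneg (sq_nonneg c) (abs_nonneg (κ - κ₀)))]
  simpa using this

/-- The resonant amplitude `z` of a phase `x` at momentum `κ`. -/
def resonance (f : ℝ → ℝ) (κ x : ℝ) : ℂ := amplitude f κ * circleExp x

lemma norm_resonance_le (hf : ∀ t, |f t| ≤ B) (hκ : 0 < κ) (hc : κ⁻¹ ≤ c) (x : ℝ) :
    ‖resonance f κ x‖ ≤ B * c := by
  rw [resonance, norm_mul, norm_circleExp, mul_one]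
  exact norm_amplitude_le hf hκ hc

/-- Amplitude and unimodular factor are both Lipschitz. This linearity in the differences makes the
noise acting on the relative phase proportional to the relative phase itself. -/
lemma norm_resonance_sub_le (hfm : Measurable f) (hf : ∀ t, |f t| ≤ B) (hκ : 0 < κ) (hκ₀ : 0 < κ₀)
    (hc : κ⁻¹ ≤ c) (hc₀ : κ₀⁻¹ ≤ c) (x y : ℝ) :
    ‖resonance f κ x - resonance f κ₀ y‖ ≤ B * (c ^ 2 + 3 * c) * (|x - y| + |κ - κ₀|) := by
  have hB0 : 0 ≤ B := (abs_nonneg _).trans (hf 0)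
  have hc0 : 0 ≤ c := (inv_pos.2 hκ).le.trans hc
  have e : resonance f κ x - resonance f κ₀ y = (amplitude f κ - amplitude f κ₀) * circleExp x
      + amplitude f κ₀ * (circleExp x - circleExp y) := by
    simp only [resonance]; ring
  rw [e]
  refine (norm_add_le _ _).trans ?_
  rw [norm_mul, norm_mul, norm_circleExp, mul_one]
  have h1 := norm_amplitude_sub_le hfm hf hκ hκ₀ hc hc₀
  have h2 : ‖amplitude f κ₀‖ * ‖circleExp x - circleExp y‖ ≤ B * c * (2 * |x - y|) :=
    mul_le_mul (norm_amplitude_le hf hκ₀ hc₀) (norm_circleExp_sub_le x y) (norm_nonneg _)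
      (by positivity)
  have h3 : 0 ≤ B * c ^ 2 * |x - y| := by positivity
  have h4 : 0 ≤ B * c * |x - y| := by positivity
  have h5 : 0 ≤ B * c * |κ - κ₀| := by positivity
  nlinarith

/-- As sin² = (1 - cos 2·)/2, this integral is the phase-dependent part of -∫ (f/κ) sin² along free
motion. The first order effect of the potential on the phase is thus v Re z plus a term depending on
κ alone. -/
lemma resonance_re (hfm : Measurable f) (hf : ∀ t, |f t| ≤ B) (κ x : ℝ) :
    (resonance f κ x).re
      = ∫ s in (0 : ℝ)..1, f s / (2 * κ) * Real.cos (2 * (x + κ * s)) := by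
  have e : resonance f κ x
      = ∫ s in (0 : ℝ)..1, ((f s / (2 * κ) : ℝ) : ℂ) * circleExp (x + κ * s) := by
    rw [resonance, amplitude, ← intervalIntegral.integral_mul_const]
    refine intervalIntegral.integral_congr fun s _ => ?_
    simp only [circleExp_add]
    ring
  rw [e, ← Complex.reCLM_apply,
    ← Complex.reCLM.intervalIntegral_comp_comm (amplitude_integrable hfm hf κ x)]
  refine intervalIntegral.integral_congr fun s _ => ?_
  simp only [Complex.reCLM_apply]
  rw [Complex.re_ofReal_mul, circleExp_re]

/-- Sum-to-product writes each inner difference as 2 sin(2a + b) sin b, which displays the small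
factor b. The second difference is therefore small both in the deviations b, b₀ and in the
separation of the two phases. -/
lemma abs_cos_sub_cos_add_le (a b a₀ b₀ : ℝ) :
    |(Real.cos (2 * a) - Real.cos (2 * (a + b))) - (Real.cos (2 * a₀) - Real.cos (2 * (a₀ + b₀)))|
      ≤ 2 * ((2 * |a - a₀| + |b - b₀|) * |b| + |b - b₀|) := by
  have e : ∀ a b : ℝ, Real.cos (2 * a) - Real.cos (2 * (a + b))
      = 2 * (Real.sin (2 * a + b) * Real.sin b) := fun a b => by
    rw [Real.cos_sub_cos, show (2 * a + 2 * (a + b)) / 2 = 2 * a + b by ring,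
      show (2 * a - 2 * (a + b)) / 2 = -b by ring, Real.sin_neg]
    ring
  have hl : ∀ x y : ℝ, |Real.sin x - Real.sin y| ≤ |x - y| := fun x y => by
    have := Real.abs_sin_sub_sin_le x y
    exact this
  rw [e, e, ← mul_sub, abs_mul, abs_two]
  have e2 : Real.sin (2 * a + b) * Real.sin b - Real.sin (2 * a₀ + b₀) * Real.sin b₀
      = (Real.sin (2 * a + b) - Real.sin (2 * a₀ + b₀)) * Real.sin b
        + Real.sin (2 * a₀ + b₀) * (Real.sin b - Real.sin b₀) := by ring
  rw [e2]
  have h1 : |(2 * a + b) - (2 * a₀ + b₀)| ≤ 2 * |a - a₀| + |b - b₀| := by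
    rw [show (2 * a + b) - (2 * a₀ + b₀) = 2 * (a - a₀) + (b - b₀) by ring]
    refine (abs_add_le _ _).trans ?_
    rw [abs_mul, abs_two]
  refine mul_le_mul_of_nonneg_left ((abs_add_le _ _).trans ?_) zero_le_two
  rw [abs_mul, abs_mul]
  refine add_le_add (mul_le_mul ((hl _ _).trans h1) Real.abs_sin_le_abs (abs_nonneg _)
    (by positivity)) ?_
  · exact (mul_le_of_le_one_left (abs_nonneg _) (Real.abs_sin_le_one _)).trans (hl _ _)

/-- First order expansion of the increment of the relative phase over one cell. -/
lemma IsPhaseStep.abs_increment_sub_le (h : IsPhaseStep f κ v g) (h₀ : IsPhaseStep f κ₀ v g₀)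
    (hfm : Measurable f) (hf : ∀ t, |f t| ≤ B) (hκ : 0 < κ) (hκ₀ : 0 < κ₀) (hc : κ⁻¹ ≤ c)
    (hc₀ : κ₀⁻¹ ≤ c) (hv : |v| ≤ 1) :
    ∀ C, C = B * (c ^ 2 + c * ((1 + B * c ^ 2) * Real.exp (B * c))) →
    |(g 1 - g₀ 1) - (g 0 - g₀ 0) - (κ - κ₀)
        - v * ((resonance f κ (g 0)).re - (resonance f κ₀ (g₀ 0)).re)|
      ≤ B * (3 * c ^ 2 * (|v| * |κ - κ₀|)
        + c * ((2 + C) * (B * c) + C) * (|v| ^ 2 * (|g 0 - g₀ 0| + |κ - κ₀|))) := by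
  intro C hC
  have hB0 : 0 ≤ B := (abs_nonneg _).trans (hf 0)
  have hi₀ := inv_pos.2 hκ₀
  have hc0 : 0 ≤ c := hi₀.le.trans hc₀
  have hC0 : 0 ≤ C := by rw [hC]; positivity
  set D := |g 0 - g₀ 0| + |κ - κ₀| with hD
  have hD0 : 0 ≤ D := by positivity
  have hgc := h.cont
  have hg₀c := h₀.cont
  have hint : ∀ κ (w : ℝ → ℝ), Continuous w → IntervalIntegrable
      (fun s => f s / (2 * κ) * Real.cos (w s)) volume 0 1 := fun κ w hw =>
    ((intervalIntegrable_of_bound hfm hf 0 1).div_const _).mul_continuousOn (by fun_prop)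
  have e : (g 1 - g₀ 1) - (g 0 - g₀ 0) - (κ - κ₀)
        - v * ((resonance f κ (g 0)).re - (resonance f κ₀ (g₀ 0)).re)
      = -(v * ∫ s in (0 : ℝ)..1, ((f s / κ * Real.sin (g s) ^ 2 - f s / κ₀ * Real.sin (g₀ s) ^ 2)
          + (f s / (2 * κ) * Real.cos (2 * (g 0 + κ * s))
            - f s / (2 * κ₀) * Real.cos (2 * (g₀ 0 + κ₀ * s))))) := by
    rw [intervalIntegral.integral_add
        ((h.intervalIntegrable hfm hf _ _).sub (h₀.intervalIntegrable hfm hf _ _))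
        ((hint _ _ (by fun_prop)).sub (hint _ _ (by fun_prop))),
      intervalIntegral.integral_sub (h.intervalIntegrable hfm hf _ _)
        (h₀.intervalIntegrable hfm hf _ _),
      intervalIntegral.integral_sub (hint _ _ (by fun_prop)) (hint _ _ (by fun_prop)),
      resonance_re hfm hf, resonance_re hfm hf, h.eqn 1 ⟨zero_le_one, le_rfl⟩,
      h₀.eqn 1 ⟨zero_le_one, le_rfl⟩]
    ring
  have hpt : ∀ s ∈ Ioc (0 : ℝ) 1,
      |(f s / κ * Real.sin (g s) ^ 2 - f s / κ₀ * Real.sin (g₀ s) ^ 2)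
          + (f s / (2 * κ) * Real.cos (2 * (g 0 + κ * s))
            - f s / (2 * κ₀) * Real.cos (2 * (g₀ 0 + κ₀ * s)))|
        ≤ B * (3 * c ^ 2 * |κ - κ₀| + c * ((2 + C) * (B * c) + C) * (|v| * D)) := by
    intro s hs
    have hs' : s ∈ Icc (0 : ℝ) 1 := ⟨hs.1.le, hs.2⟩
    have hb := h.abs_sub_linear_le hf hκ hc hs'
    have hbb := h.abs_deviation_sub_le h₀ hfm hf hκ hκ₀ hc hc₀ hv hs'
    rw [← hC, ← hD] at hbb
    set b := g s - g 0 - κ * s with hbd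
    set b₀ := g₀ s - g₀ 0 - κ₀ * s with hb₀d
    set a := g 0 + κ * s with had
    set a₀ := g₀ 0 + κ₀ * s with ha₀d
    have hg : g s = a + b := by rw [had, hbd]; ring
    have hg₀ : g₀ s = a₀ + b₀ := by rw [ha₀d, hb₀d]; ring
    have haa : |a - a₀| ≤ D := by
      have : a - a₀ = (g 0 - g₀ 0) + (κ - κ₀) * s := by rw [had, ha₀d]; ring
      rw [this]
      refine (abs_add_le _ _).trans ?_
      rw [abs_mul, abs_of_pos hs.1, hD]
      gcongr
      exact mul_le_of_le_one_right (abs_nonneg _) hs.2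
    have hcos := abs_cos_sub_cos_add_le a b a₀ b₀
    rw [← hg, ← hg₀] at hcos
    have hcos' : 2 * ((2 * |a - a₀| + |b - b₀|) * |b| + |b - b₀|)
        ≤ 2 * (((2 + C) * (B * c) + C) * (|v| * D)) := by
      have h1 : |b - b₀| ≤ C * D := hbb.trans (by
        gcongr
        exact mul_le_of_le_one_left hD0 hv)
      have h2 : (2 * |a - a₀| + |b - b₀|) * |b| ≤ (2 * D + C * D) * (|v| * (B * c)) := by
        gcongr
      nlinarith
    -- The first summand carries the difference of inverse momenta, of order |κ - κ₀|. The second is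
    -- the second difference of cosines, which supplies the extra factor |v|.
    have e2 : (f s / κ * Real.sin (g s) ^ 2 - f s / κ₀ * Real.sin (g₀ s) ^ 2)
          + (f s / (2 * κ) * Real.cos (2 * a) - f s / (2 * κ₀) * Real.cos (2 * a₀))
        = f s * ((κ⁻¹ - κ₀⁻¹) * ((1 + Real.cos (2 * a) - Real.cos (2 * g s)) / 2)
          + κ₀⁻¹ * (((Real.cos (2 * a) - Real.cos (2 * g s))
            - (Real.cos (2 * a₀) - Real.cos (2 * g₀ s))) / 2)) := by
      rw [Real.sin_sq_eq_half_sub, Real.sin_sq_eq_half_sub]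
      field_simp
      ring
    rw [e2, abs_mul]
    refine mul_le_mul (hf s) ((abs_add_le _ _).trans ?_) (abs_nonneg _) hB0
    rw [abs_mul, abs_mul, abs_of_pos hi₀]
    refine add_le_add ?_ ?_
    · have h3 : |(1 + Real.cos (2 * a) - Real.cos (2 * g s)) / 2| ≤ 3 := by
        rw [abs_le]
        have := Real.neg_one_le_cos (2 * a)
        have := Real.neg_one_le_cos (2 * g s)
        have := Real.cos_le_one (2 * a)
        have := Real.cos_le_one (2 * g s)
        constructor <;> linarith
      calc _ ≤ (c ^ 2 * |κ - κ₀|) * 3 := by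
            gcongr
            exact abs_inv_sub_inv_le hκ hκ₀ hc hc₀
        _ = _ := by ring
    · rw [mul_assoc]
      gcongr
      rw [abs_div, abs_two]
      linarith
  have h1 : ‖∫ s in (0 : ℝ)..1, ((f s / κ * Real.sin (g s) ^ 2 - f s / κ₀ * Real.sin (g₀ s) ^ 2)
          + (f s / (2 * κ) * Real.cos (2 * (g 0 + κ * s))
            - f s / (2 * κ₀) * Real.cos (2 * (g₀ 0 + κ₀ * s))))‖
      ≤ B * (3 * c ^ 2 * |κ - κ₀| + c * ((2 + C) * (B * c) + C) * (|v| * D)) * |(1 : ℝ) - 0| := by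
    refine intervalIntegral.norm_integral_le_of_norm_le_const fun s hs => ?_
    rw [uIoc_of_le zero_le_one] at hs
    exact hpt s hs
  rw [sub_zero, abs_one, mul_one] at h1
  rw [e, abs_neg, abs_mul]
  refine (mul_le_mul_of_nonneg_left h1 (abs_nonneg v)).trans (le_of_eq ?_)
  ring

/-- The resonance rotates freely up to an error of the size of the coupling. -/
lemma IsPhaseStep.norm_rotation_le (h : IsPhaseStep f κ v g)
    (hf : ∀ t, |f t| ≤ B) (hκ : 0 < κ) (hc : κ⁻¹ ≤ c) :
    ‖resonance f κ (g 1) - circleExp κ * resonance f κ (g 0)‖ ≤ 2 * (B * c) ^ 2 * |v| := by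
  have hb := h.abs_sub_linear_le hf hκ hc (right_mem_Icc.2 zero_le_one)
  set b := g 1 - g 0 - κ * 1 with hbd
  have e : resonance f κ (g 1) - circleExp κ * resonance f κ (g 0)
      = amplitude f κ * (circleExp (g 0 + κ) * (circleExp b - 1)) := by
    have : g 1 = g 0 + κ + b := by rw [hbd]; ring
    rw [this, resonance, resonance, circleExp_add (g 0 + κ) b, circleExp_add (g 0) κ]
    ring
  have hBc : 0 ≤ B * c := (norm_nonneg _).trans (norm_amplitude_le hf hκ hc)
  rw [e, norm_mul, norm_mul, norm_circleExp, one_mul]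
  calc ‖amplitude f κ‖ * ‖circleExp b - 1‖ ≤ (B * c) * (2 * (|v| * (B * c))) := by
        refine mul_le_mul (norm_amplitude_le hf hκ hc) ((norm_circleExp_sub_one_le b).trans ?_)
          (norm_nonneg _) hBc
        gcongr
    _ = _ := by ring

/-- The rotation error factors as amplitude · e^{2i(g 0 + κ)}(e^{2ib} - 1), with b the deviation
from free motion. The last factor is O(v), and every factor is Lipschitz in the initial phase and
the momentum, so differencing keeps the factor |v| and gains the separation. Summation by parts
needs both gains. -/
lemma IsPhaseStep.norm_rotation_sub_le (h : IsPhaseStep f κ v g) (h₀ : IsPhaseStep f κ₀ v g₀)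
    (hfm : Measurable f) (hf : ∀ t, |f t| ≤ B) (hκ : 0 < κ) (hκ₀ : 0 < κ₀) (hc : κ⁻¹ ≤ c)
    (hc₀ : κ₀⁻¹ ≤ c) (hv : |v| ≤ 1) :
    ∀ C, C = B * (c ^ 2 + c * ((1 + B * c ^ 2) * Real.exp (B * c))) →
    ‖(resonance f κ (g 1) - circleExp κ * resonance f κ (g 0))
      - (resonance f κ₀ (g₀ 1) - circleExp κ₀ * resonance f κ₀ (g₀ 0))‖
      ≤ (B * (c ^ 2 + c) * (2 * (B * c)) + B * c * (4 * (B * c) + 2 * C))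
        * (|v| * (|g 0 - g₀ 0| + |κ - κ₀|)) := by
  intro C hC
  have hB0 : 0 ≤ B := (abs_nonneg _).trans (hf 0)
  have hi₀ := inv_pos.2 hκ₀
  have hc0 : 0 ≤ c := hi₀.le.trans hc₀
  have hC0 : 0 ≤ C := by rw [hC]; positivity
  have hb := h.abs_sub_linear_le hf hκ hc (right_mem_Icc.2 zero_le_one)
  have hbb := h.abs_deviation_sub_le h₀ hfm hf hκ hκ₀ hc hc₀ hv (right_mem_Icc.2 zero_le_one)
  rw [← hC] at hbb
  set D := |g 0 - g₀ 0| + |κ - κ₀| with hD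
  have hD0 : 0 ≤ D := by positivity
  set b := g 1 - g 0 - κ * 1 with hbd
  set b₀ := g₀ 1 - g₀ 0 - κ₀ * 1 with hb₀d
  have e : ∀ κ x b : ℝ, resonance f κ (x + κ + b) - circleExp κ * resonance f κ x
      = amplitude f κ * (circleExp (x + κ) * (circleExp b - 1)) := fun κ x b => by
    rw [resonance, resonance, circleExp_add (x + κ) b, circleExp_add x κ]
    ring
  have hg1 : g 1 = g 0 + κ + b := by rw [hbd]; ring
  have hg₀1 : g₀ 1 = g₀ 0 + κ₀ + b₀ := by rw [hb₀d]; ring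
  rw [hg1, hg₀1, e, e]
  set W := circleExp (g 0 + κ) * (circleExp b - 1) with hW
  set W₀ := circleExp (g₀ 0 + κ₀) * (circleExp b₀ - 1) with hW₀
  have hWn : ‖W‖ ≤ 2 * (|v| * (B * c)) := by
    rw [hW, norm_mul, norm_circleExp, one_mul]
    exact (norm_circleExp_sub_one_le b).trans (by gcongr)
  have hWW : ‖W - W₀‖ ≤ (4 * (B * c) + 2 * C) * (|v| * D) := by
    have e3 : W - W₀ = (circleExp (g 0 + κ) - circleExp (g₀ 0 + κ₀)) * (circleExp b - 1)
        + circleExp (g₀ 0 + κ₀) * (circleExp b - circleExp b₀) := by rw [hW, hW₀]; ring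
    have h1 : ‖circleExp (g 0 + κ) - circleExp (g₀ 0 + κ₀)‖ ≤ 2 * D := by
      refine (norm_circleExp_sub_le _ _).trans ?_
      gcongr
      rw [show g 0 + κ - (g₀ 0 + κ₀) = (g 0 - g₀ 0) + (κ - κ₀) by ring]
      exact abs_add_le _ _
    have h2 : ‖circleExp b - 1‖ ≤ 2 * (|v| * (B * c)) :=
      (norm_circleExp_sub_one_le b).trans (by gcongr)
    have h3 : ‖circleExp b - circleExp b₀‖ ≤ 2 * (C * (|v| * D)) :=
      (norm_circleExp_sub_le b b₀).trans (by gcongr)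
    rw [e3]
    refine (norm_add_le _ _).trans ?_
    rw [norm_mul, norm_mul, norm_circleExp, one_mul]
    calc _ ≤ 2 * D * (2 * (|v| * (B * c))) + 2 * (C * (|v| * D)) := by gcongr
      _ = _ := by ring
  have e4 : amplitude f κ * W - amplitude f κ₀ * W₀
      = (amplitude f κ - amplitude f κ₀) * W + amplitude f κ₀ * (W - W₀) := by ring
  have h5 : |κ - κ₀| ≤ D := by rw [hD]; linarith [abs_nonneg (g 0 - g₀ 0)]
  rw [e4]
  refine (norm_add_le _ _).trans ?_
  rw [norm_mul (_ - _) W, norm_mul (amplitude f κ₀)]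
  calc _ ≤ (B * (c ^ 2 + c) * D) * (2 * (|v| * (B * c)))
        + (B * c) * ((4 * (B * c) + 2 * C) * (|v| * D)) := by
        exact add_le_add
          (mul_le_mul ((norm_amplitude_sub_le hfm hf hκ hκ₀ hc hc₀).trans (by gcongr)) hWn
            (norm_nonneg _) (by positivity))
          (mul_le_mul (norm_amplitude_le hf hκ₀ hc₀) hWW (norm_nonneg _) (by positivity))
    _ = _ := by ring

end

end

end ClockStatistics

/-! ### The alloy potential: cells, measurability, and the recursive estimates -/

namespace ClockStatistics

section

variable {f : ℝ → ℝ} {B α : ℝ} {x : ℕ → ℝ}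

/-- Half-open support leaves only the term with j = ⌊t⌋, with no overlap at the integers. -/
lemma alloyPotential_eq (hs : ∀ t, t ∉ Ico (0 : ℝ) 1 → f t = 0) (α : ℝ) (x : ℕ → ℝ) (t : ℝ) :
    alloyPotential f α x t
      = if t < 1 then 0 else x ⌊t⌋₊ / (⌊t⌋₊ : ℝ) ^ α * f (t - (⌊t⌋₊ : ℝ)) := by
  split_ifs with ht
  · refine (tsum_congr fun j => ?_).trans tsum_zero
    rw [hs _ fun h => ?_, mul_zero]
    have := h.1
    push_cast at this
    linarith [(Nat.cast_nonneg j : (0 : ℝ) ≤ j)]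
  · push Not at ht
    have h1 : 1 ≤ ⌊t⌋₊ := Nat.one_le_floor_iff _ |>.2 ht
    obtain ⟨m, hm⟩ : ∃ m, ⌊t⌋₊ = m + 1 := ⟨⌊t⌋₊ - 1, by omega⟩
    rw [alloyPotential, tsum_eq_single m, hm]
    intro j hj
    rw [hs _ fun h => hj ?_, mul_zero]
    have : ⌊t⌋₊ = j + 1 := (Nat.floor_eq_iff (by linarith)).2 ⟨by linarith [h.1], by linarith [h.2]⟩
    omega

lemma alloyPotential_eq_of_mem (hs : ∀ t, t ∉ Ico (0 : ℝ) 1 → f t = 0) (i : ℕ) {u : ℝ}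
    (hu : u ∈ Ico (0 : ℝ) 1) :
    alloyPotential f α x ((i + 1 : ℕ) + u) = x (i + 1) / ((i + 1 : ℕ) : ℝ) ^ α * f u := by
  have h1 : ⌊((i + 1 : ℕ) : ℝ) + u⌋₊ = i + 1 := by
    rw [Nat.floor_eq_iff (by have := hu.1; positivity)]
    exact ⟨by linarith [hu.1], by linarith [hu.2]⟩
  rw [alloyPotential_eq hs, if_neg, h1, add_sub_cancel_left]
  push_cast
  linarith [hu.1, (Nat.cast_nonneg i : (0 : ℝ) ≤ i)]

lemma measurable_alloyPotential (hfm : Measurable f) (hs : ∀ t, t ∉ Ico (0 : ℝ) 1 → f t = 0)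
    (α : ℝ) (x : ℕ → ℝ) : Measurable (alloyPotential f α x) := by
  have h1 : Measurable fun t : ℝ => ⌊t⌋₊ := Nat.measurable_floor
  have h2 : Measurable fun t : ℝ => x ⌊t⌋₊ / (⌊t⌋₊ : ℝ) ^ α :=
    (measurable_of_countable fun n : ℕ => x n / (n : ℝ) ^ α).comp h1
  have h3 : Measurable fun t : ℝ => f (t - (⌊t⌋₊ : ℝ)) :=
    hfm.comp (measurable_id.sub ((measurable_of_countable fun n : ℕ => (n : ℝ)).comp h1))
  rw [funext (alloyPotential_eq hs α x)]
  exact Measurable.ite measurableSet_Iio measurable_const (h2.mul h3)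

lemma abs_alloyPotential_le (hf : ∀ t, |f t| ≤ B) (hs : ∀ t, t ∉ Ico (0 : ℝ) 1 → f t = 0)
    (hα : 0 ≤ α) {X : ℝ} (hX : ∀ j, 1 ≤ j → |x j| ≤ X) (t : ℝ) :
    |alloyPotential f α x t| ≤ X * B := by
  have hB0 : 0 ≤ B := (abs_nonneg _).trans (hf 0)
  have hX0 : 0 ≤ X := (abs_nonneg _).trans (hX 1 le_rfl)
  rw [alloyPotential_eq hs]
  split_ifs with ht
  · rw [abs_zero]; positivity
  · push Not at ht
    have h1 : 1 ≤ ⌊t⌋₊ := Nat.one_le_floor_iff _ |>.2 ht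
    have h2 : (1 : ℝ) ≤ (⌊t⌋₊ : ℝ) ^ α := Real.one_le_rpow (by exact_mod_cast h1) hα
    rw [abs_mul, abs_div, abs_of_pos (zero_lt_one.trans_le h2)]
    have h3 : |x ⌊t⌋₊| / (⌊t⌋₊ : ℝ) ^ α ≤ X :=
      (div_le_self (abs_nonneg _) h2).trans (hX _ h1)
    exact mul_le_mul h3 (hf _) (abs_nonneg _) hX0

/-- Over the cell `[i + 1, i + 2]` the Prüfer phase is a phase step. -/
lemma isPhaseStep_of_pruferPhase (hfm : Measurable f) (hf : ∀ t, |f t| ≤ B)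
    (hs : ∀ t, t ∉ Ico (0 : ℝ) 1 → f t = 0) (hα : 0 ≤ α) (hx : ∀ j, 1 ≤ j → |x j| ≤ 1)
    {κ : ℝ} (hκ : 0 < κ) (i : ℕ) :
    ∃ g, IsPhaseStep f κ (x (i + 1) * (1 / ((i + 1 : ℕ) : ℝ) ^ α)) g ∧
      ∀ s, 0 ≤ s → pruferPhase (alloyPotential f α x) κ ((i + 1 : ℕ) + s) = g s := by
  set V := alloyPotential f α x with hV
  have hVm : Measurable V := measurable_alloyPotential hfm hs α x
  have hVB : ∀ t, |V t| ≤ 1 * B := abs_alloyPotential_le hf hs hα hx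
  obtain ⟨θ, hθc, -, hθ, heq⟩ := pruferPhase_spec hVm hVB hκ
  have hi0 : (0 : ℝ) ≤ (i + 1 : ℕ) := Nat.cast_nonneg _
  refine ⟨fun s => θ ((i + 1 : ℕ) + s), ⟨by fun_prop, fun s hs' => ?_⟩,
    fun s hs' => hθ _ (by positivity)⟩
  have hint : ∀ a b, IntervalIntegrable (fun s => V s / κ * Real.sin (θ s) ^ 2) volume a b :=
    fun a b => ((intervalIntegrable_of_bound hVm hVB a b).div_const κ).mul_continuousOn
      (by fun_prop)
  have e1 : ∫ u in (((i + 1 : ℕ) : ℝ) + 0)..((i + 1 : ℕ) + s), V u / κ * Real.sin (θ u) ^ 2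
      = x (i + 1) * (1 / ((i + 1 : ℕ) : ℝ) ^ α)
        * ∫ u in (0 : ℝ)..s, f u / κ * Real.sin (θ ((i + 1 : ℕ) + u)) ^ 2 := by
    rw [← intervalIntegral.integral_comp_add_left (fun u => V u / κ * Real.sin (θ u) ^ 2),
      ← intervalIntegral.integral_const_mul]
    refine intervalIntegral.integral_congr_ae ?_
    have h1 : ∀ᵐ u : ℝ, u ≠ 1 := by simp [ae_iff, measure_singleton]
    filter_upwards [h1] with u hu1 hu
    rw [uIoc_of_le hs'.1] at hu
    rw [hV, alloyPotential_eq_of_mem hs i ⟨hu.1.le, lt_of_le_of_ne (hu.2.trans hs'.2) hu1⟩]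
    ring
  have e2 := intervalIntegral.integral_interval_sub_left (hint 0 ((i + 1 : ℕ) + s))
    (hint 0 (((i + 1 : ℕ) : ℝ) + 0))
  rw [← e1, ← e2]
  rw [heq _ (by have := hs'.1; positivity), heq _ (by positivity)]
  ring

/-- The potential vanishes on [0, 1), so the motion is free there. Sampling the relative phase from
time 1 on hence starts with the value δ. -/
lemma pruferPhase_one (hfm : Measurable f) (hf : ∀ t, |f t| ≤ B)
    (hs : ∀ t, t ∉ Ico (0 : ℝ) 1 → f t = 0) (hα : 0 ≤ α) (hx : ∀ j, 1 ≤ j → |x j| ≤ 1)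
    {κ : ℝ} (hκ : 0 < κ) : pruferPhase (alloyPotential f α x) κ 1 = κ := by
  obtain ⟨θ, hθc, -, hθ, heq⟩ := pruferPhase_spec (measurable_alloyPotential hfm hs α x)
    (abs_alloyPotential_le hf hs hα hx) hκ
  rw [hθ 1 zero_le_one, heq 1 zero_le_one, mul_one, sub_eq_self]
  refine (intervalIntegral.integral_congr_ae (g := fun _ => 0) ?_).trans (by simp)
  have h1 : ∀ᵐ u : ℝ, u ≠ 1 := by simp [ae_iff, measure_singleton]
  filter_upwards [h1] with u hu1 hu
  rw [uIoc_of_le zero_le_one] at hu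
  rw [alloyPotential_eq hs, if_pos (lt_of_le_of_ne hu.2 hu1)]
  simp

/-- Stability of the Prüfer phase under perturbations of the potential. -/
lemma abs_pruferPhase_sub_le {V V' : ℝ → ℝ} (hV : Measurable V) (hV' : Measurable V') {B₁ B₂ : ℝ}
    (hB₁ : ∀ t, |V t| ≤ B₁) (hB₂ : ∀ t, |V' t| ≤ B₂) {κ : ℝ} (hκ : 0 < κ) {T ε : ℝ} (hT : 0 ≤ T)
    (hε : ∀ t ∈ Ico 0 T, |V t - V' t| ≤ ε) :
    |pruferPhase V κ T - pruferPhase V' κ T| ≤ ε * T / κ * Real.exp (B₂ / κ * T) := by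
  obtain ⟨θ, hθc, -, hθ, heq⟩ := pruferPhase_spec hV hB₁ hκ
  obtain ⟨θ', hθc', -, hθ', heq'⟩ := pruferPhase_spec hV' hB₂ hκ
  have hB0 : 0 ≤ B₂ := (abs_nonneg _).trans (hB₂ 0)
  rw [hθ T hT, hθ' T hT]
  rcases hT.eq_or_lt with rfl | hTpos
  · simp [heq 0 le_rfl, heq' 0 le_rfl]
  have hε0 : 0 ≤ ε := (abs_nonneg _).trans (hε 0 ⟨le_rfl, hTpos⟩)
  have hint : ∀ a b, IntervalIntegrable (fun s => V s / κ * Real.sin (θ s) ^ 2) volume a b :=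
    fun a b => ((intervalIntegrable_of_bound hV hB₁ a b).div_const κ).mul_continuousOn
      (by fun_prop)
  have hint' : ∀ a b, IntervalIntegrable (fun s => V' s / κ * Real.sin (θ' s) ^ 2) volume a b :=
    fun a b => ((intervalIntegrable_of_bound hV' hB₂ a b).div_const κ).mul_continuousOn
      (by fun_prop)
  have key := le_mul_exp_of_le_add_integral (u := fun s => |θ s - θ' s|) (A := ε * T / κ)
    (K := B₂ / κ) (a := 0) (b := T) (by positivity) (hθc.sub hθc').abs.continuousOn (fun t ht => by
      have e : θ t - θ' t = ∫ s in (0 : ℝ)..t, (V' s / κ * Real.sin (θ' s) ^ 2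
          - V s / κ * Real.sin (θ s) ^ 2) := by
        rw [intervalIntegral.integral_sub (hint' _ _) (hint _ _), heq t ht.1, heq' t ht.1]
        ring
      have h1 : ‖∫ s in (0 : ℝ)..t, (V' s / κ * Real.sin (θ' s) ^ 2
          - V s / κ * Real.sin (θ s) ^ 2)‖
          ≤ ∫ s in (0 : ℝ)..t, (ε / κ + B₂ / κ * |θ s - θ' s|) := by
        have hT1 : ∀ᵐ u : ℝ, u ≠ T := by simp [ae_iff, measure_singleton]
        refine intervalIntegral.norm_integral_le_of_norm_le ht.1 ?_
          (Continuous.intervalIntegrable (by fun_prop) _ _)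
        filter_upwards [hT1] with s hs1 hs2
        have e2 : V' s / κ * Real.sin (θ' s) ^ 2 - V s / κ * Real.sin (θ s) ^ 2
            = -((V s - V' s) / κ * Real.sin (θ s) ^ 2)
              - V' s / κ * (Real.sin (θ s) ^ 2 - Real.sin (θ' s) ^ 2) := by ring
        rw [e2, Real.norm_eq_abs]
        refine (abs_sub _ _).trans ?_
        rw [abs_neg, abs_mul, abs_mul, abs_div, abs_div, abs_of_pos hκ]
        have h3 : |Real.sin (θ s) ^ 2| ≤ 1 := by
          rw [abs_of_nonneg (sq_nonneg _)]; exact Real.sin_sq_le_one _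
        refine add_le_add ?_ ?_
        · refine (mul_le_of_le_one_right (by positivity) h3).trans ?_
          gcongr
          exact hε s ⟨hs2.1.le, lt_of_le_of_ne (hs2.2.trans ht.2) hs1⟩
        · refine mul_le_mul ?_ (abs_sin_sq_sub_sin_sq_le _ _) (abs_nonneg _) (by positivity)
          gcongr
          exact hB₂ s
      rw [intervalIntegral.integral_add intervalIntegrable_const
        (Continuous.intervalIntegrable (by fun_prop) _ _), intervalIntegral.integral_const,
        intervalIntegral.integral_const_mul, sub_zero, smul_eq_mul] at h1
      simp only [e]
      refine h1.trans (add_le_add_left ?_ _)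
      rw [mul_comm, mul_div_right_comm]
      gcongr
      exact ht.2) T ⟨hT, le_rfl⟩
  rwa [sub_zero] at key

/-- Truncation of a sequence of amplitudes to the indices `1, …, i`. -/
def truncate (i : ℕ) (x : ℕ → ℝ) (j : ℕ) : ℝ := if 1 ≤ j ∧ j ≤ i then x j else 0

lemma abs_truncate_le (i : ℕ) (x : ℕ → ℝ) (j : ℕ) :
    |truncate i x j| ≤ ∑ k ∈ Finset.range (i + 1), |x k| := by
  rw [truncate]
  split_ifs with h
  · exact Finset.single_le_sum (f := fun k => |x k|) (fun _ _ => abs_nonneg _)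
      (Finset.mem_range.2 (by omega))
  · rw [abs_zero]
    exact Finset.sum_nonneg fun _ _ => abs_nonneg _

/-- Continuity in the product topology is the route to measurability. Truncation makes finitely many
coordinates matter, so the potential is bounded for every x and the stability estimate applies. -/
lemma continuous_pruferPhase_truncate (hfm : Measurable f) (hf : ∀ t, |f t| ≤ B)
    (hs : ∀ t, t ∉ Ico (0 : ℝ) 1 → f t = 0) (hα : 0 ≤ α) {κ : ℝ} (hκ : 0 < κ) (i : ℕ) :
    Continuous fun x : ℕ → ℝ =>
      pruferPhase (alloyPotential f α (truncate i x)) κ ((i + 1 : ℕ) : ℝ) := by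
  have hB0 : 0 ≤ B := (abs_nonneg _).trans (hf 0)
  rw [continuous_iff_continuousAt]
  intro x₀
  rw [ContinuousAt, tendsto_iff_dist_tendsto_zero]
  set T : ℝ := ((i + 1 : ℕ) : ℝ) with hT
  -- Only the bound at the base point enters the exponent, so the majorant is continuous in x and
  -- vanishes at x₀.
  set M : ℝ := (∑ k ∈ Finset.range (i + 1), |x₀ k|) * B with hM
  have hlim : Tendsto (fun x : ℕ → ℝ => (∑ k ∈ Finset.range (i + 1), |x k - x₀ k|) * B * T / κ
      * Real.exp (M / κ * T)) (𝓝 x₀) (𝓝 0) := by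
    have hc : Continuous fun x : ℕ → ℝ => (∑ k ∈ Finset.range (i + 1), |x k - x₀ k|) * B * T / κ
      * Real.exp (M / κ * T) := by fun_prop
    have := hc.tendsto x₀
    simpa using this
  refine squeeze_zero (fun _ => dist_nonneg) (fun x => ?_) hlim
  rw [Real.dist_eq]
  refine abs_pruferPhase_sub_le (measurable_alloyPotential hfm hs α _)
    (measurable_alloyPotential hfm hs α _)
    (abs_alloyPotential_le hf hs hα fun j _ => abs_truncate_le i x j)
    (abs_alloyPotential_le hf hs hα fun j _ => abs_truncate_le i x₀ j) hκ (Nat.cast_nonneg _)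
    fun t _ => ?_
  have e : alloyPotential f α (truncate i x) t - alloyPotential f α (truncate i x₀) t
      = alloyPotential f α (truncate i fun k => x k - x₀ k) t := by
    simp only [alloyPotential_eq hs, truncate]
    split_ifs <;> ring
  rw [e]
  exact abs_alloyPotential_le hf hs hα (fun j _ => abs_truncate_le i (fun k => x k - x₀ k) j) t

/-- The phase at time `i + 1` is measurable with respect to the first `i` amplitudes. -/
lemma measurable_pruferPhase {Ω : Type*} {m : MeasurableSpace Ω} {ω : ℕ → Ω → ℝ}
    (hfm : Measurable f) (hf : ∀ t, |f t| ≤ B)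
    (hs : ∀ t, t ∉ Ico (0 : ℝ) 1 → f t = 0) (hα : 0 ≤ α) {κ : ℝ} (hκ : 0 < κ) (i : ℕ)
    (hω : ∀ j w, 1 ≤ j → |ω j w| ≤ 1) (hm : ∀ j, 1 ≤ j → j ≤ i → Measurable (ω j)) :
    Measurable fun w =>
      pruferPhase (alloyPotential f α fun j => ω j w) κ ((i + 1 : ℕ) : ℝ) := by
  have h1 : Measurable fun w => truncate i fun j => ω j w := by
    rw [measurable_pi_iff]
    intro j
    simp only [truncate]
    split_ifs with h
    · exact hm j h.1 h.2
    · exact measurable_const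
  have h2 : (fun w => pruferPhase (alloyPotential f α fun j => ω j w) κ ((i + 1 : ℕ) : ℝ))
      = (fun x : ℕ → ℝ => pruferPhase (alloyPotential f α (truncate i x)) κ ((i + 1 : ℕ) : ℝ))
        ∘ fun w => truncate i fun j => ω j w := by
    funext w
    have h3 : truncate i (truncate i fun j => ω j w) = truncate i fun j => ω j w := by
      funext j
      simp only [truncate]
      split_ifs <;> rfl
    simp only [Function.comp, h3]
    refine sub_eq_zero.1 (abs_eq_zero.1 (le_antisymm ?_ (abs_nonneg _)))
    refine (abs_pruferPhase_sub_le (ε := 0) (measurable_alloyPotential hfm hs α _)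
      (measurable_alloyPotential hfm hs α _)
      (abs_alloyPotential_le hf hs hα fun j hj => hω j w hj)
      (abs_alloyPotential_le hf hs hα fun j _ => abs_truncate_le i _ j) hκ (Nat.cast_nonneg _)
      fun t ht => ?_).trans (by simp)
    rw [alloyPotential_eq hs, alloyPotential_eq hs]
    split_ifs with h
    · simp
    · push Not at h
      have h4 : 1 ≤ ⌊t⌋₊ := Nat.one_le_floor_iff _ |>.2 h
      have h5 : ⌊t⌋₊ < i + 1 := (Nat.floor_lt ht.1).2 ht.2
      rw [truncate, if_pos ⟨h4, by omega⟩, sub_self, abs_zero]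
  rw [h2]
  exact (continuous_pruferPhase_truncate hfm hf hs hα hκ i).measurable.comp h1

/-- The relative phase and the resonances at two momenta, sampled once per cell: the recursive
estimates. Here `v i` is the size of the `i`-th coupling and `ξ i` the `i`-th amplitude. -/
structure CoupledCells (v : ℕ → ℝ) (C δ : ℝ) (p p₀ : ℂ) (ξ Δ : ℕ → ℝ) (z z₀ : ℕ → ℂ) : Prop where
  zero : Δ 0 = δ
  growth : ∀ i, |Δ (i + 1)| ≤ C * (|Δ i| + |δ|)
  increment : ∀ i, |Δ (i + 1) - Δ i - δ - v i * ξ i * ((z i).re - (z₀ i).re)|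
    ≤ C * (v i * |δ| + v i ^ 2 * |Δ i|)
  norm_le : ∀ i, ‖z i‖ ≤ C
  norm_le' : ∀ i, ‖z₀ i‖ ≤ C
  norm_sub_le : ∀ i, ‖z i - z₀ i‖ ≤ C * (|Δ i| + |δ|)
  rotation : ∀ i, ‖z₀ (i + 1) - p₀ * z₀ i‖ ≤ C * v i
  rotation_sub : ∀ i, ‖(z (i + 1) - p * z i) - (z₀ (i + 1) - p₀ * z₀ i)‖
    ≤ C * (v i * (|Δ i| + |δ|))
  norm_eq : ‖p‖ = 1
  norm_eq' : ‖p₀‖ = 1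
  norm_sub_le' : ‖p - p₀‖ ≤ C * |δ|

/-- The size `(i + 1)^{-α}` of the `i`-th coupling. -/
noncomputable def coupling (α : ℝ) (i : ℕ) : ℝ := 1 / ((i + 1 : ℕ) : ℝ) ^ α

lemma coupling_pos (α : ℝ) (i : ℕ) : 0 < coupling α i := by
  rw [coupling]; positivity

lemma coupling_le_one (hα : 0 ≤ α) (i : ℕ) : coupling α i ≤ 1 := by
  rw [coupling, div_le_one (by positivity)]
  exact Real.one_le_rpow (by norm_cast; omega) hα

/-- The constant depends only on B and κ₀, hence is uniform over realisations, momenta and cells;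
the probabilistic estimates rely on this. The second assertion controls non-integer times. -/
lemma exists_coupledCells (B : ℝ) (hB : 0 ≤ B) {κ₀ : ℝ} (hκ₀ : 0 < κ₀) :
    ∃ C, 0 < C ∧ ∀ (f : ℝ → ℝ) (α : ℝ), Measurable f → (∀ t, |f t| ≤ B) →
      (∀ t, t ∉ Ico (0 : ℝ) 1 → f t = 0) → 0 ≤ α → ∀ x : ℕ → ℝ, (∀ j, 1 ≤ j → |x j| ≤ 1) →
      ∀ κ, κ₀ / 2 ≤ κ →
        CoupledCells (coupling α) C (κ - κ₀) (circleExp κ) (circleExp κ₀) (fun i => x (i + 1))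
          (fun i => pruferPhase (alloyPotential f α x) κ ((i + 1 : ℕ) : ℝ)
            - pruferPhase (alloyPotential f α x) κ₀ ((i + 1 : ℕ) : ℝ))
          (fun i => resonance f κ (pruferPhase (alloyPotential f α x) κ ((i + 1 : ℕ) : ℝ)))
          (fun i => resonance f κ₀ (pruferPhase (alloyPotential f α x) κ₀ ((i + 1 : ℕ) : ℝ))) ∧
        ∀ (i : ℕ) (s : ℝ), s ∈ Icc (0 : ℝ) 1 →
          |(pruferPhase (alloyPotential f α x) κ ((i + 1 : ℕ) + s)
              - pruferPhase (alloyPotential f α x) κ₀ ((i + 1 : ℕ) + s))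
            - (pruferPhase (alloyPotential f α x) κ ((i + 1 : ℕ) : ℝ)
              - pruferPhase (alloyPotential f α x) κ₀ ((i + 1 : ℕ) : ℝ)) - (κ - κ₀) * s|
            ≤ C * coupling α i := by
  -- A common bound for κ⁻¹ and κ₀⁻¹, valid because κ ≥ κ₀ / 2.
  set c : ℝ := 2 / κ₀ with hcdef
  have hc0 : 0 < c := by positivity
  set C₁ := B * (c ^ 2 + c * ((1 + B * c ^ 2) * Real.exp (B * c))) with hC₁
  set C₂ := (1 + B * c ^ 2) * Real.exp (B * c) with hC₂
  set C₃ := B * (3 * c ^ 2) + B * (c * ((2 + C₁) * (B * c) + C₁)) with hC₃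
  set C₄ := B * (c ^ 2 + 3 * c) with hC₄
  set C₅ := 2 * (B * c) ^ 2 with hC₅
  set C₆ := B * (c ^ 2 + c) * (2 * (B * c)) + B * c * (4 * (B * c) + 2 * C₁) with hC₆
  have h1 : 0 ≤ C₁ := by positivity
  have h2 : 0 ≤ C₂ := by positivity
  have h3 : 0 ≤ C₃ := by positivity
  have h4 : 0 ≤ C₄ := by positivity
  have h5 : 0 ≤ C₅ := by positivity
  have h6 : 0 ≤ C₆ := by positivity
  have h7 : 0 ≤ B * c := by positivity
  refine ⟨C₁ + C₂ + C₃ + C₄ + C₅ + C₆ + 2 * (B * c) + 2, by positivity,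
    fun f α hfm hf hs hα x hx κ hκ => ?_⟩
  set C := C₁ + C₂ + C₃ + C₄ + C₅ + C₆ + 2 * (B * c) + 2 with hC
  have hκpos : 0 < κ := by linarith
  have hc : κ⁻¹ ≤ c := by
    rw [hcdef, show 2 / κ₀ = (κ₀ / 2)⁻¹ by rw [inv_div]]
    exact inv_anti₀ (by positivity) hκ
  have hc₀ : κ₀⁻¹ ≤ c := by
    rw [hcdef, show 2 / κ₀ = (κ₀ / 2)⁻¹ by rw [inv_div]]
    exact inv_anti₀ (by positivity) (by linarith)
  set V := alloyPotential f α x with hV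
  choose g hg hgθ using fun i => isPhaseStep_of_pruferPhase hfm hf hs hα hx hκpos i
  choose g₀ hg₀ hgθ₀ using fun i => isPhaseStep_of_pruferPhase hfm hf hs hα hx hκ₀ i
  have e0 : ∀ i : ℕ, pruferPhase V κ ((i + 1 : ℕ) : ℝ) = g i 0 := fun i => by
    rw [← hgθ i 0 le_rfl, add_zero]
  have e0' : ∀ i : ℕ, pruferPhase V κ₀ ((i + 1 : ℕ) : ℝ) = g₀ i 0 := fun i => by
    rw [← hgθ₀ i 0 le_rfl, add_zero]
  have e1 : ∀ i : ℕ, pruferPhase V κ ((i + 1 + 1 : ℕ) : ℝ) = g i 1 := fun i => by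
    rw [← hgθ i 1 zero_le_one]; push_cast; rfl
  have e1' : ∀ i : ℕ, pruferPhase V κ₀ ((i + 1 + 1 : ℕ) : ℝ) = g₀ i 1 := fun i => by
    rw [← hgθ₀ i 1 zero_le_one]; push_cast; rfl
  have hvle : ∀ i, |x (i + 1) * (1 / ((i + 1 : ℕ) : ℝ) ^ α)| ≤ coupling α i := fun i => by
    rw [abs_mul, ← coupling, abs_of_pos (coupling_pos α i)]
    exact mul_le_of_le_one_left (coupling_pos α i).le (hx _ (by omega))
  have hv1 : ∀ i, |x (i + 1) * (1 / ((i + 1 : ℕ) : ℝ) ^ α)| ≤ 1 := fun i =>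
    (hvle i).trans (coupling_le_one hα i)
  refine ⟨⟨?_, fun i => ?_, fun i => ?_, fun i => ?_, fun i => ?_, fun i => ?_, fun i => ?_,
    fun i => ?_, norm_circleExp _, norm_circleExp _, ?_⟩, fun i s hs' => ?_⟩
  · simp only [zero_add, Nat.cast_one]
    rw [pruferPhase_one hfm hf hs hα hx hκpos, pruferPhase_one hfm hf hs hα hx hκ₀]
  · simp only [e1, e1']
    simp only [e0, e0']
    refine ((hg i).abs_sub_le (hg₀ i) hfm hf hκpos hκ₀ hc hc₀ (hv1 i)
      (right_mem_Icc.2 zero_le_one)).trans ?_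
    gcongr
    linarith
  · simp only [e1, e1']
    simp only [e0, e0']
    have := (hg i).abs_increment_sub_le (hg₀ i) hfm hf hκpos hκ₀ hc hc₀ (hv1 i) C₁ hC₁
    rw [show coupling α i * x (i + 1) = x (i + 1) * (1 / ((i + 1 : ℕ) : ℝ) ^ α) by
      rw [coupling, mul_comm]]
    refine this.trans ?_
    have hv := hvle i
    set v' := |x (i + 1) * (1 / ((i + 1 : ℕ) : ℝ) ^ α)|
    have hv0 : 0 ≤ v' := abs_nonneg _
    have hvv : v' ^ 2 ≤ coupling α i ^ 2 := by gcongr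
    -- The |κ - κ₀| part may lose one power of the coupling; the part with the relative phase must
    -- keep the square, since only the squares are summable.
    have hvv' : v' ^ 2 ≤ coupling α i := by
      have := hv1 i
      nlinarith
    calc B * (3 * c ^ 2 * (v' * |κ - κ₀|)
          + c * ((2 + C₁) * (B * c) + C₁) * (v' ^ 2 * (|g i 0 - g₀ i 0| + |κ - κ₀|)))
        = B * (3 * c ^ 2) * (v' * |κ - κ₀|) + B * (c * ((2 + C₁) * (B * c) + C₁))
          * (v' ^ 2 * |κ - κ₀| + v' ^ 2 * |g i 0 - g₀ i 0|) := by ring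
      _ ≤ B * (3 * c ^ 2) * (coupling α i * |κ - κ₀| + coupling α i ^ 2 * |g i 0 - g₀ i 0|)
          + B * (c * ((2 + C₁) * (B * c) + C₁))
          * (coupling α i * |κ - κ₀| + coupling α i ^ 2 * |g i 0 - g₀ i 0|) := by
          gcongr
          have : 0 ≤ coupling α i ^ 2 * |g i 0 - g₀ i 0| := by positivity
          have : v' * |κ - κ₀| ≤ coupling α i * |κ - κ₀| := by gcongr
          linarith
      _ = C₃ * (coupling α i * |κ - κ₀| + coupling α i ^ 2 * |g i 0 - g₀ i 0|) := by
          rw [hC₃]; ring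
      _ ≤ C * (coupling α i * |κ - κ₀| + coupling α i ^ 2 * |g i 0 - g₀ i 0|) := by
          have := coupling_pos α i
          gcongr
          linarith
  · exact (norm_resonance_le hf hκpos hc _).trans (by linarith)
  · exact (norm_resonance_le hf hκ₀ hc₀ _).trans (by linarith)
  · refine (norm_resonance_sub_le hfm hf hκpos hκ₀ hc hc₀ _ _).trans ?_
    gcongr
    linarith
  · simp only [e1']
    simp only [e0']
    refine ((hg₀ i).norm_rotation_le hf hκ₀ hc₀).trans ?_
    exact mul_le_mul (by linarith) (hvle i) (abs_nonneg _) (by positivity)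
  · simp only [e1, e1']
    simp only [e0, e0']
    refine ((hg i).norm_rotation_sub_le (hg₀ i) hfm hf hκpos hκ₀ hc hc₀ (hv1 i) C₁ hC₁).trans ?_
    refine mul_le_mul (by linarith) ?_ (by positivity) (by positivity)
    gcongr
    exact hvle i
  · refine (norm_circleExp_sub_le _ _).trans ?_
    gcongr
    linarith
  · rw [hgθ i s hs'.1, hgθ₀ i s hs'.1, e0, e0']
    have a1 := (hg i).abs_sub_linear_le hf hκpos hc hs'
    have a2 := (hg₀ i).abs_sub_linear_le hf hκ₀ hc₀ hs'
    have e : g i s - g₀ i s - (g i 0 - g₀ i 0) - (κ - κ₀) * s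
        = (g i s - g i 0 - κ * s) - (g₀ i s - g₀ i 0 - κ₀ * s) := by ring
    rw [e]
    refine (abs_sub _ _).trans ?_
    calc _ ≤ coupling α i * (B * c) + coupling α i * (B * c) := by
          refine add_le_add (a1.trans ?_) (a2.trans ?_) <;> gcongr <;> exact hvle i
      _ = 2 * (B * c) * coupling α i := by ring
      _ ≤ C * coupling α i := by
          have := coupling_pos α i
          gcongr
          linarith

end

end ClockStatistics

/-! ### Twisted correctors and summation by parts along one path -/

namespace ClockStatistics

section

/-- The twisted corrector of a family of predictions `e j k` of the `j`-th amplitude at time `k`,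
with horizon `N`. -/
noncomputable def corrector (p : ℂ) (e : ℕ → ℕ → ℝ) (N k : ℕ) : ℂ :=
  ∑ m ∈ Finset.range (N + 1 - k), p ^ m * (e (k + m) k : ℂ)

/-- The change of the corrector due to the information gained between the times `k`, `k + 1`. -/
noncomputable def innovation (p : ℂ) (e : ℕ → ℕ → ℝ) (N k : ℕ) : ℂ :=
  ∑ m ∈ Finset.range (N - k), p ^ m * ((e (k + 1 + m) (k + 1) - e (k + 1 + m) k : ℝ) : ℂ)

variable {p p₀ : ℂ} {e : ℕ → ℕ → ℝ} {q K : ℝ} {N k : ℕ}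

/-- A Poisson equation twisted by p: splitting off the m = 0 term of the corrector and shifting the
rest produces p times the next corrector, except that the predictions are still those made at time
k. The innovation repairs this. -/
lemma eq_corrector_sub_add_innovation (p : ℂ) (e : ℕ → ℕ → ℝ) (hk : k ≤ N) :
    (e k k : ℂ) = corrector p e N k - p * corrector p e N (k + 1) + p * innovation p e N k := by
  have h1 : N + 1 - k = (N - k) + 1 := by omega
  have h2 : N + 1 - (k + 1) = N - k := by omega
  rw [corrector, corrector, innovation, h1, h2, Finset.sum_range_succ', Finset.mul_sum,
    Finset.mul_sum]
  have h3 : ∀ m, p ^ (m + 1) * (e (k + (m + 1)) k : ℂ) = p * (p ^ m * (e (k + 1 + m) (k + 1) : ℂ))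
      - p * (p ^ m * ((e (k + 1 + m) (k + 1) - e (k + 1 + m) k : ℝ) : ℂ)) := fun m => by
    rw [show k + (m + 1) = k + 1 + m by ring]
    push_cast
    ring
  simp only [h3, Finset.sum_sub_distrib, add_zero, pow_zero, one_mul]
  ring

lemma norm_pow_sub_pow_le (hp : ‖p‖ = 1) (hp₀ : ‖p₀‖ = 1) (m : ℕ) :
    ‖p ^ m - p₀ ^ m‖ ≤ m * ‖p - p₀‖ := by
  induction m with
  | zero => simp
  | succ m ih =>
    have : p ^ (m + 1) - p₀ ^ (m + 1) = (p ^ m - p₀ ^ m) * p + p₀ ^ m * (p - p₀) := by ring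
    rw [this]
    refine (norm_add_le _ _).trans ?_
    rw [norm_mul, norm_mul, norm_pow, hp, hp₀, one_pow, one_mul, mul_one]
    push_cast
    linarith

lemma norm_sum_pow_mul_le (hp : ‖p‖ = 1) {a : ℕ → ℝ} {A : ℝ} (hA : 0 ≤ A)
    (hK : ∀ n, ∑ m ∈ Finset.range n, q ^ m ≤ K) (n : ℕ) (ha : ∀ m < n, |a m| ≤ A * q ^ m) :
    ‖∑ m ∈ Finset.range n, p ^ m * (a m : ℂ)‖ ≤ A * K := by
  calc _ ≤ ∑ m ∈ Finset.range n, A * q ^ m := by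
        refine norm_sum_le_of_le _ fun m hm => ?_
        rw [norm_mul, norm_pow, hp, one_pow, one_mul, Complex.norm_real]
        exact ha m (Finset.mem_range.1 hm)
    _ ≤ A * K := by
        rw [← Finset.mul_sum]
        exact mul_le_mul_of_nonneg_left (hK n) hA

/-- Differentiating p^m costs a factor m, which explains the second series required of geometric
predictions. -/
lemma norm_sum_pow_mul_sub_le (hp : ‖p‖ = 1) (hp₀ : ‖p₀‖ = 1) {a : ℕ → ℝ} {A : ℝ} (hA : 0 ≤ A)
    (hK : ∀ n, ∑ m ∈ Finset.range n, (m : ℝ) * q ^ m ≤ K) (n : ℕ)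
    (ha : ∀ m < n, |a m| ≤ A * q ^ m) :
    ‖∑ m ∈ Finset.range n, p ^ m * (a m : ℂ) - ∑ m ∈ Finset.range n, p₀ ^ m * (a m : ℂ)‖
      ≤ A * K * ‖p - p₀‖ := by
  rw [← Finset.sum_sub_distrib]
  calc _ ≤ ∑ m ∈ Finset.range n, (A * ‖p - p₀‖) * ((m : ℝ) * q ^ m) := by
        refine norm_sum_le_of_le _ fun m hm => ?_
        rw [← sub_mul, norm_mul, Complex.norm_real, Real.norm_eq_abs]
        calc _ ≤ (m * ‖p - p₀‖) * (A * q ^ m) :=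
              mul_le_mul (norm_pow_sub_pow_le hp hp₀ m) (ha m (Finset.mem_range.1 hm))
                (abs_nonneg _) (by positivity)
          _ = _ := by ring
    _ ≤ (A * ‖p - p₀‖) * K := by
        rw [← Finset.mul_sum]
        exact mul_le_mul_of_nonneg_left (hK n) (by positivity)
    _ = _ := by ring

/-- Predictions whose quality decays geometrically in the prediction distance. -/
structure IsGeometricPrediction (q K : ℝ) (e : ℕ → ℕ → ℝ) : Prop where
  nonneg : 0 ≤ q
  le_one : q ≤ 1
  sum_le : ∀ n, ∑ m ∈ Finset.range n, q ^ m ≤ K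
  sum_le' : ∀ n, ∑ m ∈ Finset.range n, (m : ℝ) * q ^ m ≤ K
  bound : ∀ k m, |e (k + m) k| ≤ q ^ m

namespace IsGeometricPrediction

lemma K_nonneg (h : IsGeometricPrediction q K e) : 0 ≤ K := by simpa using h.sum_le 0

lemma norm_corrector_le (h : IsGeometricPrediction q K e) (hp : ‖p‖ = 1) (N k : ℕ) :
    ‖corrector p e N k‖ ≤ K := by
  have := norm_sum_pow_mul_le hp zero_le_one h.sum_le (N + 1 - k) (a := fun m => e (k + m) k)
    (fun m _ => by rw [one_mul]; exact h.bound k m)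
  rwa [one_mul] at this

lemma norm_corrector_sub_le (h : IsGeometricPrediction q K e) (hp : ‖p‖ = 1) (hp₀ : ‖p₀‖ = 1)
    (N k : ℕ) : ‖corrector p e N k - corrector p₀ e N k‖ ≤ K * ‖p - p₀‖ := by
  have := norm_sum_pow_mul_sub_le hp hp₀ zero_le_one h.sum_le' (N + 1 - k)
    (a := fun m => e (k + m) k) (fun m _ => by rw [one_mul]; exact h.bound k m)
  rwa [one_mul] at this

lemma abs_innovation_coeff_le (h : IsGeometricPrediction q K e) (k m : ℕ) :
    |e (k + 1 + m) (k + 1) - e (k + 1 + m) k| ≤ 2 * q ^ m := by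
  have h1 := h.bound (k + 1) m
  have h2 := h.bound k (1 + m)
  rw [← add_assoc] at h2
  have h3 : q ^ (1 + m) ≤ q ^ m := pow_le_pow_of_le_one h.nonneg h.le_one (by omega)
  refine (abs_sub _ _).trans ?_
  linarith

lemma norm_innovation_le (h : IsGeometricPrediction q K e) (hp : ‖p‖ = 1) (N k : ℕ) :
    ‖innovation p e N k‖ ≤ 2 * K :=
  norm_sum_pow_mul_le hp zero_le_two h.sum_le (N - k) fun m _ => h.abs_innovation_coeff_le k m

lemma norm_innovation_sub_le (h : IsGeometricPrediction q K e) (hp : ‖p‖ = 1) (hp₀ : ‖p₀‖ = 1)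
    (N k : ℕ) : ‖innovation p e N k - innovation p₀ e N k‖ ≤ 2 * K * ‖p - p₀‖ :=
  norm_sum_pow_mul_sub_le hp hp₀ zero_le_two h.sum_le' (N - k)
    fun m _ => h.abs_innovation_coeff_le k m

end IsGeometricPrediction

/-- Admissible coupling sequences. -/
structure IsCoupling (v : ℕ → ℝ) (S : ℝ) : Prop where
  pos : ∀ i, 0 < v i
  le_one : ∀ i, v i ≤ 1
  succ_le : ∀ i, v (i + 1) ≤ v i
  sub_le : ∀ i, v i - v (i + 1) ≤ v i ^ 2
  sum_le : ∀ n, ∑ i ∈ Finset.range n, v i ^ 2 ≤ S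

/-- The martingale increment in the evolution of the relative phase. -/
noncomputable def martingaleIncrement (v : ℕ → ℝ) (p p₀ : ℂ) (e : ℕ → ℕ → ℝ) (N : ℕ) (z z₀ : ℕ → ℂ)
    (i : ℕ) : ℝ :=
  (v i * (p * innovation p e N i * z i - p₀ * innovation p₀ e N i * z₀ i)).re

variable {v ξ Δ : ℕ → ℝ} {C S δ : ℝ} {z z₀ : ℕ → ℂ}

namespace CoupledCells

lemma C_nonneg (h : CoupledCells v C δ p p₀ ξ Δ z z₀) : 0 ≤ C := (norm_nonneg _).trans (h.norm_le 0)

/-- Change z, the innovation and p to their values at κ₀ one at a time; each replacement costs O(|Δ|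
+ |δ|). The quadratic variation is thus controlled by ∑ v²(Δ² + δ²). -/
lemma abs_increment_le (h : CoupledCells v C δ p p₀ ξ Δ z z₀) (he : IsGeometricPrediction q K e)
    (hv : ∀ i, 0 < v i) (N i : ℕ) :
    |martingaleIncrement v p p₀ e N z z₀ i| ≤ (2 * K * C + 4 * K * C ^ 2) * (v i * (|Δ i| + |δ|)) := by
  have hC := h.C_nonneg
  have hK := he.K_nonneg
  set D := innovation p e N i
  set D₀ := innovation p₀ e N i
  have hD : ‖D‖ ≤ 2 * K := he.norm_innovation_le h.norm_eq N i
  have hD₀ : ‖D₀‖ ≤ 2 * K := he.norm_innovation_le h.norm_eq' N i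
  have hDD : ‖D - D₀‖ ≤ 2 * K * (C * |δ|) :=
    (he.norm_innovation_sub_le h.norm_eq h.norm_eq' N i).trans (by
      gcongr; exact h.norm_sub_le')
  have e1 : p * D * z i - p₀ * D₀ * z₀ i = p * D * (z i - z₀ i) + p * (D - D₀) * z₀ i
      + (p - p₀) * D₀ * z₀ i := by ring
  have h1 : ‖p * D * z i - p₀ * D₀ * z₀ i‖
      ≤ 2 * K * (C * (|Δ i| + |δ|)) + 2 * K * (C * |δ|) * C + C * |δ| * (2 * K) * C := by
    rw [e1]
    refine (norm_add₃_le).trans ?_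
    rw [norm_mul, norm_mul, norm_mul, norm_mul, norm_mul, norm_mul, h.norm_eq, one_mul, one_mul]
    have a1 := h.norm_sub_le i
    have a2 := h.norm_le' i
    have a3 := h.norm_sub_le'
    gcongr
  have h2 : 0 ≤ K * C ^ 2 * |Δ i| := by positivity
  refine (Complex.abs_re_le_norm _).trans ?_
  rw [norm_mul, Complex.norm_real, Real.norm_eq_abs, abs_of_pos (hv i)]
  calc _ ≤ v i * (2 * K * (C * (|Δ i| + |δ|)) + 2 * K * (C * |δ|) * C + C * |δ| * (2 * K) * C) :=
        mul_le_mul_of_nonneg_left h1 (hv i).le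
    _ ≤ v i * ((2 * K * C + 4 * K * C ^ 2) * (|Δ i| + |δ|)) := by
        refine mul_le_mul_of_nonneg_left ?_ (hv i).le
        nlinarith
    _ = _ := by ring

/-- The boundary term of the summation by parts. -/
noncomputable def boundary (v : ℕ → ℝ) (p p₀ : ℂ) (e : ℕ → ℕ → ℝ) (N : ℕ) (z z₀ : ℕ → ℂ)
    (i : ℕ) : ℂ :=
  v i * (z i * corrector p e N i - z₀ i * corrector p₀ e N i)

lemma norm_boundary_le (h : CoupledCells v C δ p p₀ ξ Δ z z₀) (he : IsGeometricPrediction q K e)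
    (hv : ∀ i, 0 < v i) (N i : ℕ) :
    ‖boundary v p p₀ e N z z₀ i‖ ≤ K * (C + C ^ 2) * (v i * (|Δ i| + |δ|)) := by
  have hC := h.C_nonneg
  have hK := he.K_nonneg
  set X := corrector p e N i with hX
  set X₀ := corrector p₀ e N i with hX₀
  have h1 : ‖z i * X - z₀ i * X₀‖ ≤ C * (|Δ i| + |δ|) * K + C * (K * (C * |δ|)) := by
    have e1 : z i * X - z₀ i * X₀ = (z i - z₀ i) * X + z₀ i * (X - X₀) := by ring
    rw [e1]
    refine (norm_add_le _ _).trans ?_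
    rw [norm_mul, norm_mul]
    have a1 := h.norm_sub_le i
    have a2 := h.norm_le' i
    have a3 : ‖X‖ ≤ K := he.norm_corrector_le h.norm_eq N i
    have a4 : ‖X - X₀‖ ≤ K * (C * |δ|) :=
      (he.norm_corrector_sub_le h.norm_eq h.norm_eq' N i).trans
        (by gcongr; exact h.norm_sub_le')
    gcongr
  have h2 : 0 ≤ K * C ^ 2 * |Δ i| := by positivity
  rw [boundary, norm_mul, Complex.norm_real, Real.norm_eq_abs, abs_of_pos (hv i)]
  calc _ ≤ v i * (C * (|Δ i| + |δ|) * K + C * (K * (C * |δ|))) :=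
        mul_le_mul_of_nonneg_left h1 (hv i).le
    _ ≤ v i * (K * (C + C ^ 2) * (|Δ i| + |δ|)) := by
        refine mul_le_mul_of_nonneg_left ?_ (hv i).le
        nlinarith
    _ = _ := by ring

/-- One step of the summation by parts. -/
lemma abs_step_le (h : CoupledCells v C δ p p₀ ξ Δ z z₀) (he : IsGeometricPrediction q K e)
    (hξ : ∀ k, e k k = ξ k) (hv : IsCoupling v S) {N i : ℕ} (hi : i ≤ N) :
    |Δ (i + 1) - Δ i - δ - martingaleIncrement v p p₀ e N z z₀ i
        - ((boundary v p p₀ e N z z₀ i).re - (boundary v p p₀ e N z z₀ (i + 1)).re)|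
      ≤ (C + K * (2 * C + C ^ 2) + 2 * K * C ^ 2) * (v i ^ 2 * |Δ i| + v i * |δ|) := by
  have hC := h.C_nonneg
  have hK := he.K_nonneg
  have hvp := hv.pos i
  set X := corrector p e N i with hX
  set X₀ := corrector p₀ e N i with hX₀
  set Y := corrector p e N (i + 1) with hY
  set Y₀ := corrector p₀ e N (i + 1) with hY₀
  -- The defect of v z from exact rotation. `W₀` is O(v²), by the rotation estimate and v i - v
  -- (i+1) ≤ v i ^ 2; the difference `W - W₀` gains the further factor |Δ| + |δ|.
  set W := v (i + 1) * z (i + 1) - v i * (p * z i) with hW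
  set W₀ := v (i + 1) * z₀ (i + 1) - v i * (p₀ * z₀ i) with hW₀
  have hξ₁ := eq_corrector_sub_add_innovation p e hi
  have hξ₂ := eq_corrector_sub_add_innovation p₀ e hi
  rw [hξ] at hξ₁ hξ₂
  -- Insert the corrector identity for ξ at both momenta. Replacing v i · p z i by v (i+1) z (i+1)
  -- makes the corrector terms telescope and leaves `W` times the next corrector.
  have e1 : (v i * ξ i * (z i - z₀ i) : ℂ)
      = (boundary v p p₀ e N z z₀ i - boundary v p p₀ e N z z₀ (i + 1))
        + v i * (p * innovation p e N i * z i - p₀ * innovation p₀ e N i * z₀ i)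
        + (W * Y - W₀ * Y₀) := by
    have : (v i * ξ i * (z i - z₀ i) : ℂ) = v i * z i * ξ i - v i * z₀ i * ξ i := by ring
    rw [this]
    conv_lhs => rw [show v i * z i * (ξ i : ℂ) = v i * z i * (X - p * Y + p * innovation p e N i) by
      rw [← hξ₁], show v i * z₀ i * (ξ i : ℂ)
        = v i * z₀ i * (X₀ - p₀ * Y₀ + p₀ * innovation p₀ e N i) by rw [← hξ₂]]
    rw [boundary, boundary]
    simp only [← hX, ← hX₀, ← hY, ← hY₀, hW, hW₀]
    ring
  have e2 : v i * ξ i * ((z i).re - (z₀ i).re)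
      = ((boundary v p p₀ e N z z₀ i).re - (boundary v p p₀ e N z z₀ (i + 1)).re)
        + martingaleIncrement v p p₀ e N z z₀ i + (W * Y - W₀ * Y₀).re := by
    have := congrArg Complex.re e1
    rw [← Complex.ofReal_mul, Complex.re_ofReal_mul, Complex.sub_re, Complex.add_re, Complex.add_re,
      Complex.sub_re] at this
    exact this
  have hd : 0 ≤ v i - v (i + 1) := sub_nonneg.2 (hv.succ_le i)
  have hW₀n : ‖W₀‖ ≤ 2 * C * v i ^ 2 := by
    have e3 : W₀ = v (i + 1) * (z₀ (i + 1) - p₀ * z₀ i) - ((v i - v (i + 1) : ℝ) : ℂ) * (p₀ * z₀ i) := by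
      rw [hW₀]; push_cast; ring
    rw [e3]
    refine (_root_.norm_sub_le _ _).trans ?_
    rw [norm_mul, norm_mul, norm_mul, h.norm_eq', one_mul, Complex.norm_real, Complex.norm_real,
      Real.norm_eq_abs, Real.norm_eq_abs, abs_of_pos (hv.pos _), abs_of_nonneg hd]
    calc _ ≤ v i * (C * v i) + v i ^ 2 * C := by
          refine add_le_add (mul_le_mul (hv.succ_le i) (h.rotation i) (norm_nonneg _) hvp.le)
            (mul_le_mul (hv.sub_le i) (h.norm_le' i) (norm_nonneg _) (sq_nonneg _))
      _ = _ := by ring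
  have hWW : ‖W - W₀‖ ≤ (2 * C + C ^ 2) * (v i ^ 2 * (|Δ i| + |δ|)) := by
    have e3 : W - W₀ = v (i + 1) * ((z (i + 1) - p * z i) - (z₀ (i + 1) - p₀ * z₀ i))
        - ((v i - v (i + 1) : ℝ) : ℂ) * (p * (z i - z₀ i) + (p - p₀) * z₀ i) := by
      rw [hW, hW₀]; push_cast; ring
    have h3 : ‖p * (z i - z₀ i) + (p - p₀) * z₀ i‖ ≤ C * (|Δ i| + |δ|) + C * |δ| * C := by
      refine (norm_add_le _ _).trans ?_
      rw [norm_mul, norm_mul, h.norm_eq, one_mul]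
      have a1 := h.norm_sub_le i
      have a2 := h.norm_le' i
      have a3 := h.norm_sub_le'
      gcongr
    rw [e3]
    refine (_root_.norm_sub_le _ _).trans ?_
    rw [norm_mul, norm_mul, Complex.norm_real, Complex.norm_real,
      Real.norm_eq_abs, Real.norm_eq_abs, abs_of_pos (hv.pos _), abs_of_nonneg hd]
    calc _ ≤ v i * (C * (v i * (|Δ i| + |δ|))) + v i ^ 2 * (C * (|Δ i| + |δ|) + C * |δ| * C) :=
          add_le_add (mul_le_mul (hv.succ_le i) (h.rotation_sub i) (norm_nonneg _) hvp.le)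
            (mul_le_mul (hv.sub_le i) h3 (norm_nonneg _) (sq_nonneg _))
      _ ≤ _ := by
          have : 0 ≤ v i ^ 2 * (C ^ 2 * |Δ i|) := by positivity
          nlinarith
  have hR : ‖W * Y - W₀ * Y₀‖
      ≤ (K * (2 * C + C ^ 2) + 2 * K * C ^ 2) * (v i ^ 2 * |Δ i| + v i * |δ|) := by
    have e3 : W * Y - W₀ * Y₀ = (W - W₀) * Y + W₀ * (Y - Y₀) := by ring
    have a3 : ‖Y‖ ≤ K := he.norm_corrector_le h.norm_eq N (i + 1)
    have a4 : ‖Y - Y₀‖ ≤ K * (C * |δ|) :=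
      (he.norm_corrector_sub_le h.norm_eq h.norm_eq' N (i + 1)).trans
        (by gcongr; exact h.norm_sub_le')
    rw [e3]
    refine (norm_add_le _ _).trans ?_
    rw [norm_mul, norm_mul]
    have hvv : v i ^ 2 ≤ v i := by nlinarith [hv.le_one i]
    have hvd : v i ^ 2 * |δ| ≤ v i * |δ| := by gcongr
    calc _ ≤ (2 * C + C ^ 2) * (v i ^ 2 * (|Δ i| + |δ|)) * K + 2 * C * v i ^ 2 * (K * (C * |δ|)) := by
          gcongr
      _ = K * (2 * C + C ^ 2) * (v i ^ 2 * |Δ i| + v i ^ 2 * |δ|)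
          + 2 * K * C ^ 2 * (v i ^ 2 * |δ|) := by ring
      _ ≤ K * (2 * C + C ^ 2) * (v i ^ 2 * |Δ i| + v i * |δ|)
          + 2 * K * C ^ 2 * (v i ^ 2 * |Δ i| + v i * |δ|) := by
          have : 0 ≤ v i ^ 2 * |Δ i| := by positivity
          gcongr
          linarith
      _ = _ := by ring
  have e4 : Δ (i + 1) - Δ i - δ - martingaleIncrement v p p₀ e N z z₀ i
        - ((boundary v p p₀ e N z z₀ i).re - (boundary v p p₀ e N z z₀ (i + 1)).re)
      = (Δ (i + 1) - Δ i - δ - v i * ξ i * ((z i).re - (z₀ i).re)) + (W * Y - W₀ * Y₀).re := by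
    rw [e2]; ring
  rw [e4]
  refine (abs_add_le _ _).trans ?_
  have h5 := h.increment i
  have h6 := (Complex.abs_re_le_norm _).trans hR
  calc _ ≤ C * (v i * |δ| + v i ^ 2 * |Δ i|)
        + (K * (2 * C + C ^ 2) + 2 * K * C ^ 2) * (v i ^ 2 * |Δ i| + v i * |δ|) := add_le_add h5 h6
    _ = _ := by ring

/-- The steps are added and the boundary terms telescope. The factor m + 1 arises because Δ 0 is
already δ. -/
lemma abs_sub_le (h : CoupledCells v C δ p p₀ ξ Δ z z₀) (he : IsGeometricPrediction q K e)
    (hξ : ∀ k, e k k = ξ k) (hv : IsCoupling v S) {N m : ℕ} (hm : m ≤ N) :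
    |Δ m - (m + 1) * δ| ≤ |∑ i ∈ Finset.range m, martingaleIncrement v p p₀ e N z z₀ i|
      + ‖boundary v p p₀ e N z z₀ 0‖ + ‖boundary v p p₀ e N z z₀ m‖
      + (C + K * (2 * C + C ^ 2) + 2 * K * C ^ 2)
        * ∑ i ∈ Finset.range m, (v i ^ 2 * |Δ i| + v i * |δ|) := by
  set L := C + K * (2 * C + C ^ 2) + 2 * K * C ^ 2
  have key : ∀ m ≤ N, |Δ m - (m + 1) * δ - ∑ i ∈ Finset.range m, martingaleIncrement v p p₀ e N z z₀ i
      - ((boundary v p p₀ e N z z₀ 0).re - (boundary v p p₀ e N z z₀ m).re)|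
      ≤ L * ∑ i ∈ Finset.range m, (v i ^ 2 * |Δ i| + v i * |δ|) := by
    intro m
    induction m with
    | zero => intro _; simp [h.zero]
    | succ m ih =>
      intro hm
      have h1 := ih (by omega)
      have h2 := h.abs_step_le he hξ hv (show m ≤ N by omega)
      rw [Finset.sum_range_succ, Finset.sum_range_succ, mul_add]
      refine le_trans (le_of_eq ?_) ((abs_add_le _ _).trans (add_le_add h1 h2))
      congr 1
      push_cast
      ring
  have h1 := key m hm
  have h2 := Complex.abs_re_le_norm (boundary v p p₀ e N z z₀ 0)
  have h3 := Complex.abs_re_le_norm (boundary v p p₀ e N z z₀ m)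
  rw [abs_le] at h1 h2 h3
  have h4 := abs_le.1 (le_refl |∑ i ∈ Finset.range m, martingaleIncrement v p p₀ e N z z₀ i|)
  rw [abs_le]
  constructor <;> linarith [h1.1, h1.2, h2.1, h2.2, h3.1, h3.2, h4.1, h4.2]

end CoupledCells

lemma add_sq_le_four_mul (a b c d : ℝ) :
    (a + b + c + d) ^ 2 ≤ 4 * (a ^ 2 + b ^ 2 + c ^ 2 + d ^ 2) := by
  linarith [sq_nonneg (a - b), sq_nonneg (a - c), sq_nonneg (a - d), sq_nonneg (b - c),
    sq_nonneg (b - d), sq_nonneg (c - d)]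

set_option maxHeartbeats 800000 in
/-- Pathwise quadratic bound for the deviation of the relative phase from its free evolution. -/
lemma exists_sq_sub_le (C K S : ℝ) (hC : 0 ≤ C) (hK : 0 ≤ K) (hS : 0 ≤ S) :
    ∃ C', 0 < C' ∧ ∀ {v ξ Δ : ℕ → ℝ} {δ q : ℝ} {p p₀ : ℂ} {z z₀ : ℕ → ℂ} {e : ℕ → ℕ → ℝ},
      CoupledCells v C δ p p₀ ξ Δ z z₀ → IsGeometricPrediction q K e → (∀ k, e k k = ξ k) →
      IsCoupling v S → ∀ {N m : ℕ}, m ≤ N →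
      (Δ m - (m + 1) * δ) ^ 2 ≤ C' * ((∑ i ∈ Finset.range m, martingaleIncrement v p p₀ e N z z₀ i) ^ 2
        + ∑ i ∈ Finset.range m, v i ^ 2 * Δ i ^ 2
        + δ ^ 2 * (1 + ∑ i ∈ Finset.range m, v i) ^ 2) := by
  set L := C + K * (2 * C + C ^ 2) + 2 * K * C ^ 2 with hL
  set A := K * (C + C ^ 2) with hA
  have hL0 : 0 ≤ L := by positivity
  have hA0 : 0 ≤ A := by positivity
  set H := 2 * A + A * (C + 1) + L with hH
  have hH0 : 0 ≤ H := by positivity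
  have hAC : 0 ≤ A * (C + 1) := by positivity
  have hLH : L ≤ H := by linarith
  have hAH : A * (C + 1) ≤ H := by linarith
  refine ⟨4 * (1 + H ^ 2 * (S + 2)), by positivity,
    fun {v ξ Δ δ q p p₀ z z₀ e} h he hξ hv {N m} hm => ?_⟩
  rcases Nat.eq_zero_or_pos m with rfl | hmpos
  · have : Δ 0 - ((0 : ℕ) + 1) * δ = 0 := by simp [h.zero]
    rw [this, zero_pow two_ne_zero]
    simp only [Finset.range_zero, Finset.sum_empty]
    positivity
  obtain ⟨l, rfl⟩ : ∃ l, m = l + 1 := ⟨m - 1, by omega⟩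
  set M := ∑ i ∈ Finset.range (l + 1), martingaleIncrement v p p₀ e N z z₀ i with hM
  set Q := ∑ i ∈ Finset.range (l + 1), v i ^ 2 * Δ i ^ 2 with hQ
  set P := ∑ i ∈ Finset.range (l + 1), v i ^ 2 * |Δ i| with hP
  set σ := ∑ i ∈ Finset.range (l + 1), v i with hσ
  have hσ0 : 0 ≤ σ := Finset.sum_nonneg fun i _ => (hv.pos i).le
  have hP0 : 0 ≤ P := Finset.sum_nonneg fun i _ => by positivity
  have hvl := hv.pos l
  have h1 := h.abs_sub_le he hξ hv hm
  rw [Finset.sum_add_distrib, ← Finset.sum_mul, ← hP, ← hσ, ← hM, ← hL] at h1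
  have h2 : ‖CoupledCells.boundary v p p₀ e N z z₀ 0‖ ≤ 2 * A * |δ| := by
    refine (h.norm_boundary_le he hv.pos N 0).trans ?_
    rw [h.zero, ← hA]
    have : v 0 * (|δ| + |δ|) ≤ 2 * |δ| := by
      nlinarith [hv.le_one 0, abs_nonneg δ]
    nlinarith
  -- One-cell growth trades Δ (l + 1) for Δ l, whose contribution (v l |Δ l|)² is a single term of
  -- `Q`. The final bound then involves only earlier indices, as the later Grönwall argument
  -- requires.
  have h3 : ‖CoupledCells.boundary v p p₀ e N z z₀ (l + 1)‖
      ≤ A * (C + 1) * (v l * |Δ l| + |δ|) := by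
    refine (h.norm_boundary_le he hv.pos N (l + 1)).trans ?_
    rw [← hA, mul_assoc A]
    refine mul_le_mul_of_nonneg_left ?_ hA0
    have a1 : v (l + 1) * (|Δ (l + 1)| + |δ|) ≤ v l * (C * (|Δ l| + |δ|) + |δ|) :=
      mul_le_mul (hv.succ_le l) (by linarith [h.growth l]) (by positivity) hvl.le
    have a2 : v l * |δ| ≤ |δ| := mul_le_of_le_one_left (abs_nonneg _) (hv.le_one l)
    have a3 : 0 ≤ v l * |Δ l| := by positivity
    nlinarith [mul_le_mul_of_nonneg_left a2 hC]
  have hQl : (v l * |Δ l|) ^ 2 ≤ Q := by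
    rw [mul_pow, sq_abs]
    exact Finset.single_le_sum (f := fun i => v i ^ 2 * Δ i ^ 2) (fun i _ => by positivity)
      (Finset.mem_range.2 (Nat.lt_succ_self l))
  have hQ0 : 0 ≤ Q := (sq_nonneg _).trans hQl
  -- Cauchy–Schwarz for the product of v and v|Δ|, using ∑ v² ≤ S.
  have hPQ : P ^ 2 ≤ S * Q := by
    have := Finset.sum_mul_sq_le_sq_mul_sq (Finset.range (l + 1)) v (fun i => v i * |Δ i|)
    have e1 : ∑ i ∈ Finset.range (l + 1), v i * (v i * |Δ i|) = P :=
      Finset.sum_congr rfl fun i _ => by ring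
    have e2 : ∑ i ∈ Finset.range (l + 1), (v i * |Δ i|) ^ 2 = Q :=
      Finset.sum_congr rfl fun i _ => by rw [mul_pow, sq_abs]
    rw [e1, e2] at this
    exact this.trans (mul_le_mul_of_nonneg_right (hv.sum_le _) hQ0)
  have h4 : |Δ (l + 1) - ((l + 1 : ℕ) + 1) * δ|
      ≤ |M| + H * P + H * (v l * |Δ l|) + H * (|δ| * (1 + σ)) := by
    have a3 : 0 ≤ v l * |Δ l| := by positivity
    have b1 : L * (P + σ * |δ|) ≤ H * P + L * (|δ| * σ) := by
      have : L * P ≤ H * P := mul_le_mul_of_nonneg_right hLH hP0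
      linarith
    have b2 : A * (C + 1) * (v l * |Δ l|) ≤ H * (v l * |Δ l|) :=
      mul_le_mul_of_nonneg_right hAH a3
    have b3 : 2 * A * |δ| + A * (C + 1) * |δ| + L * (|δ| * σ) ≤ H * (|δ| * (1 + σ)) := by
      have c1 : 0 ≤ |δ| * σ := by positivity
      have c2 : L * (|δ| * σ) ≤ H * (|δ| * σ) :=
        mul_le_mul_of_nonneg_right hLH c1
      have c3 : (2 * A + A * (C + 1)) * |δ| ≤ H * |δ| :=
        mul_le_mul_of_nonneg_right (by linarith) (abs_nonneg _)
      linarith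
    linarith
  have h5 : (Δ (l + 1) - ((l + 1 : ℕ) + 1) * δ) ^ 2
      ≤ (|M| + H * P + H * (v l * |Δ l|) + H * (|δ| * (1 + σ))) ^ 2 := by
    rw [← sq_abs]
    exact pow_le_pow_left₀ (abs_nonneg _) h4 2
  have h7 := h5.trans (add_sq_le_four_mul _ _ _ _)
  rw [sq_abs, mul_pow, mul_pow, mul_pow H, mul_pow |δ|, sq_abs] at h7
  have hH2 : 0 ≤ H ^ 2 := sq_nonneg H
  set T := δ ^ 2 * (1 + σ) ^ 2 with hT
  have hT0 : 0 ≤ T := by positivity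
  have i1 : H ^ 2 * P ^ 2 ≤ H ^ 2 * (S * Q) := mul_le_mul_of_nonneg_left hPQ hH2
  have i2 : H ^ 2 * (v l * |Δ l|) ^ 2 ≤ H ^ 2 * Q := mul_le_mul_of_nonneg_left hQl hH2
  have j1 : 0 ≤ H ^ 2 * (S + 2) * M ^ 2 := by positivity
  have j2 : 0 ≤ H ^ 2 * Q := by positivity
  have j3 : 0 ≤ H ^ 2 * (S + 1) * T := by positivity
  linarith

end

end ClockStatistics

/-! ### Martingale increments and predictions -/

namespace ClockStatistics

section

variable {Ω : Type*} {mΩ : MeasurableSpace Ω} {μ : Measure Ω}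

lemma integrable_of_abs_le [IsFiniteMeasure μ] {X : Ω → ℝ} (hX : Measurable X)
    (hb : ∃ b, ∀ w, |X w| ≤ b) : Integrable X μ := by
  obtain ⟨b, hb⟩ := hb
  exact Integrable.of_bound hX.aestronglyMeasurable b (ae_of_all _ hb)

lemma exists_abs_mul_le {X Y : Ω → ℝ} (hX : ∃ b, ∀ w, |X w| ≤ b) (hY : ∃ b, ∀ w, |Y w| ≤ b) :
    ∃ b, ∀ w, |X w * Y w| ≤ b := by
  obtain ⟨a, ha⟩ := hX
  obtain ⟨b, hb⟩ := hY
  refine ⟨a * b, fun w => ?_⟩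
  rw [abs_mul]
  exact mul_le_mul (ha w) (hb w) (abs_nonneg _) ((abs_nonneg _).trans (ha w))

lemma exists_abs_sum_le {I : ℕ → Ω → ℝ} (hb : ∀ i, ∃ b, ∀ w, |I i w| ≤ b) (n : ℕ) :
    ∃ b, ∀ w, |∑ i ∈ Finset.range n, I i w| ≤ b := by
  choose b hb using hb
  exact ⟨∑ i ∈ Finset.range n, b i, fun w =>
    (Finset.abs_sum_le_sum_abs _ _).trans (Finset.sum_le_sum fun i _ => hb i w)⟩

lemma exists_abs_sq_le {X : Ω → ℝ} (hX : ∃ b, ∀ w, |X w| ≤ b) : ∃ b, ∀ w, |X w ^ 2| ≤ b := by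
  simpa only [sq] using exists_abs_mul_le hX hX

/-- Bounded martingale increments with respect to a filtration. -/
structure IsMartingaleIncrement (μ : Measure Ω) (G : Filtration ℕ mΩ) (I : ℕ → Ω → ℝ) : Prop where
  measurable : ∀ i, Measurable[G (i + 1)] (I i)
  bounded : ∀ i, ∃ b, ∀ w, |I i w| ≤ b
  orthogonal : ∀ i (Y : Ω → ℝ), Measurable[G i] Y → (∃ b, ∀ w, |Y w| ≤ b) →
    ∫ w, Y w * I i w ∂μ = 0

namespace IsMartingaleIncrement

variable {G : Filtration ℕ mΩ} {I : ℕ → Ω → ℝ}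

lemma measurable_sum (h : IsMartingaleIncrement μ G I) (n : ℕ) :
    Measurable[G n] fun w => ∑ i ∈ Finset.range n, I i w :=
  Finset.measurable_sum _ fun i hi =>
    (h.measurable i).mono (G.mono (Finset.mem_range.1 hi)) le_rfl

lemma sq_sum_succ (I : ℕ → Ω → ℝ) (n : ℕ) (w : Ω) :
    (∑ i ∈ Finset.range (n + 1), I i w) ^ 2 = (∑ i ∈ Finset.range n, I i w) ^ 2
      + (2 * (∑ i ∈ Finset.range n, I i w) * I n w + I n w ^ 2) := by
  rw [Finset.sum_range_succ]
  ring

lemma bounded_two_mul_sum (h : IsMartingaleIncrement μ G I) (n : ℕ) :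
    ∃ b, ∀ w, |2 * ∑ i ∈ Finset.range n, I i w| ≤ b :=
  exists_abs_mul_le (X := fun _ => 2) ⟨|2|, fun _ => le_rfl⟩ (exists_abs_sum_le h.bounded n)

variable [IsProbabilityMeasure μ]

lemma integrable_sq_sum (h : IsMartingaleIncrement μ G I) (n : ℕ) :
    Integrable (fun w => (∑ i ∈ Finset.range n, I i w) ^ 2) μ :=
  integrable_of_abs_le (((h.measurable_sum n).mono (G.le n) le_rfl).pow_const 2)
    (exists_abs_sq_le (exists_abs_sum_le h.bounded n))

lemma integrable_sq (h : IsMartingaleIncrement μ G I) (i : ℕ) :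
    Integrable (fun w => I i w ^ 2) μ :=
  integrable_of_abs_le (((h.measurable i).mono (G.le _) le_rfl).pow_const 2)
    (exists_abs_sq_le (h.bounded i))

lemma integrable_cross (h : IsMartingaleIncrement μ G I) (n : ℕ) :
    Integrable (fun w => 2 * (∑ i ∈ Finset.range n, I i w) * I n w) μ :=
  integrable_of_abs_le ((((h.measurable_sum n).mono (G.le n) le_rfl).const_mul 2).mul
    ((h.measurable n).mono (G.le _) le_rfl))
    (exists_abs_mul_le (h.bounded_two_mul_sum n) (h.bounded n))

lemma integrable_cross_add_sq (h : IsMartingaleIncrement μ G I) (n : ℕ) :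
    Integrable (fun w => 2 * (∑ i ∈ Finset.range n, I i w) * I n w + I n w ^ 2) μ :=
  (h.integrable_cross n).add (h.integrable_sq n)

lemma integral_sq_sum (h : IsMartingaleIncrement μ G I) (n : ℕ) :
    ∫ w, (∑ i ∈ Finset.range n, I i w) ^ 2 ∂μ = ∑ i ∈ Finset.range n, ∫ w, I i w ^ 2 ∂μ := by
  induction n with
  | zero => simp
  | succ n ih =>
    simp only [sq_sum_succ]
    rw [integral_add (h.integrable_sq_sum n) (h.integrable_cross_add_sq n),
      integral_add (h.integrable_cross n) (h.integrable_sq n), ih, Finset.sum_range_succ,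
      h.orthogonal n _ ((h.measurable_sum n).const_mul 2) (h.bounded_two_mul_sum n), zero_add]

/-- On each event known at time n the cross term integrates to zero, which leaves the nonnegative
square of the new increment. -/
lemma submartingale_sq_sum (h : IsMartingaleIncrement μ G I) :
    Submartingale (fun n w => (∑ i ∈ Finset.range n, I i w) ^ 2) G μ := by
  refine submartingale_of_setIntegral_le_succ
    (fun n => ((h.measurable_sum n).pow_const 2).stronglyMeasurable) h.integrable_sq_sum ?_
  intro n s hs
  have hs' : MeasurableSet s := G.le n s hs
  simp only [sq_sum_succ I n]
  rw [integral_add (h.integrable_sq_sum n).integrableOn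
    (h.integrable_cross_add_sq n).integrableOn,
    integral_add (h.integrable_cross n).integrableOn (h.integrable_sq n).integrableOn]
  have h1 : ∫ w in s, 2 * (∑ i ∈ Finset.range n, I i w) * I n w ∂μ = 0 := by
    rw [← integral_indicator hs']
    obtain ⟨b, hb⟩ := h.bounded_two_mul_sum n
    have := h.orthogonal n (s.indicator fun w => 2 * ∑ i ∈ Finset.range n, I i w)
      (((h.measurable_sum n).const_mul 2).indicator hs) ⟨b, fun w => by
        by_cases hw : w ∈ s
        · rw [indicator_of_mem hw]; exact hb w
        · rw [indicator_of_notMem hw, abs_zero]; exact (abs_nonneg _).trans (hb w)⟩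
    rw [← this]
    refine integral_congr_ae (ae_of_all _ fun w => ?_)
    by_cases hw : w ∈ s
    · simp only [indicator_of_mem hw]
    · simp only [indicator_of_notMem hw, zero_mul]
  have h2 : 0 ≤ ∫ w in s, I n w ^ 2 ∂μ := integral_nonneg fun w => sq_nonneg _
  rw [h1]
  linarith

/-- Doob's maximal inequality for the squares. -/
lemma measureReal_le (h : IsMartingaleIncrement μ G I) (n : ℕ) {a : ℝ} (ha : 0 < a) :
    μ.real {w | ∃ m ≤ n, a ≤ (∑ i ∈ Finset.range m, I i w) ^ 2}
      ≤ (∑ i ∈ Finset.range n, ∫ w, I i w ^ 2 ∂μ) / a := by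
  set ε : NNReal := ⟨a, ha.le⟩ with hε
  have h1 := maximal_ineq h.submartingale_sq_sum (fun n w => sq_nonneg _) (ε := ε) n
  have hset : {w | ∃ m ≤ n, a ≤ (∑ i ∈ Finset.range m, I i w) ^ 2}
      = {w | (ε : ℝ) ≤ (Finset.range (n + 1)).sup' Finset.nonempty_range_add_one
        fun k => (∑ i ∈ Finset.range k, I i w) ^ 2} := by
    ext w
    simp only [mem_ofPred_eq, Finset.le_sup'_iff, Finset.mem_range, Nat.lt_succ_iff]
    rfl
  rw [← hset] at h1
  set s := {w | ∃ m ≤ n, a ≤ (∑ i ∈ Finset.range m, I i w) ^ 2} with hs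
  have h2 : ∫ w in s, (∑ i ∈ Finset.range n, I i w) ^ 2 ∂μ
      ≤ ∑ i ∈ Finset.range n, ∫ w, I i w ^ 2 ∂μ := by
    rw [← h.integral_sq_sum n]
    exact setIntegral_le_integral (h.integrable_sq_sum n) (ae_of_all _ fun w => sq_nonneg _)
  have h3 := ENNReal.toReal_mono ENNReal.ofReal_ne_top h1
  rw [ENNReal.toReal_mul, ENNReal.toReal_ofReal (integral_nonneg fun w => sq_nonneg _)] at h3
  rw [le_div_iff₀ ha, mul_comm]
  exact h3.trans h2

end IsMartingaleIncrement

/-- A family of predictions `e j k` of the process `ξ j` based on the information at time `k`. -/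
structure IsPrediction (μ : Measure Ω) (G : Filtration ℕ mΩ) (q : ℝ) (ξ : ℕ → Ω → ℝ)
    (e : ℕ → ℕ → Ω → ℝ) : Prop where
  measurable : ∀ j k, Measurable[G k] (e j k)
  bound : ∀ k m w, |e (k + m) k w| ≤ q ^ m
  self : ∀ k w, e k k w = ξ k w
  orthogonal : ∀ j k, k < j → ∀ Y : Ω → ℝ, Measurable[G k] Y → (∃ b, ∀ w, |Y w| ≤ b) →
    ∫ w, Y w * (e j (k + 1) w - e j k w) ∂μ = 0

-- Conditional expectations satisfy the decay bound only almost surely, while the pathwise argument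
-- is run at every point. Clamping to [-q^{j-k}, q^{j-k}] makes the bound pointwise and changes
-- nothing almost everywhere; on the diagonal the process itself is used. Orthogonality holds
-- because the predictions at times k and k + 1 have the same integral against any bounded function
-- known at time k.
open Classical in
lemma exists_isPrediction [IsProbabilityMeasure μ] {G : Filtration ℕ mΩ} {ξ : ℕ → Ω → ℝ} {ρ : ℝ}
    (hm : ∀ j, Measurable[G j] (ξ j)) (hb : ∀ j w, |ξ j w| ≤ 1)
    (hd : ∀ k j, k < j → ∀ᵐ w ∂μ, |(μ[ξ j | G k]) w| ≤ Real.exp (-ρ * ((j : ℝ) - k))) :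
    ∃ e, IsPrediction μ G (Real.exp (-ρ)) ξ e := by
  set q := Real.exp (-ρ) with hq
  have hq0 : 0 < q := Real.exp_pos _
  have hint : ∀ j, Integrable (ξ j) μ := fun j =>
    integrable_of_abs_le ((hm j).mono (G.le j) le_rfl) ⟨1, hb j⟩
  set e : ℕ → ℕ → Ω → ℝ := fun j k w => if j = k then ξ k w
    else max (-q ^ (j - k)) (min (q ^ (j - k)) ((μ[ξ j | G k]) w)) with he
  have hem : ∀ j k, Measurable[G k] (e j k) := fun j k => by
    by_cases hjk : j = k
    · simp only [he, hjk, if_true]; exact hm k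
    · simp only [he, hjk, if_false]
      exact measurable_const.max
        (measurable_const.min (stronglyMeasurable_condExp (m := G k)).measurable)
  have heb : ∀ k m w, |e (k + m) k w| ≤ q ^ m := fun k m w => by
    by_cases hm0 : m = 0
    · subst hm0; simp only [he, add_zero, if_true, pow_zero]; exact hb k w
    · have : ¬ k + m = k := by omega
      simp only [he, this, if_false, Nat.add_sub_cancel_left]
      have hqm : 0 < q ^ m := pow_pos hq0 m
      rw [abs_le]
      exact ⟨le_max_left _ _, max_le (by linarith) (min_le_left _ _)⟩
  have hae : ∀ j k, k ≤ j → e j k =ᵐ[μ] μ[ξ j | G k] := fun j k hkj => by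
    rcases hkj.eq_or_lt with rfl | hlt
    · rw [condExp_of_stronglyMeasurable (G.le k) (hm k).stronglyMeasurable (hint k)]
      exact ae_of_all _ fun w => by simp [he]
    · filter_upwards [hd k j hlt] with w hw
      have h1 : ¬ j = k := by omega
      have h2 : Real.exp (-ρ * ((j : ℝ) - k)) = q ^ (j - k) := by
        rw [hq, ← Real.exp_nat_mul, Nat.cast_sub hlt.le, mul_comm]
      rw [h2, abs_le] at hw
      simp only [he, h1, if_false]
      rw [min_eq_right hw.2, max_eq_right hw.1]
  have hpull : ∀ j k, k ≤ j → ∀ Y : Ω → ℝ, Measurable[G k] Y → (∃ b, ∀ w, |Y w| ≤ b) →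
      Integrable (fun w => Y w * e j k w) μ ∧
      ∫ w, Y w * e j k w ∂μ = ∫ w, Y w * ξ j w ∂μ := by
    intro j k hkj Y hY hYb
    have hjk : j = k + (j - k) := by omega
    refine ⟨integrable_of_abs_le ((hY.mono (G.le k) le_rfl).mul ((hem j k).mono (G.le k) le_rfl))
      (exists_abs_mul_le hYb ⟨q ^ (j - k), fun w => by
        have := heb k (j - k) w
        rwa [← hjk] at this⟩), ?_⟩
    obtain ⟨b, hb'⟩ := hYb
    have h1 := condExp_stronglyMeasurable_mul_of_bound (G.le k) hY.stronglyMeasurable (hint j) b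
      (ae_of_all _ hb')
    calc ∫ w, Y w * e j k w ∂μ = ∫ w, (μ[Y * ξ j | G k]) w ∂μ := by
          refine integral_congr_ae ?_
          filter_upwards [hae j k hkj, h1] with w hw1 hw2
          rw [hw1, hw2, Pi.mul_apply]
      _ = ∫ w, Y w * ξ j w ∂μ := integral_condExp (G.le k)
  refine ⟨e, hem, heb, fun k w => by simp [he], fun j k hkj Y hY hYb => ?_⟩
  obtain ⟨i1, e1⟩ := hpull j (k + 1) hkj Y (hY.mono (G.mono (Nat.le_succ k)) le_rfl) hYb
  obtain ⟨i2, e2⟩ := hpull j k hkj.le Y hY hYb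
  simp only [mul_sub]
  rw [integral_sub i1 i2, e1, e2, sub_self]

/-- The increments in the evolution of the relative phase are martingale increments. -/
lemma isMartingaleIncrement_martingaleIncrement [IsProbabilityMeasure μ] {G : Filtration ℕ mΩ}
    {q C : ℝ} {ξ : ℕ → Ω → ℝ} {e : ℕ → ℕ → Ω → ℝ} (he : IsPrediction μ G q ξ e)
    (v : ℕ → ℝ) (p p₀ : ℂ) (N : ℕ) {z z₀ : ℕ → Ω → ℂ} (hz : ∀ i, Measurable[G i] (z i))
    (hz₀ : ∀ i, Measurable[G i] (z₀ i)) (hzb : ∀ i w, ‖z i w‖ ≤ C) (hzb₀ : ∀ i w, ‖z₀ i w‖ ≤ C) :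
    IsMartingaleIncrement μ G fun i w => martingaleIncrement v p p₀ (fun j k => e j k w) N
      (fun i => z i w) (fun i => z₀ i w) i := by
  -- The coefficient of the m-th prediction update is known at time i, so its product with a bounded
  -- function known at time i is again an admissible test function.
  set c : ℕ → ℕ → Ω → ℝ := fun i m w =>
    (v i * (p * p ^ m * z i w - p₀ * p₀ ^ m * z₀ i w) : ℂ).re with hc
  have hcm : ∀ i m, Measurable[G i] (c i m) := fun i m =>
    Complex.measurable_re.comp ((((hz i).const_mul _).sub ((hz₀ i).const_mul _)).const_mul _)
  have hcb : ∀ i m, ∃ b, ∀ w, |c i m w| ≤ b := fun i m => by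
    refine ⟨‖(v i : ℂ)‖ * (‖p * p ^ m‖ * C + ‖p₀ * p₀ ^ m‖ * C), fun w => ?_⟩
    refine (Complex.abs_re_le_norm _).trans ?_
    rw [norm_mul]
    refine mul_le_mul_of_nonneg_left ((norm_sub_le _ _).trans ?_) (norm_nonneg _)
    rw [norm_mul _ (z i w), norm_mul _ (z₀ i w)]
    have := hzb i w
    have := hzb₀ i w
    gcongr
  have heq : ∀ i w, martingaleIncrement v p p₀ (fun j k => e j k w) N
      (fun i => z i w) (fun i => z₀ i w) i = ∑ m ∈ Finset.range (N - i),
        c i m w * (e (i + 1 + m) (i + 1) w - e (i + 1 + m) i w) := fun i w => by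
    have h1 : (v i * (p * innovation p (fun j k => e j k w) N i * z i w
          - p₀ * innovation p₀ (fun j k => e j k w) N i * z₀ i w) : ℂ)
        = ∑ m ∈ Finset.range (N - i), (v i * (p * p ^ m * z i w - p₀ * p₀ ^ m * z₀ i w)
          * ((e (i + 1 + m) (i + 1) w - e (i + 1 + m) i w : ℝ) : ℂ)) := by
      simp only [innovation]
      rw [Finset.mul_sum, Finset.mul_sum, Finset.sum_mul, Finset.sum_mul, ← Finset.sum_sub_distrib,
        Finset.mul_sum]
      refine Finset.sum_congr rfl fun m _ => ?_
      ring
    rw [martingaleIncrement, h1, Complex.re_sum]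
    refine Finset.sum_congr rfl fun m _ => ?_
    rw [mul_comm, Complex.re_ofReal_mul, mul_comm]
  have hdm : ∀ i m, Measurable[G (i + 1)]
      (fun w => e (i + 1 + m) (i + 1) w - e (i + 1 + m) i w) := fun i m =>
    (he.measurable _ _).sub ((he.measurable _ _).mono (G.mono (Nat.le_succ i)) le_rfl)
  have hdb : ∀ i m, ∃ b, ∀ w, |e (i + 1 + m) (i + 1) w - e (i + 1 + m) i w| ≤ b := fun i m =>
    ⟨q ^ m + q ^ (1 + m), fun w => (abs_sub _ _).trans (add_le_add (he.bound _ _ _) (by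
      rw [add_assoc]; exact he.bound _ _ _))⟩
  have htm : ∀ i m, Measurable[G (i + 1)]
      (fun w => c i m w * (e (i + 1 + m) (i + 1) w - e (i + 1 + m) i w)) := fun i m =>
    ((hcm i m).mono (G.mono (Nat.le_succ i)) le_rfl).mul (hdm i m)
  have htb : ∀ i m, ∃ b, ∀ w, |c i m w * (e (i + 1 + m) (i + 1) w - e (i + 1 + m) i w)| ≤ b :=
    fun i m => exists_abs_mul_le (hcb i m) (hdb i m)
  refine ⟨fun i => ?_, fun i => ?_, fun i Y hY hYb => ?_⟩
  · simp only [heq]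
    exact Finset.measurable_sum _ fun m _ => htm i m
  · simp only [heq]
    exact exists_abs_sum_le (htb i) _
  · simp only [heq, Finset.mul_sum]
    have hi : ∀ m, Integrable (fun w => Y w *
        (c i m w * (e (i + 1 + m) (i + 1) w - e (i + 1 + m) i w))) μ := fun m =>
      integrable_of_abs_le ((hY.mono (G.le i) le_rfl).mul ((htm i m).mono (G.le _) le_rfl))
        (exists_abs_mul_le hYb (htb i m))
    rw [integral_finsetSum _ fun m _ => hi m]
    refine Finset.sum_eq_zero fun m _ => ?_
    have := he.orthogonal (i + 1 + m) i (by omega) (fun w => Y w * c i m w) (hY.mul (hcm i m))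
      (exists_abs_mul_le hYb (hcb i m))
    simpa only [mul_assoc] using this

end

end ClockStatistics

/-! ### Second moments and the maximal deviation -/

namespace ClockStatistics

section

/-- A discrete Grönwall inequality with a monotone inhomogeneity. -/
lemma le_mul_exp_of_le_add_sum {a g w : ℕ → ℝ} {R S : ℝ} (hR : 0 ≤ R) (hw : ∀ i, 0 ≤ w i)
    (hS : ∀ n, ∑ i ∈ Finset.range n, w i ≤ S) (hg0 : ∀ i, 0 ≤ g i) (hg : Monotone g)
    (h : ∀ m, a m ≤ g m + R * ∑ i ∈ Finset.range m, w i * a i) (m : ℕ) :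
    a m ≤ g m * Real.exp (R * S) := by
  -- `P` solves the recursion with equality and constant inhomogeneity 1; monotonicity of g lets g i
  -- be replaced by g m in the sum.
  set P : ℕ → ℝ := fun m => ∏ i ∈ Finset.range m, (1 + R * w i) with hP
  have hPpos : ∀ m, 0 ≤ P m := fun m =>
    Finset.prod_nonneg fun i _ => add_nonneg zero_le_one (mul_nonneg hR (hw i))
  have hsum : ∀ m, 1 + ∑ i ∈ Finset.range m, R * w i * P i = P m := by
    intro m
    induction m with
    | zero => simp [hP]
    | succ m ih =>
      rw [Finset.sum_range_succ, ← add_assoc, ih]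
      simp only [hP, Finset.prod_range_succ]
      ring
  have key : ∀ m, a m ≤ g m * P m := by
    intro m
    induction m using Nat.strong_induction_on with
    | _ m ih =>
      calc a m ≤ g m + R * ∑ i ∈ Finset.range m, w i * a i := h m
        _ ≤ g m + R * ∑ i ∈ Finset.range m, w i * (g m * P i) := by
            gcongr with i hi
            · exact hw i
            · have him := Finset.mem_range.1 hi
              exact (ih i him).trans (mul_le_mul_of_nonneg_right (hg him.le) (hPpos i))
        _ = g m * (1 + ∑ i ∈ Finset.range m, R * w i * P i) := by
            rw [mul_add, mul_one, Finset.mul_sum, Finset.mul_sum]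
            congr 1
            exact Finset.sum_congr rfl fun i _ => by ring
        _ = g m * P m := by rw [hsum]
  refine (key m).trans (mul_le_mul_of_nonneg_left ?_ (hg0 m))
  calc P m ≤ ∏ i ∈ Finset.range m, Real.exp (R * w i) :=
        Finset.prod_le_prod (fun i _ => add_nonneg zero_le_one (mul_nonneg hR (hw i)))
          fun i _ => by rw [add_comm]; exact Real.add_one_le_exp _
    _ = Real.exp (R * ∑ i ∈ Finset.range m, w i) := by rw [← Real.exp_sum, Finset.mul_sum]
    _ ≤ Real.exp (R * S) := Real.exp_le_exp.2 (mul_le_mul_of_nonneg_left (hS m) hR)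

variable {Ω : Type*} {mΩ : MeasurableSpace Ω} {μ : Measure Ω} [IsProbabilityMeasure μ]

/-- A random family of coupled cells, adapted to a filtration. -/
structure IsCoupledProcess (G : Filtration ℕ mΩ) (v : ℕ → ℝ) (C δ : ℝ) (p p₀ : ℂ)
    (ξ Δ : ℕ → Ω → ℝ) (z z₀ : ℕ → Ω → ℂ) : Prop where
  cells : ∀ w, CoupledCells v C δ p p₀ (fun i => ξ i w) (fun i => Δ i w) (fun i => z i w)
    (fun i => z₀ i w)
  measurable : ∀ i, Measurable[G i] (Δ i)
  measurable_z : ∀ i, Measurable[G i] (z i)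
  measurable_z₀ : ∀ i, Measurable[G i] (z₀ i)

variable {G : Filtration ℕ mΩ} {v : ℕ → ℝ} {C δ : ℝ} {p p₀ : ℂ} {ξ Δ : ℕ → Ω → ℝ}
  {z z₀ : ℕ → Ω → ℂ}

lemma IsCoupledProcess.bounded (h : IsCoupledProcess G v C δ p p₀ ξ Δ z z₀) (hC : 0 ≤ C) (i : ℕ) :
    ∃ b, ∀ w, |Δ i w| ≤ b := by
  induction i with
  | zero => exact ⟨|δ|, fun w => by rw [(h.cells w).zero]⟩
  | succ i ih =>
    obtain ⟨b, hb⟩ := ih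
    exact ⟨C * (b + |δ|), fun w => ((h.cells w).growth i).trans (by have := hb w; gcongr)⟩

lemma IsCoupledProcess.integrable_sq (h : IsCoupledProcess G v C δ p p₀ ξ Δ z z₀) (hC : 0 ≤ C)
    (i : ℕ) : Integrable (fun w => Δ i w ^ 2) μ :=
  integrable_of_abs_le (((h.measurable i).mono (G.le i) le_rfl).pow_const 2)
    (exists_abs_sq_le (h.bounded hC i))

set_option maxHeartbeats 1000000 in
/-- Maximal deviation estimate for the relative phase. -/
lemma exists_measureReal_deviation_le {q K S : ℝ} {e : ℕ → ℕ → Ω → ℝ} (hC : 0 ≤ C) (hK : 0 ≤ K)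
    (hS : 0 ≤ S) (he : IsPrediction μ G q ξ e)
    (heq : ∀ w, IsGeometricPrediction q K fun j k => e j k w) (hv : IsCoupling v S) :
    ∃ A, 0 < A ∧ ∀ {δ : ℝ} {p p₀ : ℂ} {Δ : ℕ → Ω → ℝ} {z z₀ : ℕ → Ω → ℂ},
      IsCoupledProcess G v C δ p p₀ ξ Δ z z₀ → ∀ (N : ℕ) (ε : ℝ), 0 < ε →
      μ.real {w | ∃ m ≤ N, ε ≤ |Δ m w - (m + 1) * δ|} ≤ A * δ ^ 2 / ε ^ 2 *
        (∑ i ∈ Finset.range N, v i ^ 2 * ((i : ℝ) + 1) ^ 2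
          + (1 + ∑ i ∈ Finset.range N, v i) ^ 2) := by
  obtain ⟨C', hC', hsq⟩ := exists_sq_sub_le C K S hC hK hS
  set L := (2 * K * C + 4 * K * C ^ 2) ^ 2 * 2 with hL
  have hL0 : 0 ≤ L := by positivity
  -- Chosen to dominate both coefficients in `hrec`: that of (m + 1)² δ² and that of the weighted
  -- sum of second moments.
  set R := 2 + 2 * C' * (L * S + 1) + 2 * C' * (L + 1) with hR
  have hR0 : 0 ≤ R := by positivity
  set A₁ := R * Real.exp (R * S) with hA₁
  have hA₁0 : 0 ≤ A₁ := by positivity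
  refine ⟨2 * C' * (L * (A₁ + 1) + A₁ + 1), by positivity,
    fun {δ p p₀ Δ z z₀} h N ε hε => ?_⟩
  set a : ℕ → ℝ := fun i => ∫ w, Δ i w ^ 2 ∂μ with ha
  have ha0 : ∀ i, 0 ≤ a i := fun i => integral_nonneg fun w => sq_nonneg _
  have hΔi : ∀ i, Integrable (fun w => Δ i w ^ 2) μ := h.integrable_sq hC
  -- The horizon stays a parameter. The moment recursion takes horizon m for each m, whereas the
  -- maximal inequality needs one horizon N, hence one martingale, for all m ≤ N.
  set I : ℕ → ℕ → Ω → ℝ := fun N i w => martingaleIncrement v p p₀ (fun j k => e j k w) N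
      (fun i => z i w) (fun i => z₀ i w) i with hI
  have hIM : ∀ N, IsMartingaleIncrement μ G (I N) := fun N =>
    isMartingaleIncrement_martingaleIncrement he v p p₀ N h.measurable_z h.measurable_z₀
      (fun i w => (h.cells w).norm_le i) (fun i w => (h.cells w).norm_le' i)
  have hIsq : ∀ N i, ∫ w, I N i w ^ 2 ∂μ ≤ L * (v i ^ 2 * (a i + δ ^ 2)) := fun N i => by
    have h1 : ∀ w, I N i w ^ 2 ≤ L * v i ^ 2 * (Δ i w ^ 2 + δ ^ 2) := fun w => by
      have h2 := (h.cells w).abs_increment_le (heq w) hv.pos N i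
      have h3 := pow_le_pow_left₀ (abs_nonneg _) h2 2
      rw [sq_abs] at h3
      refine h3.trans ?_
      have h4 : (|Δ i w| + |δ|) ^ 2 ≤ 2 * (Δ i w ^ 2 + δ ^ 2) := by
        rw [← sq_abs (Δ i w), ← sq_abs δ]
        nlinarith [sq_nonneg (|Δ i w| - |δ|)]
      calc _ = (2 * K * C + 4 * K * C ^ 2) ^ 2 * v i ^ 2 * (|Δ i w| + |δ|) ^ 2 := by ring
        _ ≤ (2 * K * C + 4 * K * C ^ 2) ^ 2 * v i ^ 2 * (2 * (Δ i w ^ 2 + δ ^ 2)) := by gcongr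
        _ = _ := by rw [hL]; ring
    calc ∫ w, I N i w ^ 2 ∂μ ≤ ∫ w, L * v i ^ 2 * (Δ i w ^ 2 + δ ^ 2) ∂μ :=
          integral_mono ((hIM N).integrable_sq i)
            (((hΔi i).add (integrable_const _)).const_mul _) h1
      _ = L * (v i ^ 2 * (a i + δ ^ 2)) := by
          rw [integral_const_mul, integral_add (hΔi i) (integrable_const _), integral_const]
          simp only [probReal_univ, one_smul, ha]
          ring
  have hv0 : ∀ i, 0 ≤ v i ^ 2 := fun i => sq_nonneg _
  have hσ0 : ∀ m, 0 ≤ ∑ i ∈ Finset.range m, v i := fun m =>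
    Finset.sum_nonneg fun i _ => (hv.pos i).le
  have hMsum : ∀ N m, ∑ i ∈ Finset.range m, ∫ w, I N i w ^ 2 ∂μ
      ≤ L * (∑ i ∈ Finset.range m, v i ^ 2 * a i + S * δ ^ 2) := fun N m => by
    calc _ ≤ ∑ i ∈ Finset.range m, L * (v i ^ 2 * (a i + δ ^ 2)) :=
          Finset.sum_le_sum fun i _ => hIsq N i
      _ = L * (∑ i ∈ Finset.range m, v i ^ 2 * a i + (∑ i ∈ Finset.range m, v i ^ 2) * δ ^ 2) := by
          rw [← Finset.mul_sum, Finset.sum_mul, ← Finset.sum_add_distrib]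
          congr 1
          exact Finset.sum_congr rfl fun i _ => by ring
      _ ≤ _ := by
          have := hv.sum_le m
          gcongr
  have hQi : ∀ m, Integrable (fun w => ∑ i ∈ Finset.range m, v i ^ 2 * Δ i w ^ 2) μ := fun m =>
    integrable_finsetSum _ fun i _ => (hΔi i).const_mul _
  have hQint : ∀ m, ∫ w, ∑ i ∈ Finset.range m, v i ^ 2 * Δ i w ^ 2 ∂μ
      = ∑ i ∈ Finset.range m, v i ^ 2 * a i := fun m => by
    rw [integral_finsetSum _ fun i _ => (hΔi i).const_mul _]
    exact Finset.sum_congr rfl fun i _ => integral_const_mul _ _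
  have hrec : ∀ m, a m ≤ R * (((m : ℝ) + 1) ^ 2 * δ ^ 2)
      + R * ∑ i ∈ Finset.range m, v i ^ 2 * a i := by
    intro m
    set σ := ∑ i ∈ Finset.range m, v i with hσ
    have hσm : (1 + σ) ^ 2 ≤ ((m : ℝ) + 1) ^ 2 := by
      have : σ ≤ m := by
        calc σ ≤ ∑ i ∈ Finset.range m, (1 : ℝ) := Finset.sum_le_sum fun i _ => hv.le_one i
          _ = m := by simp
      have := hσ0 m
      gcongr ?_ ^ 2
      linarith
    have h1 : ∀ w, Δ m w ^ 2 ≤ 2 * C' * (∑ i ∈ Finset.range m, I m i w) ^ 2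
        + 2 * C' * ∑ i ∈ Finset.range m, v i ^ 2 * Δ i w ^ 2
        + (2 * C' * (δ ^ 2 * (1 + σ) ^ 2) + 2 * (((m : ℝ) + 1) ^ 2 * δ ^ 2)) := fun w => by
      have h2 := hsq (h.cells w) (heq w) (fun k => he.self k w) hv (le_refl m)
      have h3 : Δ m w ^ 2 ≤ 2 * (Δ m w - (m + 1) * δ) ^ 2 + 2 * (((m : ℝ) + 1) ^ 2 * δ ^ 2) := by
        nlinarith [sq_nonneg (Δ m w - 2 * ((m + 1) * δ))]
      linarith
    have h4 : a m ≤ 2 * C' * ∫ w, (∑ i ∈ Finset.range m, I m i w) ^ 2 ∂μ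
        + 2 * C' * ∑ i ∈ Finset.range m, v i ^ 2 * a i
        + (2 * C' * (δ ^ 2 * (1 + σ) ^ 2) + 2 * (((m : ℝ) + 1) ^ 2 * δ ^ 2)) := by
      have i1 : Integrable (fun w => 2 * C' * (∑ i ∈ Finset.range m, I m i w) ^ 2) μ :=
        ((hIM m).integrable_sq_sum m).const_mul _
      have i2 : Integrable (fun w => 2 * C' * ∑ i ∈ Finset.range m, v i ^ 2 * Δ i w ^ 2) μ :=
        (hQi m).const_mul _
      have i12 : Integrable (fun w => 2 * C' * (∑ i ∈ Finset.range m, I m i w) ^ 2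
        + 2 * C' * ∑ i ∈ Finset.range m, v i ^ 2 * Δ i w ^ 2) μ := i1.add i2
      refine (integral_mono (hΔi m) (i12.add (integrable_const _)) h1).trans (le_of_eq ?_)
      rw [integral_add' i12 (integrable_const _), integral_add i1 i2, integral_const_mul,
        integral_const_mul, hQint, integral_const]
      simp only [probReal_univ, one_smul]
    rw [(hIM m).integral_sq_sum m] at h4
    have h5 := hMsum m m
    set T := ∑ i ∈ Finset.range m, v i ^ 2 * a i with hT
    have hT0 : 0 ≤ T := Finset.sum_nonneg fun i _ => mul_nonneg (hv0 i) (ha0 i)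
    have h6 : δ ^ 2 ≤ ((m : ℝ) + 1) ^ 2 * δ ^ 2 := by
      refine le_mul_of_one_le_left (sq_nonneg _) ?_
      have : (0 : ℝ) ≤ m := Nat.cast_nonneg m
      nlinarith
    set g := ((m : ℝ) + 1) ^ 2 * δ ^ 2 with hg
    have h7 : δ ^ 2 * (1 + σ) ^ 2 ≤ g := by
      rw [hg, mul_comm]
      gcongr
    have hg0 : 0 ≤ g := by positivity
    calc a m ≤ 2 * C' * (L * (T + S * δ ^ 2)) + 2 * C' * T + (2 * C' * (δ ^ 2 * (1 + σ) ^ 2) + 2 * g) :=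
          h4.trans (by gcongr)
      _ ≤ 2 * C' * (L * (T + S * g)) + 2 * C' * T + (2 * C' * g + 2 * g) := by gcongr
      _ = (2 + 2 * C' * (L * S + 1)) * g + 2 * C' * (L + 1) * T := by ring
      _ ≤ R * g + R * T := by
          have p1 : 0 ≤ 2 * C' * (L * S + 1) := by positivity
          have p2 : 0 ≤ 2 * C' * (L + 1) := by positivity
          gcongr
          · linarith
          · linarith
  have ha_le : ∀ m, a m ≤ A₁ * (((m : ℝ) + 1) ^ 2 * δ ^ 2) := fun m => by
    have := le_mul_exp_of_le_add_sum (a := a) (g := fun m : ℕ => R * (((m : ℝ) + 1) ^ 2 * δ ^ 2))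
      hR0 hv0 hv.sum_le (fun i => by positivity) (fun i j hij => by
        have : (i : ℝ) ≤ j := by exact_mod_cast hij
        simp only
        gcongr) hrec m
    refine this.trans (le_of_eq ?_)
    rw [hA₁]; ring
  set Q : Ω → ℝ := fun w => ∑ i ∈ Finset.range N, v i ^ 2 * Δ i w ^ 2 with hQ
  set σ := ∑ i ∈ Finset.range N, v i with hσ
  set E := ∑ i ∈ Finset.range N, v i ^ 2 * ((i : ℝ) + 1) ^ 2 with hE
  have hE0 : 0 ≤ E := Finset.sum_nonneg fun i _ => by positivity
  have hσN := hσ0 N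
  have hTE : ∑ i ∈ Finset.range N, v i ^ 2 * a i ≤ A₁ * E * δ ^ 2 := by
    rw [hE, Finset.mul_sum, Finset.sum_mul]
    refine Finset.sum_le_sum fun i _ => ?_
    calc v i ^ 2 * a i ≤ v i ^ 2 * (A₁ * (((i : ℝ) + 1) ^ 2 * δ ^ 2)) :=
          mul_le_mul_of_nonneg_left (ha_le i) (hv0 i)
      _ = _ := by ring
  have hSE : ∑ i ∈ Finset.range N, v i ^ 2 ≤ E :=
    Finset.sum_le_sum fun i _ => le_mul_of_one_le_right (hv0 i) (by
      have : (0 : ℝ) ≤ i := Nat.cast_nonneg i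
      nlinarith)
  have hME : ∑ i ∈ Finset.range N, ∫ w, I N i w ^ 2 ∂μ ≤ L * (A₁ + 1) * E * δ ^ 2 := by
    calc _ ≤ ∑ i ∈ Finset.range N, L * (v i ^ 2 * (a i + δ ^ 2)) :=
          Finset.sum_le_sum fun i _ => hIsq N i
      _ = L * (∑ i ∈ Finset.range N, v i ^ 2 * a i + (∑ i ∈ Finset.range N, v i ^ 2) * δ ^ 2) := by
          rw [← Finset.mul_sum, Finset.sum_mul, ← Finset.sum_add_distrib]
          congr 1
          exact Finset.sum_congr rfl fun i _ => by ring
      _ ≤ L * (A₁ * E * δ ^ 2 + E * δ ^ 2) := by gcongr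
      _ = _ := by ring
  -- If the squared martingale and the remaining terms are both below t, the squared deviation is
  -- below 2 C' t = ε². The two events are handled by Doob's and Markov's inequalities.
  set t := ε ^ 2 / (2 * C') with ht
  have ht0 : 0 < t := by positivity
  have hsub : {w | ∃ m ≤ N, ε ≤ |Δ m w - (m + 1) * δ|}
      ⊆ {w | ∃ m ≤ N, t ≤ (∑ i ∈ Finset.range m, I N i w) ^ 2}
        ∪ {w | t ≤ Q w + δ ^ 2 * (1 + σ) ^ 2} := by
    rintro w ⟨m, hmN, hm⟩
    have h1 := hsq (h.cells w) (heq w) (fun k => he.self k w) hv hmN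
    have h2 : ε ^ 2 ≤ (Δ m w - (m + 1) * δ) ^ 2 := by
      rw [← sq_abs (Δ m w - (m + 1) * δ)]
      gcongr
    by_contra! hcon
    simp only [mem_union, mem_ofPred_eq, not_or, not_exists, not_and, not_le] at hcon
    obtain ⟨c1, c2⟩ := hcon
    have c1 := c1 m hmN
    have h3 : ∑ i ∈ Finset.range m, v i ^ 2 * Δ i w ^ 2 ≤ Q w :=
      Finset.sum_le_sum_of_subset_of_nonneg (Finset.range_mono hmN) fun i _ _ => by positivity
    have h4 : ∑ i ∈ Finset.range m, v i ≤ σ :=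
      Finset.sum_le_sum_of_subset_of_nonneg (Finset.range_mono hmN) fun i _ _ => (hv.pos i).le
    have h5 : δ ^ 2 * (1 + ∑ i ∈ Finset.range m, v i) ^ 2 ≤ δ ^ 2 * (1 + σ) ^ 2 := by
      have := hσ0 m
      gcongr
    have h6 : ε ^ 2 < C' * (t + t) := by
      refine (h2.trans h1).trans_lt (mul_lt_mul_of_pos_left ?_ hC')
      simp only [hI] at c1
      linarith
    rw [ht] at h6
    have : C' * (ε ^ 2 / (2 * C') + ε ^ 2 / (2 * C')) = ε ^ 2 := by field_simp; ring
    rw [this] at h6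
    exact lt_irrefl _ h6
  have hP1 := (hIM N).measureReal_le N ht0
  have hP2 : μ.real {w | t ≤ Q w + δ ^ 2 * (1 + σ) ^ 2}
      ≤ (A₁ * E * δ ^ 2 + δ ^ 2 * (1 + σ) ^ 2) / t := by
    rw [le_div_iff₀ ht0, mul_comm]
    refine (mul_meas_ge_le_integral_of_nonneg (ae_of_all _ fun w => ?_)
      ((hQi N).add (integrable_const _)) t).trans ?_
    · exact add_nonneg (Finset.sum_nonneg fun i _ => by positivity) (by positivity)
    · rw [integral_add' (hQi N) (integrable_const _), integral_const, hQint]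
      simp only [probReal_univ, one_smul]
      gcongr
  calc μ.real {w | ∃ m ≤ N, ε ≤ |Δ m w - (m + 1) * δ|}
      ≤ μ.real {w | ∃ m ≤ N, t ≤ (∑ i ∈ Finset.range m, I N i w) ^ 2}
        + μ.real {w | t ≤ Q w + δ ^ 2 * (1 + σ) ^ 2} :=
        (measureReal_mono hsub).trans (measureReal_union_le _ _)
    _ ≤ (L * (A₁ + 1) * E * δ ^ 2) / t + (A₁ * E * δ ^ 2 + δ ^ 2 * (1 + σ) ^ 2) / t :=
        add_le_add (hP1.trans (by gcongr)) hP2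
    _ = 2 * C' * δ ^ 2 / ε ^ 2 * ((L * (A₁ + 1) + A₁) * E + (1 + σ) ^ 2) := by
        rw [ht]; field_simp; ring
    _ ≤ 2 * C' * δ ^ 2 / ε ^ 2 * ((L * (A₁ + 1) + A₁ + 1) * (E + (1 + σ) ^ 2)) := by
        gcongr
        have : 0 ≤ (L * (A₁ + 1) + A₁) * (1 + σ) ^ 2 := by positivity
        linarith
    _ = _ := by ring

end

end ClockStatistics

/-! ### Power couplings and the deviation bound for alloy potentials -/

namespace ClockStatistics

section

variable {α : ℝ}

lemma coupling_sq (α : ℝ) (i : ℕ) : coupling α i ^ 2 = 1 / ((i + 1 : ℕ) : ℝ) ^ (2 * α) := by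
  rw [coupling, div_pow, one_pow, ← Real.rpow_natCast, ← Real.rpow_mul (by positivity), mul_comm]
  norm_num

lemma coupling_succ_le (hα : 0 ≤ α) (i : ℕ) : coupling α (i + 1) ≤ coupling α i := by
  refine one_div_le_one_div_of_le (by positivity) (Real.rpow_le_rpow (by positivity) ?_ hα)
  exact_mod_cast Nat.le_succ _

/-- With n = i + 1, the relative decrease is at most 1 - n/(n + 1) = 1/(n + 1), and 1/(n + 1) ≤
n^{-α}. Both comparisons use α ≤ 1. -/
lemma coupling_sub_le (hα1 : α ≤ 1) (i : ℕ) :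
    coupling α i - coupling α (i + 1) ≤ coupling α i ^ 2 := by
  have hn : (0 : ℝ) < ((i + 1 : ℕ) : ℝ) := by positivity
  have hn' : (0 : ℝ) < ((i + 1 + 1 : ℕ) : ℝ) := by positivity
  set n : ℝ := ((i + 1 : ℕ) : ℝ) with hndef
  have hn1 : ((i + 1 + 1 : ℕ) : ℝ) = n + 1 := by rw [hndef]; push_cast; ring
  have h1 : n / (n + 1) ≤ (n / (n + 1)) ^ α := by
    conv_lhs => rw [← Real.rpow_one (n / (n + 1))]
    exact Real.rpow_le_rpow_of_exponent_ge (by positivity)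
      ((div_le_one (by positivity)).2 (by linarith)) hα1
  have hnα : 0 < n ^ α := Real.rpow_pos_of_pos hn _
  have h2 : coupling α (i + 1) = coupling α i * (n / (n + 1)) ^ α := by
    rw [coupling, coupling, hn1, Real.div_rpow hn.le (by positivity), ← hndef]
    field_simp
  have h3 : 1 - n / (n + 1) ≤ coupling α i := by
    rw [coupling, ← hndef]
    have : 1 - n / (n + 1) = 1 / (n + 1) := by field_simp; ring
    rw [this]
    refine one_div_le_one_div_of_le hnα ?_
    have : n ^ α ≤ n ^ (1 : ℝ) := Real.rpow_le_rpow_of_exponent_le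
      (by rw [hndef]; norm_cast; omega) hα1
    rw [Real.rpow_one] at this
    linarith
  have h4 := (coupling_pos α i).le
  rw [h2, sq]
  calc _ = coupling α i * (1 - (n / (n + 1)) ^ α) := by ring
    _ ≤ coupling α i * coupling α i := mul_le_mul_of_nonneg_left (by linarith) h4

lemma exists_isCoupling_coupling (hα : 1 / 2 < α) (hα1 : α ≤ 1) :
    ∃ S, 0 ≤ S ∧ IsCoupling (coupling α) S := by
  have hs : Summable fun i : ℕ => coupling α i ^ 2 := by
    simp only [coupling_sq]
    exact (summable_nat_add_iff 1).2 (Real.summable_one_div_nat_rpow.2 (by linarith))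
  exact ⟨∑' i, coupling α i ^ 2, tsum_nonneg fun i => sq_nonneg _, coupling_pos α,
    coupling_le_one (by linarith), coupling_succ_le (by linarith), coupling_sub_le hα1,
    fun n => hs.sum_le_tsum _ fun i _ => sq_nonneg _⟩

lemma tendsto_coupling (hα : 0 < α) : Tendsto (coupling α) atTop (𝓝 0) := by
  have h : Tendsto (fun i : ℕ => ((i + 1 : ℕ) : ℝ) ^ α) atTop atTop :=
    (tendsto_rpow_atTop hα).comp (tendsto_natCast_atTop_atTop.comp (tendsto_add_atTop_nat 1))
  refine (tendsto_inv_atTop_zero.comp h).congr fun i => ?_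
  rw [coupling, one_div, Function.comp_apply]

/-- Since α ≤ 1, each of the N terms (i + 1)^{2-2α} is at most N^{2-2α}. Cauchy–Schwarz bounds the
squared sum of couplings by N S, and N ≤ N^{3-2α}. -/
lemma sum_coupling_le (hα1 : α ≤ 1) {S : ℝ} (hS : IsCoupling (coupling α) S)
    {N : ℕ} (hN : 1 ≤ N) :
    ∑ i ∈ Finset.range N, coupling α i ^ 2 * ((i : ℝ) + 1) ^ 2
      + (1 + ∑ i ∈ Finset.range N, coupling α i) ^ 2 ≤ (3 + 2 * S) * (N : ℝ) ^ (3 - 2 * α) := by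
  have hN0 : (0 : ℝ) < N := by exact_mod_cast hN
  have hN1 : (1 : ℝ) ≤ N := by exact_mod_cast hN
  have hpow : (N : ℝ) * (N : ℝ) ^ (2 - 2 * α) = (N : ℝ) ^ (3 - 2 * α) := by
    rw [← Real.rpow_one_add' hN0.le (by linarith)]
    congr 1; ring
  have h1 : ∑ i ∈ Finset.range N, coupling α i ^ 2 * ((i : ℝ) + 1) ^ 2
      ≤ (N : ℝ) ^ (3 - 2 * α) := by
    calc _ ≤ ∑ i ∈ Finset.range N, (N : ℝ) ^ (2 - 2 * α) := by
          refine Finset.sum_le_sum fun i hi => ?_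
          have hp : (0 : ℝ) < ((i + 1 : ℕ) : ℝ) := by positivity
          have : coupling α i ^ 2 * ((i : ℝ) + 1) ^ 2 = ((i + 1 : ℕ) : ℝ) ^ (2 - 2 * α) := by
            rw [coupling_sq, Real.rpow_sub hp, Real.rpow_two]
            push_cast
            ring
          rw [this]
          exact Real.rpow_le_rpow hp.le (by exact_mod_cast Finset.mem_range.1 hi) (by linarith)
      _ = (N : ℝ) ^ (3 - 2 * α) := by rw [Finset.sum_const, Finset.card_range, nsmul_eq_mul, hpow]
  have h2 : (∑ i ∈ Finset.range N, coupling α i) ^ 2 ≤ N * S := by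
    have := sq_sum_le_card_mul_sum_sq (s := Finset.range N) (f := coupling α)
    rw [Finset.card_range] at this
    exact this.trans (mul_le_mul_of_nonneg_left (hS.sum_le N) hN0.le)
  have h3 : (N : ℝ) ≤ (N : ℝ) ^ (3 - 2 * α) := by
    conv_lhs => rw [← Real.rpow_one (N : ℝ)]
    exact Real.rpow_le_rpow_of_exponent_le hN1 (by linarith)
  have hS0 : 0 ≤ S := by simpa using hS.sum_le 0
  nlinarith [sq_nonneg (1 - ∑ i ∈ Finset.range N, coupling α i), mul_le_mul_of_nonneg_right h3 hS0]

end

section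

variable {Ω : Type*} {mΩ : MeasurableSpace Ω} {μ : Measure Ω}

lemma IsPrediction.exists_isGeometricPrediction {G : Filtration ℕ mΩ} {q : ℝ} {ξ : ℕ → Ω → ℝ}
    {e : ℕ → ℕ → Ω → ℝ} (he : IsPrediction μ G q ξ e) (hq0 : 0 ≤ q) (hq1 : q < 1) :
    ∃ K, 0 ≤ K ∧ ∀ w, IsGeometricPrediction q K fun j k => e j k w := by
  have h0 : Summable fun m : ℕ => q ^ m := summable_geometric_of_lt_one hq0 hq1
  have h1 : Summable fun m : ℕ => (m : ℝ) * q ^ m := by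
    have := summable_pow_mul_geometric_of_norm_lt_one 1 (r := q)
      (by rwa [Real.norm_eq_abs, abs_of_nonneg hq0])
    simpa only [pow_one] using this
  have hn0 : 0 ≤ ∑' m : ℕ, q ^ m := tsum_nonneg fun m => pow_nonneg hq0 m
  have hn1 : 0 ≤ ∑' m : ℕ, (m : ℝ) * q ^ m := tsum_nonneg fun m => by positivity
  refine ⟨∑' m : ℕ, q ^ m + ∑' m : ℕ, (m : ℝ) * q ^ m, by positivity, fun w =>
    ⟨hq0, hq1.le, fun n => ?_, fun n => ?_, fun k m => he.bound k m w⟩⟩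
  · linarith [h0.sum_le_tsum (Finset.range n) fun m _ => pow_nonneg hq0 m]
  · linarith [h1.sum_le_tsum (Finset.range n) fun m _ => (by positivity : 0 ≤ (m : ℝ) * q ^ m)]

variable [IsProbabilityMeasure μ]

/-- The maximal deviation of the relative phase of an alloy potential up to time `N`. -/
lemma exists_measureReal_relative_deviation_le {f : ℝ → ℝ} {B α κ₀ ρ : ℝ} {G : Filtration ℕ mΩ}
    {ω : ℕ → Ω → ℝ} (hfm : Measurable f) (hf : ∀ t, |f t| ≤ B)
    (hs : ∀ t, t ∉ Ico (0 : ℝ) 1 → f t = 0) (hα : 1 / 2 < α) (hα1 : α ≤ 1) (hκ₀ : 0 < κ₀)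
    (hρ : 0 < ρ) (hm : ∀ j, Measurable[G j] (ω (j + 1))) (hb : ∀ j w, 1 ≤ j → |ω j w| ≤ 1)
    (hd : ∀ k j, k < j →
      ∀ᵐ w ∂μ, |(μ[ω (j + 1) | G k]) w| ≤ Real.exp (-ρ * ((j : ℝ) - k))) :
    ∃ A, 0 < A ∧ ∀ (δ : ℝ) (N : ℕ) (ε : ℝ), κ₀ / 2 ≤ κ₀ + δ → 1 ≤ N → 0 < ε →
      μ.real {w | ∃ m ≤ N, ε ≤
        |pruferPhase (alloyPotential f α fun j => ω j w) (κ₀ + δ) ((m + 1 : ℕ) : ℝ)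
          - pruferPhase (alloyPotential f α fun j => ω j w) κ₀ ((m + 1 : ℕ) : ℝ) - (m + 1) * δ|}
      ≤ A * δ ^ 2 / ε ^ 2 * (N : ℝ) ^ (3 - 2 * α) := by
  have hB : 0 ≤ B := (abs_nonneg _).trans (hf 0)
  have hα0 : 0 ≤ α := by linarith
  obtain ⟨e, he⟩ := exists_isPrediction (ξ := fun j => ω (j + 1)) hm
    (fun j w => hb (j + 1) w (by omega)) hd
  obtain ⟨K, hK, hgeo⟩ := he.exists_isGeometricPrediction (Real.exp_pos _).le
    (by rw [← Real.exp_zero]; exact Real.exp_lt_exp.2 (by linarith))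
  obtain ⟨S, hS, hcoup⟩ := exists_isCoupling_coupling hα hα1
  obtain ⟨C, hC, hcells⟩ := exists_coupledCells B hB hκ₀
  obtain ⟨A, hA, hdev⟩ := exists_measureReal_deviation_le hC.le hK hS he hgeo hcoup
  refine ⟨A * (3 + 2 * S), by positivity, fun δ N ε hδ hN hε => ?_⟩
  have hθ : ∀ κ, 0 < κ → ∀ i, Measurable[G i] fun w =>
      pruferPhase (alloyPotential f α fun j => ω j w) κ ((i + 1 : ℕ) : ℝ) := fun κ hκ i =>
    measurable_pruferPhase (m := G i) hfm hf hs hα0 hκ i hb fun j hj hji => by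
      obtain ⟨j, rfl⟩ := Nat.exists_eq_add_of_le' hj
      exact (hm j).mono (G.mono (by omega)) le_rfl
  have hz : ∀ κ, 0 < κ → ∀ i, Measurable[G i] fun w =>
      resonance f κ (pruferPhase (alloyPotential f α fun j => ω j w) κ ((i + 1 : ℕ) : ℝ)) :=
    fun κ hκ i => (continuous_circleExp.measurable.comp (hθ κ hκ i)).const_mul _
  have hproc : IsCoupledProcess G (coupling α) C δ (circleExp (κ₀ + δ)) (circleExp κ₀)
      (fun j => ω (j + 1))
      (fun i w => pruferPhase (alloyPotential f α fun j => ω j w) (κ₀ + δ) ((i + 1 : ℕ) : ℝ)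
        - pruferPhase (alloyPotential f α fun j => ω j w) κ₀ ((i + 1 : ℕ) : ℝ))
      (fun i w => resonance f (κ₀ + δ)
        (pruferPhase (alloyPotential f α fun j => ω j w) (κ₀ + δ) ((i + 1 : ℕ) : ℝ)))
      (fun i w => resonance f κ₀
        (pruferPhase (alloyPotential f α fun j => ω j w) κ₀ ((i + 1 : ℕ) : ℝ))) :=
    ⟨fun w => by
      have := (hcells f α hfm hf hs hα0 (fun j => ω j w) (fun j hj => hb j w hj) (κ₀ + δ) hδ).1
      rwa [add_sub_cancel_left] at this,
     fun i => (hθ _ (by linarith) i).sub (hθ _ hκ₀ i), hz _ (by linarith), hz _ hκ₀⟩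
  refine (hdev hproc N ε hε).trans ?_
  have h := mul_le_mul_of_nonneg_left (sum_coupling_le hα1 hcoup hN)
    (by positivity : 0 ≤ A * δ ^ 2 / ε ^ 2)
  refine h.trans_eq ?_
  ring

end

end ClockStatistics

/-! ### From polynomial scales and rational parameters to all times -/

namespace ClockStatistics

section

/-- Scales k^b, unlike geometric ones, have consecutive ratios tending to 1, so nothing is lost by
replacing t with the scale below it. -/
lemma tendsto_floor_rpow_pow {b : ℕ} (hb : 1 ≤ b) :
    Tendsto (fun t : ℝ => ⌊t ^ (1 / (b : ℝ))⌋₊) atTop atTop ∧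
      Tendsto (fun t : ℝ => t / (⌊t ^ (1 / (b : ℝ))⌋₊ : ℝ) ^ b) atTop (𝓝 1) := by
  have hb0 : (0 : ℝ) < b := by exact_mod_cast hb
  have h1 : Tendsto (fun t : ℝ => t ^ (1 / (b : ℝ))) atTop atTop :=
    tendsto_rpow_atTop (by positivity)
  refine ⟨tendsto_nat_floor_atTop.comp h1, ?_⟩
  have h2 := (((tendsto_nat_floor_div_atTop (R := ℝ)).comp h1).inv₀ one_ne_zero).pow b
  rw [inv_one, one_pow] at h2
  refine h2.congr' ?_
  filter_upwards [eventually_ge_atTop 0] with t ht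
  rw [Function.comp_apply, inv_div, div_pow, ← Real.rpow_natCast (t ^ _), ← Real.rpow_mul ht,
    one_div_mul_cancel hb0.ne', Real.rpow_one]

/-- A deterministic passage from a maximal bound along a sequence of scales to convergence. -/
lemma tendsto_of_forall_rat_scale {D : ℝ → ℝ → ℝ} {E : ℝ → ℝ} {r : ℕ → ℝ} {a : ℝ} {b : ℕ}
    (ha : 0 < a) (hb : 1 ≤ b) (hr : Tendsto r atTop (𝓝 0)) (hE : Tendsto E (𝓝 0) (𝓝 0))
    (hcell : ∀ δ, -a ≤ δ → ∀ (i : ℕ) (s : ℝ), s ∈ Icc (0 : ℝ) 1 →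
      |D δ ((i + 1 : ℕ) + s) - D δ ((i + 1 : ℕ) : ℝ) - δ * s| ≤ r i)
    (hmono : ∀ δ₁ δ₂ t, -a ≤ δ₁ → δ₁ ≤ δ₂ → 0 ≤ t → D δ₁ t ≤ D δ₂ t + (E δ₁ + E δ₂))
    (hmax : ∀ (c : ℚ) (ε : ℝ), 0 < ε → ∀ᶠ k : ℕ in atTop, ∀ m ≤ (k + 1) ^ b,
      |D (c / (k : ℝ) ^ b) ((m + 1 : ℕ) : ℝ) - (m + 1) * (c / (k : ℝ) ^ b)| < ε) (c : ℝ) :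
    Tendsto (fun t => D (c / t) t) atTop (𝓝 c) := by
  have hb0 : (0 : ℝ) < b := by exact_mod_cast hb
  obtain ⟨hk, hratio⟩ := tendsto_floor_rpow_pow hb
  set k : ℝ → ℕ := fun t => ⌊t ^ (1 / (b : ℝ))⌋₊ with hkdef
  have hs : Tendsto (fun t => (k t : ℝ) ^ b) atTop atTop :=
    (tendsto_pow_atTop (by omega)).comp (tendsto_natCast_atTop_atTop.comp hk)
  have hsmall : ∀ x : ℝ, Tendsto (fun t => x / (k t : ℝ) ^ b) atTop (𝓝 0) := fun x =>
    tendsto_const_nhds.div_atTop hs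
  have hsmall' : ∀ x : ℝ, Tendsto (fun t : ℝ => x / t) atTop (𝓝 0) := fun x =>
    tendsto_const_nhds.div_atTop tendsto_id
  have hfl : Tendsto (fun t : ℝ => ⌊t⌋₊ - 1) atTop atTop :=
    (tendsto_sub_atTop_nat 1).comp tendsto_nat_floor_atTop
  -- Since t < (k t + 1)^b, the maximal bound reaches the last integer before t; the remaining
  -- fraction of a cell is controlled by `hcell`.
  have hdev : ∀ x : ℚ, Tendsto (fun t => D (x / (k t : ℝ) ^ b) t - t * (x / (k t : ℝ) ^ b))
      atTop (𝓝 0) := by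
    intro x
    rw [Metric.tendsto_nhds]
    intro ε hε
    filter_upwards [hk.eventually (hmax x (ε / 2) (half_pos hε)),
      (hr.comp hfl).eventually (Metric.ball_mem_nhds 0 (half_pos hε)),
      (hsmall x).eventually (Ici_mem_nhds (neg_lt_zero.2 ha)), eventually_ge_atTop 1]
      with t h1 h2 h3 h4
    obtain ⟨i, hi⟩ : ∃ i, ⌊t⌋₊ = i + 1 := Nat.exists_eq_add_of_le' (Nat.one_le_floor_iff _ |>.2 h4)
    have ht0 : 0 ≤ t := zero_le_one.trans h4
    have h5 : ((i + 1 : ℕ) : ℝ) ≤ t := hi ▸ Nat.floor_le ht0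
    have h6 : t < ((i + 1 : ℕ) : ℝ) + 1 := hi ▸ Nat.lt_floor_add_one t
    have h7 : t < ((k t : ℝ) + 1) ^ b := by
      have := Nat.lt_floor_add_one (t ^ (1 / (b : ℝ)))
      have := pow_lt_pow_left₀ this (by positivity) (n := b) (by omega)
      rwa [← Real.rpow_natCast (t ^ _), ← Real.rpow_mul ht0, one_div_mul_cancel hb0.ne',
        Real.rpow_one] at this
    have h8 : i ≤ (k t + 1) ^ b := by
      have : ((i + 1 : ℕ) : ℝ) < (((k t + 1) ^ b : ℕ) : ℝ) := by
        push_cast at h5 ⊢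
        linarith
      have := Nat.cast_lt.1 this
      omega
    have h9 := h1 i h8
    have h10 := hcell _ h3 i (t - (i + 1 : ℕ)) ⟨by linarith, by linarith⟩
    rw [add_sub_cancel] at h10
    have h11 : |r i| < ε / 2 := by simpa [hi] using h2
    rw [Real.dist_eq, sub_zero]
    rw [abs_lt] at *
    rw [abs_le] at h10
    push_cast at *
    constructor <;> nlinarith
  have hlim : ∀ x : ℚ, Tendsto (fun t => D (x / (k t : ℝ) ^ b) t) atTop (𝓝 x) := by
    intro x
    have h1 : Tendsto (fun t => t * (x / (k t : ℝ) ^ b)) atTop (𝓝 x) := by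
      have := hratio.const_mul (x : ℝ)
      rw [mul_one] at this
      exact this.congr fun t => by ring
    simpa using (hdev x).add h1
  have herr : ∀ x : ℚ, Tendsto (fun t => E (x / (k t : ℝ) ^ b) + E (c / t)) atTop (𝓝 0) :=
    fun x => by simpa using (hE.comp (hsmall x)).add (hE.comp (hsmall' c))
  have hprod : ∀ x : ℚ, Tendsto (fun t => x * (t / (k t : ℝ) ^ b)) atTop (𝓝 x) := fun x => by
    have := hratio.const_mul (x : ℝ)
    rwa [mul_one] at this
  refine tendsto_order.2 ⟨fun l hl => ?_, fun u hu => ?_⟩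
  -- As x · t/(k t)^b → x < c, eventually x/(k t)^b ≤ c/t, and near monotonicity bounds D at c/t
  -- from below. The upper bound is symmetric.
  · obtain ⟨x, hx1, hx2⟩ := exists_rat_btwn hl
    have h1 : Tendsto (fun t => D (x / (k t : ℝ) ^ b) t - (E (x / (k t : ℝ) ^ b) + E (c / t)))
        atTop (𝓝 x) := by simpa using (hlim x).sub (herr x)
    filter_upwards [(tendsto_order.1 h1).1 l hx1, (tendsto_order.1 (hprod x)).2 c hx2,
      (hsmall x).eventually (Ici_mem_nhds (neg_lt_zero.2 ha)), eventually_gt_atTop 0]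
      with t h2 h3 h4 h5
    have h6 : (x : ℝ) / (k t : ℝ) ^ b ≤ c / t := by
      rw [le_div_iff₀ h5]
      calc _ = x * (t / (k t : ℝ) ^ b) := by ring
        _ ≤ c := h3.le
    linarith [hmono _ _ t h4 h6 h5.le]
  · obtain ⟨x, hx1, hx2⟩ := exists_rat_btwn hu
    have h1 : Tendsto (fun t => D (x / (k t : ℝ) ^ b) t + (E (x / (k t : ℝ) ^ b) + E (c / t)))
        atTop (𝓝 x) := by simpa using (hlim x).add (herr x)
    filter_upwards [(tendsto_order.1 h1).2 u hx2, (tendsto_order.1 (hprod x)).1 c hx1,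
      (hsmall' c).eventually (Ici_mem_nhds (neg_lt_zero.2 ha)), eventually_gt_atTop 0]
      with t h2 h3 h4 h5
    have h6 : c / t ≤ (x : ℝ) / (k t : ℝ) ^ b := by
      rw [div_le_iff₀ h5]
      calc c ≤ x * (t / (k t : ℝ) ^ b) := h3.le
        _ = _ := by ring
    linarith [hmono _ _ t h4 h6 h5.le]

end

section

variable {Ω : Type*} {mΩ : MeasurableSpace Ω} {μ : Measure Ω} [IsProbabilityMeasure μ]

/-- Borel–Cantelli with δ = c/k^b and N = (k + 1)^b: the deviation probability is of order
k^{b(3-2α) - 2b} = k^{-b(2α-1)}, so b ≥ 2/(2α - 1) makes it O(k⁻²). -/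
lemma ae_tendsto_relativePhase {f : ℝ → ℝ} {B α κ₀ ρ : ℝ} {G : Filtration ℕ mΩ}
    {ω : ℕ → Ω → ℝ} (hfm : Measurable f) (hf : ∀ t, |f t| ≤ B)
    (hs : ∀ t, t ∉ Ico (0 : ℝ) 1 → f t = 0) (hα : 1 / 2 < α) (hα1 : α ≤ 1) (hκ₀ : 0 < κ₀)
    (hρ : 0 < ρ) (hm : ∀ j, Measurable[G j] (ω (j + 1))) (hb : ∀ j w, 1 ≤ j → |ω j w| ≤ 1)
    (hd : ∀ k j, k < j →
      ∀ᵐ w ∂μ, |(μ[ω (j + 1) | G k]) w| ≤ Real.exp (-ρ * ((j : ℝ) - k))) :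
    ∀ᵐ w ∂μ, ∀ c : ℝ, Tendsto
      (fun t : ℝ => relativePhase (alloyPotential f α fun j => ω j w) κ₀ t c) atTop (𝓝 c) := by
  have hB : 0 ≤ B := (abs_nonneg _).trans (hf 0)
  have hα0 : 0 ≤ α := by linarith
  obtain ⟨A, hA, hdev⟩ :=
    exists_measureReal_relative_deviation_le hfm hf hs hα hα1 hκ₀ hρ hm hb hd
  obtain ⟨b, hbα⟩ := exists_nat_ge (2 / (2 * α - 1))
  have hbα' : 2 ≤ b * (2 * α - 1) := (div_le_iff₀ (by linarith)).1 hbα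
  have hb1 : 1 ≤ b := by
    rcases Nat.eq_zero_or_pos b with rfl | h
    · norm_num at hbα'
    · exact h
  obtain ⟨C, hC, hcells⟩ := exists_coupledCells B hB hκ₀
  -- Rational c and accuracies 1/(n + 1) keep the exceptional sets countable in number.
  have hmax : ∀ᵐ w ∂μ, ∀ (c : ℚ) (n : ℕ), ∀ᶠ k : ℕ in atTop, ∀ m ≤ (k + 1) ^ b,
      |pruferPhase (alloyPotential f α fun j => ω j w) (κ₀ + c / (k : ℝ) ^ b) ((m + 1 : ℕ) : ℝ)
          - pruferPhase (alloyPotential f α fun j => ω j w) κ₀ ((m + 1 : ℕ) : ℝ)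
          - (m + 1) * (c / (k : ℝ) ^ b)| < 1 / ((n : ℝ) + 1) := by
    rw [ae_all_iff]; intro c
    rw [ae_all_iff]; intro n
    set s : ℕ → Set Ω := fun k => {w | ∃ m ≤ (k + 1) ^ b, 1 / ((n : ℝ) + 1) ≤
      |pruferPhase (alloyPotential f α fun j => ω j w) (κ₀ + c / (k : ℝ) ^ b) ((m + 1 : ℕ) : ℝ)
          - pruferPhase (alloyPotential f α fun j => ω j w) κ₀ ((m + 1 : ℕ) : ℝ)
          - (m + 1) * (c / (k : ℝ) ^ b)|} with hsdef
    have hsmall : Tendsto (fun k : ℕ => (c : ℝ) / (k : ℝ) ^ b) atTop (𝓝 0) :=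
      tendsto_const_nhds.div_atTop
        ((tendsto_pow_atTop (by omega)).comp tendsto_natCast_atTop_atTop)
    -- From k₀ on, the shifted momentum is at least κ₀/2, where the uniform estimates apply, and k ≥
    -- 1.
    obtain ⟨k₀, hk₀⟩ := eventually_atTop.1
      ((hsmall.eventually (Ici_mem_nhds (neg_lt_zero.2 (half_pos hκ₀)))).and
        (eventually_ge_atTop 1))
    have hle : ∀ k, μ.real (s (k + k₀)) ≤ A * (c : ℝ) ^ 2 / (1 / ((n : ℝ) + 1)) ^ 2
        * ((2 : ℝ) ^ b) ^ (3 - 2 * α) * (1 / ((k + k₀ : ℕ) : ℝ) ^ 2) := by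
      intro k
      obtain ⟨h1, h2⟩ := hk₀ (k + k₀) (by omega)
      set l := k + k₀ with hl
      have hl1 : (1 : ℝ) ≤ l := by exact_mod_cast h2
      have hl0 : (0 : ℝ) < l := by linarith
      have h1' : -(κ₀ / 2) ≤ (c : ℝ) / (l : ℝ) ^ b := h1
      refine (hdev (c / (l : ℝ) ^ b) ((l + 1) ^ b) (1 / ((n : ℝ) + 1)) (by linarith)
        (Nat.one_le_pow _ _ (by omega)) (by positivity)).trans ?_
      have h3 : (((l + 1) ^ b : ℕ) : ℝ) ^ (3 - 2 * α)
          ≤ ((2 : ℝ) ^ b) ^ (3 - 2 * α) * ((l : ℝ) ^ b) ^ (3 - 2 * α) := by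
        rw [← Real.mul_rpow (by positivity) (by positivity), ← mul_pow]
        refine Real.rpow_le_rpow (by positivity) ?_ (by linarith)
        push_cast
        exact pow_le_pow_left₀ (by positivity) (by linarith) b
      have h4 : ((l : ℝ) ^ b) ^ (3 - 2 * α) / ((l : ℝ) ^ b) ^ 2 ≤ 1 / (l : ℝ) ^ 2 := by
        rw [← Real.rpow_natCast, ← Real.rpow_natCast, ← Real.rpow_natCast, ← Real.rpow_mul hl0.le,
          ← Real.rpow_mul hl0.le, ← Real.rpow_sub hl0, one_div, ← Real.rpow_neg hl0.le]
        refine Real.rpow_le_rpow_of_exponent_le hl1 ?_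
        push_cast
        linarith
      calc A * (c / (l : ℝ) ^ b) ^ 2 / (1 / ((n : ℝ) + 1)) ^ 2
            * (((l + 1) ^ b : ℕ) : ℝ) ^ (3 - 2 * α)
          ≤ A * (c / (l : ℝ) ^ b) ^ 2 / (1 / ((n : ℝ) + 1)) ^ 2
            * (((2 : ℝ) ^ b) ^ (3 - 2 * α) * ((l : ℝ) ^ b) ^ (3 - 2 * α)) := by gcongr
        _ = A * (c : ℝ) ^ 2 / (1 / ((n : ℝ) + 1)) ^ 2 * ((2 : ℝ) ^ b) ^ (3 - 2 * α)
            * (((l : ℝ) ^ b) ^ (3 - 2 * α) / ((l : ℝ) ^ b) ^ 2) := by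
            rw [div_pow]; ring
        _ ≤ _ := by gcongr
    have hsum : Summable fun k => μ.real (s (k + k₀)) :=
      Summable.of_nonneg_of_le (fun _ => measureReal_nonneg) hle
        (((summable_nat_add_iff k₀).2 (Real.summable_one_div_nat_pow.2 one_lt_two)).mul_left _)
    have hfin : ∑' k, μ (s (k + k₀)) ≠ ⊤ := by
      have : ∀ k, μ (s (k + k₀)) = ENNReal.ofReal (μ.real (s (k + k₀))) := fun k =>
        (ofReal_measureReal (measure_ne_top _ _)).symm
      simp only [this]
      exact hsum.tsum_ofReal_ne_top
    filter_upwards [ae_eventually_notMem hfin] with w hw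
    obtain ⟨k₁, hk₁⟩ := eventually_atTop.1 hw
    filter_upwards [eventually_ge_atTop (k₁ + k₀)] with k hk m hmk
    have := hk₁ (k - k₀) (by omega)
    rw [Nat.sub_add_cancel (by omega)] at this
    by_contra hcon
    exact this ⟨m, hmk, not_lt.1 hcon⟩
  filter_upwards [hmax] with w hw c
  have hV := measurable_alloyPotential hfm hs α fun j => ω j w
  have hVB := abs_alloyPotential_le hf hs hα0 (X := 1) (x := fun j => ω j w) fun j hj => hb j w hj
  have hcell := hcells f α hfm hf hs hα0 (fun j => ω j w) fun j hj => hb j w hj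
  have hr : Tendsto (fun i => C * coupling α i) atTop (𝓝 0) := by
    simpa using (tendsto_coupling (α := α) (by linarith)).const_mul C
  have hE : Tendsto (fun δ => Real.pi / 2 * |1 - κ₀ / (κ₀ + δ)|) (𝓝 0) (𝓝 0) := by
    have : ContinuousAt (fun δ => Real.pi / 2 * |1 - κ₀ / (κ₀ + δ)|) 0 := by
      have : κ₀ + 0 ≠ 0 := by rw [add_zero]; exact hκ₀.ne'
      fun_prop (disch := assumption)
    have h := this.tendsto
    rwa [add_zero, div_self hκ₀.ne', sub_self, abs_zero, mul_zero] at h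
  refine tendsto_of_forall_rat_scale
    (D := fun δ t => pruferPhase (alloyPotential f α fun j => ω j w) (κ₀ + δ) t
      - pruferPhase (alloyPotential f α fun j => ω j w) κ₀ t)
    (half_pos hκ₀) hb1 hr hE (fun δ hδ i s hs => ?_) (fun δ₁ δ₂ t h1 h2 ht => ?_)
    (fun c ε hε => ?_) c
  · have := (hcell (κ₀ + δ) (by linarith)).2 i s hs
    rwa [add_sub_cancel_left] at this
  · have := pruferPhase_le_add hV hVB hκ₀ (by linarith : 0 < κ₀ + δ₁)
      (by linarith : κ₀ + δ₁ ≤ κ₀ + δ₂) ht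
    linarith
  · obtain ⟨n, hn⟩ := exists_nat_one_div_lt hε
    exact (hw c n).mono fun k hk m hmk => (hk m hmk).trans hn

end

end ClockStatistics

/-! ### Reduction of general profiles and exponents -/

namespace ClockStatistics

section

/-- The cell estimates want bounds and half-open support everywhere. Cutting a measurable
representative down to these alters f on a null set, which the Prüfer phase does not see
(`pruferPhase_congr_ae`). -/
lemma exists_measurable_bounded_ae_eq {f : ℝ → ℝ} (hf : MemLp f ⊤ volume)
    (hsupp : Function.support f ⊆ Icc 0 1) :
    ∃ (g : ℝ → ℝ) (B : ℝ), Measurable g ∧ (∀ t, |g t| ≤ B) ∧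
      (∀ t, t ∉ Ico (0 : ℝ) 1 → g t = 0) ∧ f =ᵐ[volume] g := by
  set f₁ := hf.1.mk f with hf₁
  have hm : Measurable f₁ := hf.1.stronglyMeasurable_mk.measurable
  set B := (eLpNorm f ⊤ volume).toReal with hB
  have hB0 : 0 ≤ B := ENNReal.toReal_nonneg
  set s := Ico (0 : ℝ) 1 ∩ {t | |f₁ t| ≤ B} with hsdef
  have hsm : MeasurableSet s :=
    measurableSet_Ico.inter (measurableSet_le hm.abs measurable_const)
  refine ⟨s.indicator f₁, B, hm.indicator hsm, fun t => ?_, fun t ht => ?_, ?_⟩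
  · by_cases ht : t ∈ s
    · rw [indicator_of_mem ht]; exact ht.2
    · rw [indicator_of_notMem ht, abs_zero]; exact hB0
  · exact indicator_of_notMem (fun h => ht h.1) _
  · have h1 : ∀ᵐ t, |f t| ≤ B := by
      have hfin : eLpNormEssSup f volume ≠ ⊤ := by
        rw [← eLpNorm_exponent_top]; exact hf.2.ne
      filter_upwards [enorm_ae_le_eLpNormEssSup f volume] with t ht
      have := ENNReal.toReal_mono hfin ht
      rwa [toReal_enorm, Real.norm_eq_abs, ← eLpNorm_exponent_top] at this
    have h2 : ∀ᵐ t : ℝ, t ≠ 1 := by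
      rw [ae_iff]; simp
    filter_upwards [h1, h2, hf.1.ae_eq_mk] with t h1 h2 h3
    by_cases ht : t ∈ Ico (0 : ℝ) 1
    · rw [indicator_of_mem, h3]
      refine ⟨ht, ?_⟩
      change |f₁ t| ≤ B
      rw [hf₁, ← h3]
      exact h1
    · rw [indicator_of_notMem fun h => ht h.1]
      by_contra h
      have := hsupp (Function.mem_support.2 h)
      exact ht ⟨this.1, this.2.lt_of_ne h2⟩

lemma alloyPotential_congr_ae {f g : ℝ → ℝ} (h : f =ᵐ[volume] g) (α : ℝ) (x : ℕ → ℝ) :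
    alloyPotential f α x =ᵐ[volume] alloyPotential g α x := by
  have h1 : ∀ᵐ t, ∀ j : ℕ, f (t - ((j + 1 : ℕ) : ℝ)) = g (t - ((j + 1 : ℕ) : ℝ)) :=
    ae_all_iff.2 fun j =>
      (measurePreserving_sub_right volume ((j + 1 : ℕ) : ℝ)).quasiMeasurePreserving.ae h
  filter_upwards [h1] with t ht
  exact tsum_congr fun j => by rw [ht j]

/-- Excess decay can be moved from the coupling into the amplitudes, which reduces everything to
exponents at most 1. -/
lemma alloyPotential_rpow_sub (f : ℝ → ℝ) (α α' : ℝ) {x y : ℕ → ℝ}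
    (h : ∀ j, y (j + 1) = (((j + 1 : ℕ) : ℝ) ^ (α - α'))⁻¹ * x (j + 1)) :
    alloyPotential f α' y = alloyPotential f α x := by
  funext t
  refine tsum_congr fun j => ?_
  have hj : (0 : ℝ) < ((j + 1 : ℕ) : ℝ) := by positivity
  rw [h, Real.rpow_sub hj]
  have := (Real.rpow_pos_of_pos hj α).ne'
  have := (Real.rpow_pos_of_pos hj α').ne'
  field_simp

variable {Ω : Type*} {mΩ : MeasurableSpace Ω} {μ : Measure Ω} [IsProbabilityMeasure μ]

/-- For a decaying potential driven by an adapted bounded process with exponentially decaying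
predictions, the relative Prüfer phase converges along all real times. -/
theorem ae_tendsto_relativePhase_of_memLp {f : ℝ → ℝ} {α κ₀ ρ : ℝ} {G : Filtration ℕ mΩ}
    {ω : ℕ → Ω → ℝ} (hf : MemLp f ⊤ volume) (hsupp : Function.support f ⊆ Icc 0 1)
    (hα : 1 / 2 < α) (hκ₀ : 0 < κ₀) (hρ : 0 < ρ) (hm : ∀ j, Measurable[G j] (ω (j + 1)))
    (hb : ∀ j, ∀ᵐ w ∂μ, |ω (j + 1) w| ≤ 1)
    (hd : ∀ k j, k < j →
      ∀ᵐ w ∂μ, |(μ[ω (j + 1) | G k]) w| ≤ Real.exp (-ρ * ((j : ℝ) - k))) :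
    ∀ᵐ w ∂μ, ∀ c : ℝ, Tendsto
      (fun t : ℝ => relativePhase (alloyPotential f α fun j => ω j w) κ₀ t c) atTop (𝓝 c) := by
  obtain ⟨g, B, hgm, hgB, hgs, hfg⟩ := exists_measurable_bounded_ae_eq hf hsupp
  set α' := min α 1 with hα'
  set a : ℕ → ℝ := fun j => ((j : ℝ) ^ (α - α'))⁻¹ with hadef
  have ha0 : ∀ j, 1 ≤ j → 0 ≤ a j := fun j _ => by positivity
  have ha1 : ∀ j, 1 ≤ j → a j ≤ 1 := fun j hj =>
    inv_le_one_of_one_le₀ (Real.one_le_rpow (by exact_mod_cast hj)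
      (sub_nonneg.2 (min_le_left _ _)))
  -- The factor a j is deterministic and in [0, 1], so the bounds on amplitudes and predictions
  -- persist. The clamp turns |ω j| ≤ 1 from almost sure into pointwise.
  set ω' : ℕ → Ω → ℝ := fun j w => a j * max (-1) (min 1 (ω j w)) with hω'
  have hclamp : ∀ x : ℝ, |max (-1) (min 1 x)| ≤ 1 := fun x =>
    abs_le.2 ⟨le_max_left _ _, max_le (by norm_num) (min_le_left _ _)⟩
  have heq : ∀ j, ∀ᵐ w ∂μ, ω' (j + 1) w = a (j + 1) * ω (j + 1) w := fun j => by
    filter_upwards [hb j] with w hw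
    obtain ⟨h1, h2⟩ := abs_le.1 hw
    simp only [hω', min_eq_right h2, max_eq_right h1]
  have key := ae_tendsto_relativePhase (μ := μ) (ω := ω') (G := G) (ρ := ρ) (κ₀ := κ₀) (α := α')
    hgm hgB hgs (lt_min hα (by norm_num)) (min_le_right _ _) hκ₀ hρ
    (fun j => (measurable_const.max (measurable_const.min (hm j))).const_mul _)
    (fun j w hj => by
      rw [hω', abs_mul, abs_of_nonneg (ha0 j hj)]
      exact mul_le_one₀ (ha1 j hj) (abs_nonneg _) (hclamp _))
    (fun k j hkj => by
      have h1 : μ[ω' (j + 1) | G k] =ᵐ[μ] μ[a (j + 1) • ω (j + 1) | G k] :=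
        condExp_congr_ae (heq j)
      filter_upwards [h1, condExp_smul (a (j + 1)) (ω (j + 1)) (G k) (μ := μ), hd k j hkj]
        with w h1 h2 h3
      rw [h1, h2, Pi.smul_apply, smul_eq_mul, abs_mul, abs_of_nonneg (ha0 _ (by omega))]
      exact (mul_le_of_le_one_left (abs_nonneg _) (ha1 _ (by omega))).trans h3)
  filter_upwards [key, ae_all_iff.2 heq] with w h1 h2
  have h3 : alloyPotential g α' (fun j => ω' j w) = alloyPotential g α fun j => ω j w :=
    alloyPotential_rpow_sub g α α' h2
  have h4 := pruferPhase_congr_ae (alloyPotential_congr_ae hfg α fun j => ω j w)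
  intro c
  have h5 := h1 c
  rw [h3] at h5
  simpa only [relativePhase, h4] using h5

end

end ClockStatistics
-- The two assumptions as instances of the general convergence
theorem proposition6 {Ω : Type*} [mΩ : MeasurableSpace Ω] (μ : Measure Ω)
    [IsProbabilityMeasure μ] (ω : ℕ → Ω → ℝ)
    (f : ℝ → ℝ) (hf : MemLp f ⊤ volume) (hsupp : Function.support f ⊆ Icc 0 1)
    (α : ℝ) (hα : 1 / 2 < α) (κ₀ : ℝ) (hκ₀ : 0 < κ₀) :
    (ClockStatistics.AssumptionA μ ω →
      ∀ᵐ w ∂μ, ∀ c : ℝ,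
        Tendsto (fun n : ℕ =>
          ClockStatistics.relativePhase
            (ClockStatistics.alloyPotential f α (fun j => ω j w)) κ₀ (n : ℝ) c)
          atTop (𝓝 c)) ∧
    (∀ (ℱ : Filtration ℕ mΩ) (ρ : ℝ), ClockStatistics.AssumptionB μ ω ℱ ρ →
      ∀ η β : ℝ, 0 < η → η < α - 1 / 2 → 0 < β → 1 < 2 * η * β →
        ∀ᵐ w ∂μ, ∀ c : ℝ,
          Tendsto (fun k : ℕ =>
            ClockStatistics.relativePhase
              (ClockStatistics.alloyPotential f α (fun j => ω j w)) κ₀ ((k : ℝ) ^ β) c)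
            atTop (𝓝 c)) := by
  constructor
  · intro hA
    have hmeas : ∀ j : ℕ, StronglyMeasurable (ω (j + 1)) := fun j =>
      (hA.measurable (j + 1) (by omega)).stronglyMeasurable
    have key := ClockStatistics.ae_tendsto_relativePhase_of_memLp (μ := μ)
      (G := Filtration.natural (fun j => ω (j + 1)) hmeas) (ω := ω) hf hsupp hα hκ₀ one_pos
      (fun j => (Filtration.stronglyAdapted_natural hmeas j).measurable)
      (fun j => hA.bounded (j + 1) (by omega))
      -- Under independence the prediction of a future amplitude is its mean, namely zero, so any
      -- rate is admissible; the rate 1 is taken.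
      (fun k j hkj => by
        filter_upwards [hA.indep.condExp_natural_ae_eq_of_lt hmeas hkj] with w hw
        rw [hw, hA.mean_zero (j + 1) (by omega), abs_zero]
        exact (Real.exp_pos _).le)
    filter_upwards [key] with w hw c
    exact (hw c).comp tendsto_natCast_atTop_atTop
  · intro ℱ ρ hB η β _ _ hβ _
    have key := ClockStatistics.ae_tendsto_relativePhase_of_memLp (μ := μ) (ω := ω)
      -- The filtration is shifted together with the sequence ω (j + 1); prediction distances are
      -- unchanged.
      (G := ⟨fun j => ℱ (j + 1), fun i j hij => ℱ.mono (by omega), fun i => ℱ.le _⟩)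
      hf hsupp hα hκ₀ hB.rate_pos (fun j => hB.adapted (j + 1) (by omega))
      (fun j => hB.bounded (j + 1) (by omega))
      (fun k j hkj => by
        filter_upwards [hB.decay (k + 1) (j + 1) (by omega) (by omega)] with w hw
        refine hw.trans_eq ?_
        have : (k : ℝ) < j := by exact_mod_cast hkj
        rw [abs_of_pos (by push_cast; linarith)]
        push_cast
        ring_nf)
    filter_upwards [key] with w hw c
    exact (hw c).comp ((tendsto_rpow_atTop hβ).comp tendsto_natCast_atTop_atTop)
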